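/- Let $T>0$, let $(\Omega,\mathcal F,\{\mathcal F_t\}_{0\le t\le T},\mathbb P)$ be a stochastic basis and $W=W(t)$, $0\le t\le T$, a standard Wiener process on it. Let $\Lambda = 1-\frac{T^2}{\pi^2}\frac{d^2}{dt^2}$ on $(0,T)$ with Neumann boundary conditions; its eigenfunctions are the cosine basis $m_1=1/\sqrt T$, $m_k(t)=\sqrt{2/T}\cos(\pi(k-1)t/T)$, $k>1$, of $L_2((0,T))$, with eigenvalues $\lambda_k=1+(k-1)^2$. For $s\in\mathbb R$ put $\|f\|_s^2=\|\Lambda^{s/2}f\|_{L_2((0,T))}^2=\sum_{k\ge1}\lambda_k^{s}\,\big(\int_0^T f m_k\,dt\big)^2\in[0,\infty]$, and for functions on $[0,T]^k$ let $\|\cdot\|_s$ be the corresponding tensor product norm. For $p,q\in\mathbb R$ let $(\mathfrak L)_{p,q}(\mathbb W;\mathbb R)$ be the closure (completion) of the set of random variables $$\eta=\eta_0+\sum_{k=1}^N\int_0^T\int_0^{s_k}\cdots\int_0^{s_2}\eta_k(s_1,\ldots,s_k)\,dW(s_1)\cdots dW(s_k),$$ where $N\ge 1$, $\eta_0\in\mathbb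 R$ and each $\eta_k$ is a smooth symmetric function on $[0,T]^k$ with $\|\eta_k\|_q<\infty$, with respect to the norm $$\|\eta\|_{p,q}^2=|\eta_0|^2+\sum_{k=1}^N\frac{2^{kp}}{(k!)^2}\|\eta_k\|_q^2 .$$ Let $(\mathfrak L)^{p,q}(\mathbb W)$ be the dual of $(\mathfrak L)_{p,q}(\mathbb W;\mathbb R)$ relative to the inner product of $L_2(\mathbb W;\mathbb R)$, the space of square integrable random variables that are measurable with respect to the sigma-algebra generated by $W(t)$, $t\in[0,T]$: a random variable $\zeta\in L_2(\mathbb W;\mathbb R)$ belongs to $(\mathfrak L)^{p,q}(\mathbb W)$ if and only if $\eta\mapsto\mathbb E(\eta\zeta)$ extends from the random variables $\eta$ above to a continuous linear functional on $(\mathfrak L)_{p,q}(\mathbb W;\mathbb R)$. For $h\in L_2((0,T))$ let $$\mathcal E_h=\exp\Big(\int_0^T h(s)\,dW(s)-\frac12\int_0^T|h(s)|^2\,ds\Big).$$ Then, for all $p,q\in\mathbb R$ and every $h\in L_2((0,T))$, $$\mathcal E_h\in(\mathfrak L)^{p,q}(\mathbb W)\quad\Longleftrightarrow\quad \|h\|_{-q}^2<2^p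 .$$ -/

import Mathlib

open MeasureTheory ProbabilityTheory Filter Topology
open scoped ENNReal NNReal

namespace WienerChaos

noncomputable section

/-! ### The operator `Λ = 1 - (T² / π²) d²/dt²` with Neumann boundary conditions -/

/-- The cosine orthonormal basis of `L₂((0,T))`, numbered from `0`. -/
def cosBasis (T : ℝ) (n : ℕ) (t : ℝ) : ℝ :=
  if n = 0 then 1 / √T else √(2 / T) * Real.cos (Real.pi * n * t / T)

/-- The eigenvalue of `Λ` at `cosBasis T n`, see `cosBasis_eigenfunction`. -/
def eigenvalue (n : ℕ) : ℝ := 1 + (n : ℝ) ^ 2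

theorem eigenvalue_pos (n : ℕ) : 0 < eigenvalue n := by
  unfold eigenvalue; positivity

theorem cosBasis_continuous (T : ℝ) (n : ℕ) : Continuous (cosBasis T n) := by
  unfold cosBasis
  split_ifs <;> fun_prop

theorem deriv_cosBasis (T : ℝ) (n : ℕ) :
    deriv (cosBasis T n) = fun t =>
      -(√(2 / T) * (Real.pi * n / T) * Real.sin (Real.pi * n * t / T)) := by
  funext t
  by_cases hn : n = 0
  · have : cosBasis T n = fun _ => 1 / √T := by funext s; simp [cosBasis, hn]
    rw [this]; simp [hn]
  · have h0 : cosBasis T n = fun s => √(2 / T) * Real.cos (Real.pi * n * s / T) := by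
      funext s; simp [cosBasis, hn]
    rw [h0]
    have h1 : HasDerivAt (fun s : ℝ => Real.pi * n * s / T) (Real.pi * n / T) t := by
      simpa using ((hasDerivAt_id t).const_mul (Real.pi * n)).div_const T
    have h2 := (h1.cos).const_mul (√(2 / T))
    rw [h2.deriv]; ring

/-- `cosBasis T n` satisfies the Neumann boundary conditions and
`cosBasis T n - (T² / π²) (cosBasis T n)'' = eigenvalue n • cosBasis T n`. -/
theorem cosBasis_eigenfunction (T : ℝ) (hT : 0 < T) (n : ℕ) :
    deriv (cosBasis T n) 0 = 0 ∧ deriv (cosBasis T n) T = 0 ∧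
      ∀ t, cosBasis T n t - T ^ 2 / Real.pi ^ 2 * deriv (deriv (cosBasis T n)) t =
        eigenvalue n * cosBasis T n t := by
  have hT' : T ≠ 0 := hT.ne'
  refine ⟨by simp [deriv_cosBasis], ?_, fun t => ?_⟩
  · rw [deriv_cosBasis]
    have : Real.pi * n * T / T = n * Real.pi := by field_simp
    simp [this, Real.sin_nat_mul_pi]
  · have h1 : HasDerivAt (fun s : ℝ => Real.pi * n * s / T) (Real.pi * n / T) t := by
      simpa using ((hasDerivAt_id t).const_mul (Real.pi * n)).div_const T
    have h2 := ((h1.sin).const_mul (√(2 / T) * (Real.pi * n / T))).neg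
    rw [deriv_cosBasis]
    have h3 := h2.deriv
    simp only [Pi.neg_def] at h3
    rw [h3]
    unfold cosBasis eigenvalue
    split_ifs with hn
    · simp [hn]
    · have := Real.pi_ne_zero
      field_simp
      ring

/-- `‖h‖_s² = ‖Λ^{s/2} h‖²_{L₂((0,T))}` for a function `h` of one variable and any real `s`,
`Λ^{s/2}` being given by its spectral decomposition; the value `∞` is allowed. -/
def sobolevNormSq (T s : ℝ) (h : ℝ → ℝ) : ℝ≥0∞ :=
  ∑' n : ℕ, ENNReal.ofReal (eigenvalue n ^ s * (∫ t in Set.Icc 0 T, h t * cosBasis T n t) ^ 2)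

/-! ### Kernels: functions on `[0,T]^k` -/

/-- The cube `[0,T]^k`. -/
def cube (T : ℝ) (k : ℕ) : Set (Fin k → ℝ) := Set.univ.pi fun _ => Set.Icc 0 T

/-- The coefficients of a function on `[0,T]^k` in the tensor product cosine basis. -/
def kernelCoef (T : ℝ) {k : ℕ} (f : (Fin k → ℝ) → ℝ) (i : Fin k → ℕ) : ℝ :=
  ∫ x in cube T k, f x * ∏ j, cosBasis T (i j) (x j)

/-- The squared norm of a function on `[0,T]^k` in the `k`-fold Hilbert space tensor power
of `H^s((0,T))`; the value `∞` is allowed. -/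
def kernelNormSq (T s : ℝ) {k : ℕ} (f : (Fin k → ℝ) → ℝ) : ℝ≥0∞ :=
  ∑' i : Fin k → ℕ, ENNReal.ofReal ((∏ j, eigenvalue (i j) ^ s) * kernelCoef T f i ^ 2)

theorem kernelCoef_add (T : ℝ) {k : ℕ} {f g : (Fin k → ℝ) → ℝ} (hf : ContinuousOn f (cube T k))
    (hg : ContinuousOn g (cube T k)) (i : Fin k → ℕ) :
    kernelCoef T (f + g) i = kernelCoef T f i + kernelCoef T g i := by
  have hc : IsCompact (cube T k) := isCompact_univ_pi fun _ => isCompact_Icc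
  have hm : Continuous fun x : Fin k → ℝ => ∏ j, cosBasis T (i j) (x j) :=
    continuous_finsetProd _ fun j _ => (cosBasis_continuous T (i j)).comp (continuous_apply j)
  have h1 : IntegrableOn (fun x => f x * ∏ j, cosBasis T (i j) (x j)) (cube T k) :=
    (hf.mul hm.continuousOn).integrableOn_compact hc
  have h2 : IntegrableOn (fun x => g x * ∏ j, cosBasis T (i j) (x j)) (cube T k) :=
    (hg.mul hm.continuousOn).integrableOn_compact hc
  unfold kernelCoef
  rw [← integral_add h1 h2]
  simp [add_mul]

theorem kernelCoef_smul (T c : ℝ) {k : ℕ} (f : (Fin k → ℝ) → ℝ) (i : Fin k → ℕ) :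
    kernelCoef T (c • f) i = c * kernelCoef T f i := by
  unfold kernelCoef
  rw [← integral_const_mul]
  simp [mul_assoc]

theorem kernelNormSq_eq (T s : ℝ) {k : ℕ} (f : (Fin k → ℝ) → ℝ) :
    kernelNormSq T s f =
      eLpNorm (fun i => √(∏ j, eigenvalue (i j) ^ s) * kernelCoef T f i) 2 Measure.count ^ 2 := by
  rw [eLpNorm_eq_lintegral_rpow_enorm_toReal (by norm_num) (by norm_num), lintegral_count,
    ← ENNReal.rpow_natCast, ← ENNReal.rpow_mul]
  norm_num
  unfold kernelNormSq
  refine tsum_congr fun i => ?_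
  have hp : 0 ≤ ∏ j, eigenvalue (i j) ^ s :=
    Finset.prod_nonneg fun j _ => Real.rpow_nonneg (eigenvalue_pos _).le _
  rw [← enorm_mul, Real.enorm_eq_ofReal_abs, ← ENNReal.ofReal_pow (abs_nonneg _), sq_abs, mul_pow,
    Real.sq_sqrt hp]

/-- `‖f‖_s` as a real number, for kernels with a finite norm. -/
def kernelNorm (T s : ℝ) {k : ℕ} (f : (Fin k → ℝ) → ℝ) : ℝ := √(kernelNormSq T s f).toReal

theorem kernelNorm_eq (T s : ℝ) {k : ℕ} (f : (Fin k → ℝ) → ℝ) :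
    kernelNorm T s f =
      (eLpNorm (fun i => √(∏ j, eigenvalue (i j) ^ s) * kernelCoef T f i) 2
        Measure.count).toReal := by
  rw [kernelNorm, kernelNormSq_eq, ENNReal.toReal_pow, Real.sqrt_sq ENNReal.toReal_nonneg]

theorem kernelNormSq_lt_top (T s : ℝ) {k : ℕ} (f : (Fin k → ℝ) → ℝ) :
    kernelNormSq T s f < ∞ ↔
      eLpNorm (fun i => √(∏ j, eigenvalue (i j) ^ s) * kernelCoef T f i) 2 Measure.count < ∞ := by
  rw [kernelNormSq_eq, ENNReal.pow_lt_top_iff]; simp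

theorem eLpNorm_kernel_add (T s : ℝ) {k : ℕ} {f g : (Fin k → ℝ) → ℝ}
    (hf : ContinuousOn f (cube T k)) (hg : ContinuousOn g (cube T k)) :
    eLpNorm (fun i => √(∏ j, eigenvalue (i j) ^ s) * kernelCoef T (f + g) i) 2 Measure.count ≤
      eLpNorm (fun i => √(∏ j, eigenvalue (i j) ^ s) * kernelCoef T f i) 2 Measure.count +
      eLpNorm (fun i => √(∏ j, eigenvalue (i j) ^ s) * kernelCoef T g i) 2 Measure.count := by
  refine le_trans (le_of_eq ?_) (eLpNorm_add_le (Measurable.of_discrete.aestronglyMeasurable)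
    (Measurable.of_discrete.aestronglyMeasurable) (by norm_num))
  congr 1
  funext i
  simp [kernelCoef_add T hf hg i, mul_add]

theorem eLpNorm_kernel_smul (T s c : ℝ) {k : ℕ} (f : (Fin k → ℝ) → ℝ) :
    eLpNorm (fun i => √(∏ j, eigenvalue (i j) ^ s) * kernelCoef T (c • f) i) 2 Measure.count =
      ‖c‖ₑ *
      eLpNorm (fun i => √(∏ j, eigenvalue (i j) ^ s) * kernelCoef T f i) 2 Measure.count := by
  rw [← eLpNorm_const_smul]
  congr 1
  funext i
  simp [kernelCoef_smul]
  ring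

/-- The smooth symmetric functions on `[0,T]^k` whose norm `‖·‖_q` is finite. For `k = 0` these
are the constants. The values outside the cube play no role. -/
def smoothKernel (T q : ℝ) (k : ℕ) : Submodule ℝ ((Fin k → ℝ) → ℝ) where
  carrier := {f | ContDiffOn ℝ ((⊤ : ℕ∞) : WithTop ℕ∞) f (cube T k) ∧
    (∀ σ : Equiv.Perm (Fin k), ∀ x ∈ cube T k, f (x ∘ σ) = f x) ∧ kernelNormSq T q f < ∞}
  add_mem' := by
    rintro f g ⟨hf, hf', hf''⟩ ⟨hg, hg', hg''⟩
    refine ⟨hf.add hg, fun σ x hx => by simp [hf' σ x hx, hg' σ x hx], ?_⟩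
    rw [kernelNormSq_lt_top] at *
    exact (eLpNorm_kernel_add T q hf.continuousOn hg.continuousOn).trans_lt
      (ENNReal.add_lt_top.2 ⟨hf'', hg''⟩)
  zero_mem' := by
    refine ⟨contDiffOn_const, fun _ _ _ => rfl, ?_⟩
    simp [kernelNormSq, kernelCoef]
  smul_mem' := by
    rintro c f ⟨hf, hf', hf''⟩
    refine ⟨hf.const_smul c, fun σ x hx => by simp [hf' σ x hx], ?_⟩
    rw [kernelNormSq_lt_top] at *
    rw [eLpNorm_kernel_smul]
    exact ENNReal.mul_lt_top (by simp) hf''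

theorem kernelNorm_add_le {T q : ℝ} {k : ℕ} (f g : smoothKernel T q k) :
    kernelNorm T q (f + g : smoothKernel T q k).1 ≤ kernelNorm T q f.1 + kernelNorm T q g.1 := by
  have hf := (kernelNormSq_lt_top T q f.1).1 f.2.2.2
  have hg := (kernelNormSq_lt_top T q g.1).1 g.2.2.2
  simp only [kernelNorm_eq]
  rw [← ENNReal.toReal_add hf.ne hg.ne]
  exact ENNReal.toReal_mono (ENNReal.add_lt_top.2 ⟨hf, hg⟩).ne
    (eLpNorm_kernel_add T q f.2.1.continuousOn g.2.1.continuousOn)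

theorem kernelNorm_smul {T q : ℝ} {k : ℕ} (c : ℝ) (f : smoothKernel T q k) :
    kernelNorm T q (c • f : smoothKernel T q k).1 = |c| * kernelNorm T q f.1 := by
  simp only [kernelNorm_eq]
  have h : ((c • f : smoothKernel T q k) : (Fin k → ℝ) → ℝ) = c • f.1 := rfl
  rw [h, eLpNorm_kernel_smul, ENNReal.toReal_mul]
  simp

/-! ### The space `(𝔏)_{p,q}(𝕎; ℝ)` -/

/-- The finite chaos expansions `η = η₀ + ∑_{k=1}^N ∫_0^T ∫_0^{s_k} ⋯ ∫_0^{s_2} η_k dW ⋯ dW`,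
given by their kernels `(η_k)`, where `η₀` is the kernel in zero variables. The parameter `p`
enters through the norm. The random variable itself is `SimpleElement.toLp` below. -/
def SimpleElement (T _p q : ℝ) : Type := Π₀ k : ℕ, smoothKernel T q k

instance (T p q : ℝ) : AddCommGroup (SimpleElement T p q) :=
  inferInstanceAs (AddCommGroup (Π₀ k : ℕ, smoothKernel T q k))

instance (T p q : ℝ) : Module ℝ (SimpleElement T p q) :=
  inferInstanceAs (Module ℝ (Π₀ k : ℕ, smoothKernel T q k))

namespace SimpleElement

variable {T p q : ℝ}

/-- The kernel `η_k`. -/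
def kernel (η : SimpleElement T p q) (k : ℕ) : smoothKernel T q k :=
  (show Π₀ k : ℕ, smoothKernel T q k from η) k

open Classical in
/-- The finitely many `k` with `η_k ≠ 0`. -/
def support (η : SimpleElement T p q) : Finset ℕ :=
  DFinsupp.support (show Π₀ k : ℕ, smoothKernel T q k from η)

/-- `‖η‖_{p,q}² = ∑_k 2^{kp} / (k!)² ‖η_k‖_q²`. -/
def normSq (η : SimpleElement T p q) : ℝ :=
  ∑ k ∈ η.support,
    (2 : ℝ) ^ ((k : ℝ) * p) / (k.factorial : ℝ) ^ 2 * kernelNorm T q (η.kernel k).1 ^ 2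

theorem kernel_add (η ζ : SimpleElement T p q) (k : ℕ) :
    (η + ζ).kernel k = η.kernel k + ζ.kernel k := rfl

theorem kernel_smul (c : ℝ) (η : SimpleElement T p q) (k : ℕ) :
    (c • η).kernel k = c • η.kernel k := rfl

theorem kernelNorm_of_notMem {η : SimpleElement T p q} {k : ℕ} (hk : k ∉ η.support) :
    kernelNorm T q (η.kernel k).1 = 0 := by
  have : η.kernel k = 0 := by
    classical
    by_contra h
    exact hk (DFinsupp.mem_support_iff.2 h)
  rw [this]
  simp [kernelNorm, kernelNormSq, kernelCoef]

theorem sqrt_normSq_eq (η : SimpleElement T p q) {s : Finset ℕ} (hs : η.support ⊆ s) :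
    √η.normSq = (∑ k ∈ s, (√((2 : ℝ) ^ ((k : ℝ) * p) / (k.factorial : ℝ) ^ 2) *
      kernelNorm T q (η.kernel k).1) ^ (2 : ℝ)) ^ (1 / (2 : ℝ)) := by
  rw [← Real.sqrt_eq_rpow, normSq, Finset.sum_subset hs
    (fun k _ hk => by simp [kernelNorm_of_notMem hk])]
  congr 1
  refine Finset.sum_congr rfl fun k _ => ?_
  rw [Real.rpow_two, mul_pow, Real.sq_sqrt (by positivity)]

/-- `‖·‖_{p,q}` as a seminorm. -/
def seminorm (T p q : ℝ) : Seminorm ℝ (SimpleElement T p q) :=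
  Seminorm.of (fun η => √η.normSq)
    (fun η ζ => by
      have h1 : (η + ζ).support ⊆ (η + ζ).support ∪ (η.support ∪ ζ.support) :=
        Finset.subset_union_left
      have h2 : η.support ⊆ (η + ζ).support ∪ (η.support ∪ ζ.support) :=
        Finset.subset_union_left.trans Finset.subset_union_right
      have h3 : ζ.support ⊆ (η + ζ).support ∪ (η.support ∪ ζ.support) :=
        Finset.subset_union_right.trans Finset.subset_union_right
      have nn : ∀ (ξ : SimpleElement T p q) (k : ℕ), 0 ≤ kernelNorm T q (ξ.kernel k).1 :=
        fun ξ k => Real.sqrt_nonneg _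
      rw [sqrt_normSq_eq _ h1, sqrt_normSq_eq _ h2, sqrt_normSq_eq _ h3]
      refine le_trans ?_ (Real.Lp_add_le_of_nonneg _ one_le_two
        (fun k _ => mul_nonneg (Real.sqrt_nonneg _) (nn η k))
        (fun k _ => mul_nonneg (Real.sqrt_nonneg _) (nn ζ k)))
      refine Real.rpow_le_rpow (Finset.sum_nonneg fun k _ =>
        Real.rpow_nonneg (mul_nonneg (Real.sqrt_nonneg _) (nn _ k)) _) ?_ (by norm_num)
      refine Finset.sum_le_sum fun k _ => ?_
      refine Real.rpow_le_rpow (mul_nonneg (Real.sqrt_nonneg _) (nn _ k)) ?_ (by norm_num)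
      rw [← mul_add, kernel_add]
      exact mul_le_mul_of_nonneg_left (kernelNorm_add_le _ _) (Real.sqrt_nonneg _))
    (fun c η => by
      have h : (c • η).normSq = c ^ 2 * η.normSq := by
        have h1 : (c • η).support ⊆ (c • η).support ∪ η.support := Finset.subset_union_left
        have h2 : η.support ⊆ (c • η).support ∪ η.support := Finset.subset_union_right
        rw [normSq, normSq, Finset.sum_subset h1
          (fun k _ hk => by simp [kernelNorm_of_notMem hk]), Finset.sum_subset h2
          (fun k _ hk => by simp [kernelNorm_of_notMem hk]), Finset.mul_sum]
        refine Finset.sum_congr rfl fun k _ => ?_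
        rw [kernel_smul, kernelNorm_smul, mul_pow, sq_abs]
        ring
      rw [h, Real.sqrt_mul (sq_nonneg c), Real.sqrt_sq_eq_abs, Real.norm_eq_abs])

instance : SeminormedAddCommGroup (SimpleElement T p q) :=
  (seminorm T p q).toAddGroupSeminorm.toSeminormedAddCommGroup

theorem norm_def (η : SimpleElement T p q) : ‖η‖ = √η.normSq := rfl

instance : NormedSpace ℝ (SimpleElement T p q) where
  norm_smul_le c η := le_of_eq ((seminorm T p q).smul' c η)

end SimpleElement

/-- The space `(𝔏)_{p,q}(𝕎; ℝ)`: the closure (completion) of the finite chaos expansions with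
respect to `‖·‖_{p,q}`. -/
abbrev ChaosSpace (T p q : ℝ) : Type := UniformSpace.Completion (SimpleElement T p q)

/-! ### Wiener process and stochastic integrals -/

section Stochastic

variable {Ω : Type*} [mΩ : MeasurableSpace Ω] (P : Measure Ω) [IsProbabilityMeasure P]
  (T : ℝ) (𝓕 : Filtration ℝ mΩ) (W : ℝ → Ω → ℝ)

/-- `W` is a standard Wiener process on the time interval `[0,T]` relative to the filtration
`(𝓕_t)_{0 ≤ t ≤ T}`. Nothing is required of times outside `[0,T]`. -/
structure IsWienerProcess : Prop where
  adapted : ∀ t ∈ Set.Icc 0 T, Measurable[𝓕 t] (W t)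
  zero : ∀ᵐ ω ∂P, W 0 ω = 0
  law : ∀ s ∈ Set.Icc 0 T, ∀ t ∈ Set.Icc 0 T, s ≤ t →
    P.map (fun ω => W t ω - W s ω) = gaussianReal 0 (Real.toNNReal (t - s))
  indep : ∀ s ∈ Set.Icc 0 T, ∀ t ∈ Set.Icc 0 T, s ≤ t →
    Indep (MeasurableSpace.comap (fun ω => W t ω - W s ω) inferInstance) (𝓕 s) P
  continuous_paths : ∀ᵐ ω ∂P, ContinuousOn (fun t => W t ω) (Set.Icc 0 T)

/-- The sigma-algebra generated by `W(t)`, `t ∈ [0,T]`. -/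
abbrev wienerSigma : MeasurableSpace Ω :=
  ⨆ t ∈ Set.Icc 0 T, MeasurableSpace.comap (W t) inferInstance

/-- A bounded simple adapted process `∑_{i<n} c_i 1_{(t_i, t_{i+1}]}` on `[0,t]`, where `c_i` is
`𝓕_{t_i}`-measurable. -/
structure SimpleProcess {Ω : Type*} [mΩ : MeasurableSpace Ω] (𝓕 : Filtration ℝ mΩ) (t : ℝ) where
  n : ℕ
  node : ℕ → ℝ
  node_mono : Monotone node
  node_mem : ∀ i, node i ∈ Set.Icc 0 t
  coef : ℕ → Ω → ℝ
  coef_meas : ∀ i, Measurable[𝓕 (node i)] (coef i)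
  coef_bdd : ∃ C, ∀ i ω, |coef i ω| ≤ C

namespace SimpleProcess

variable {𝓕} {t : ℝ}

/-- The value of a simple process at the time `s`. -/
def value (φ : SimpleProcess 𝓕 t) (s : ℝ) (ω : Ω) : ℝ :=
  ∑ i ∈ Finset.range φ.n, (Set.Ioc (φ.node i) (φ.node (i + 1))).indicator (fun _ => φ.coef i ω) s

/-- The stochastic integral `∑_{i<n} c_i (W(t_{i+1}) - W(t_i))` of a simple process. -/
def integral (φ : SimpleProcess 𝓕 t) (ω : Ω) : ℝ :=
  ∑ i ∈ Finset.range φ.n, φ.coef i ω * (W (φ.node (i + 1)) ω - W (φ.node i) ω)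

end SimpleProcess

/-- `Y = ∫_0^t Φ(s) dW(s)` (Itô integral). The integrand is a process with values in `L₂(Ω)`,
viewed as a measurable curve in `L₂(Ω)`; it is the limit in `L₂([0,t] × Ω)` of simple adapted
processes (so that it is adapted and square integrable itself), and `Y` is the limit in `L₂(Ω)` of
their stochastic integrals. -/
def IsItoIntegral (t : ℝ) (Φ : ℝ → Lp ℝ 2 P) (Y : Lp ℝ 2 P) : Prop :=
  AEStronglyMeasurable Φ (volume.restrict (Set.Icc 0 t)) ∧
  ∃ φ : ℕ → SimpleProcess 𝓕 t,
    Tendsto (fun n => ∫⁻ s in Set.Icc 0 t,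
      eLpNorm (fun ω => (φ n).value s ω - Φ s ω) 2 P ^ 2) atTop (𝓝 0) ∧
    Tendsto (fun n => eLpNorm (fun ω => (φ n).integral W ω - Y ω) 2 P) atTop (𝓝 0)

/-- `Y = ∫_0^t ∫_0^{s_k} ⋯ ∫_0^{s_2} f(s_1, …, s_k) dW(s_1) ⋯ dW(s_{k-1}) dW(s_k)`, by recursion:
the outermost integrand at the time `s_k = s` is the `(k-1)`-fold iterated integral of
`f(·, …, ·, s)` up to the time `s`. -/
def IsIteratedIto : (k : ℕ) → ((Fin k → ℝ) → ℝ) → ℝ → Lp ℝ 2 P → Prop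
  | 0, f, _, Y => Y = Lp.const 2 P (f Fin.elim0)
  | k + 1, f, t, Y => ∃ Φ : ℝ → Lp ℝ 2 P,
      (∀ᵐ s ∂volume.restrict (Set.Icc 0 t),
        IsIteratedIto k (fun x => f (Fin.snoc x s)) s (Φ s)) ∧
      IsItoIntegral P 𝓕 W t Φ Y

open Classical in
/-- The Itô integral `∫_0^t Φ(s) dW(s)` (and `0` if it does not exist). -/
def itoIntegral (t : ℝ) (Φ : ℝ → Lp ℝ 2 P) : Lp ℝ 2 P :=
  if h : ∃ Y, IsItoIntegral P 𝓕 W t Φ Y then h.choose else 0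

open Classical in
/-- The iterated Itô integral of a kernel over `[0,t]` (and `0` if it does not exist). -/
def iteratedIto {k : ℕ} (f : (Fin k → ℝ) → ℝ) (t : ℝ) : Lp ℝ 2 P :=
  if h : ∃ Y, IsIteratedIto P 𝓕 W k f t Y then h.choose else 0

/-- The random variable
`η₀ + ∑_{k=1}^N ∫_0^T ∫_0^{s_k} ⋯ ∫_0^{s_2} η_k(s_1, …, s_k) dW(s_1) ⋯ dW(s_k)`. -/
def SimpleElement.toLp {T p q : ℝ} (η : SimpleElement T p q) : Lp ℝ 2 P :=
  ∑ k ∈ η.support, iteratedIto P 𝓕 W (η.kernel k).1 T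

/-- The random variable `ζ ∈ L₂(𝕎; ℝ)` is an element of `(𝔏)^{p,q}(𝕎)`, the dual space of
`(𝔏)_{p,q}(𝕎; ℝ)` relative to the inner product of `L₂(𝕎; ℝ)`: there is a continuous linear
functional on `(𝔏)_{p,q}(𝕎; ℝ)` that equals `η ↦ E(η ζ)` on the finite chaos expansions. -/
structure MemDual (p q : ℝ) (ζ : Ω → ℝ) : Prop where
  memLp : MemLp ζ 2 P
  measurable : AEStronglyMeasurable[wienerSigma T W] ζ P
  exists_functional : ∃ ℓ : StrongDual ℝ (ChaosSpace T p q), ∀ η : SimpleElement T p q,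
    ℓ (η : ChaosSpace T p q) = ∫ ω, η.toLp P 𝓕 W ω * ζ ω ∂P

/-- The stochastic exponential `exp (∫_0^T h(s) dW(s) - ½ ∫_0^T |h(s)|² ds)`. -/
def stochExp (h : ℝ → ℝ) (ω : Ω) : ℝ :=
  Real.exp (itoIntegral P 𝓕 W T (fun s => Lp.const 2 P (h s)) ω
    - 1 / 2 * ∫ s in Set.Icc 0 T, |h s| ^ 2)

end Stochastic

end

end WienerChaos

namespace WienerChaos

set_option linter.unusedSectionVars false

noncomputable section

/-! ### Increments of a Wiener process -/

namespace IsWienerProcess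

variable {Ω : Type*} [mΩ : MeasurableSpace Ω] {P : Measure Ω} [IsProbabilityMeasure P]
  {T : ℝ} {𝓕 : Filtration ℝ mΩ} {W : ℝ → Ω → ℝ}

/-! Everything rests on the formula E(η 𝓔_h) = ∑_k (1/k!) ⟨η_k, h ⊗ ⋯ ⊗ h⟩, the pairing being the
integral over [0,T]^k (`SimpleElement.integral_toLp_mul_stochExp`). Given it, the question is when
this functional is bounded for ‖·‖_{p,q}. Since ‖·‖_q and ‖·‖_{-q} are dual and ‖h ⊗ ⋯ ⊗ h‖_{-q} =
‖h‖_{-q}^k, the term of order k is at most r^{k/2} times the k-th part of the norm of η, where r =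
‖h‖_{-q}² / 2^p. If r < 1, Cauchy–Schwarz and the geometric series bound the functional
(`SimpleElement.abs_pairing_le`).

Conversely, let g be a truncation of Λ^{-q} h and S = ‖g‖_q² = ⟨g, h⟩, a partial sum of ‖h‖_{-q}².
On the element with kernels k! 2^{-kp} g ⊗ ⋯ ⊗ g, k < K, the functional and the squared norm have
the same value A = ∑_{k<K} (S/2^p)^k. A bound C of the functional thus forces A ≤ C√A, so A ≤ C² for
all K and all truncations, which is impossible if ‖h‖_{-q}² ≥ 2^p (`geom_sum_le_of_pairing_le`,
`sobolevNormSq_lt_of_pairing_le`). Truncation keeps g smooth and makes the argument cover an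
infinite norm of h.

The formula comes from integration by parts, E[(∫_0^t Φ dW) 𝓔_h] = ∫_0^t h(s) E[Φ(s) 𝓔_h] ds
(`IsItoIntegral.integral_mul_stochExp`). For Φ = c 1_{(a,b]} with c known at time a, it is the
derivative at ε = 0 of E[c exp(∫ h dW + ε (W(b) - W(a)))]. This expectation is explicit because a
Wiener integral over (a,T] is Gaussian and independent of the past. Both sides are inner products
with Φ in Hilbert spaces matched by the Itô isometry, so the identity passes to limits. Iterating it
turns a chaos integral into an integral over a simplex, which for a symmetric kernel is 1/k! of the
integral over the cube (`iteratedIntegral_eq`).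

As stochastic integrals are defined by choice among admissible values, their existence (and, for
Wiener integrals, uniqueness) has to be supplied as well. For iterated integrals this uses
continuity of the inner integral in its upper limit (`exists_isIteratedIto`). -/

theorem measurable_incr (hW : IsWienerProcess P T 𝓕 W) {a b u : ℝ} (ha : a ∈ Set.Icc 0 T)
    (hb : b ∈ Set.Icc 0 T) (hau : a ≤ u) (hbu : b ≤ u) :
    Measurable[𝓕 u] (fun ω => W b ω - W a ω) :=
  Measurable.sub ((hW.adapted b hb).mono (𝓕.mono hbu) le_rfl)
    ((hW.adapted a ha).mono (𝓕.mono hau) le_rfl)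

theorem measurable_incr' (hW : IsWienerProcess P T 𝓕 W) {a b : ℝ} (ha : a ∈ Set.Icc 0 T)
    (hb : b ∈ Set.Icc 0 T) : Measurable (fun ω => W b ω - W a ω) :=
  (hW.measurable_incr ha hb (le_max_left a b) (le_max_right a b)).mono (𝓕.le _) le_rfl

theorem memLp_incr (hW : IsWienerProcess P T 𝓕 W) {a b : ℝ} (ha : a ∈ Set.Icc 0 T)
    (hb : b ∈ Set.Icc 0 T) (hab : a ≤ b) : MemLp (fun ω => W b ω - W a ω) 2 P := by
  have h := memLp_id_gaussianReal' (μ := 0) (v := Real.toNNReal (b - a)) 2 (by simp)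
  rw [← hW.law a ha b hb hab] at h
  exact (memLp_map_measure_iff (by fun_prop) (hW.measurable_incr' ha hb).aemeasurable).1 h

theorem integral_incr (hW : IsWienerProcess P T 𝓕 W) {a b : ℝ} (ha : a ∈ Set.Icc 0 T)
    (hb : b ∈ Set.Icc 0 T) (hab : a ≤ b) : ∫ ω, (W b ω - W a ω) ∂P = 0 := by
  have h := integral_id_gaussianReal (μ := 0) (v := Real.toNNReal (b - a))
  rw [← hW.law a ha b hb hab, integral_map (hW.measurable_incr' ha hb).aemeasurable
    (by fun_prop)] at h
  exact h

theorem integral_incr_sq (hW : IsWienerProcess P T 𝓕 W) {a b : ℝ} (ha : a ∈ Set.Icc 0 T)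
    (hb : b ∈ Set.Icc 0 T) (hab : a ≤ b) : ∫ ω, (W b ω - W a ω) ^ 2 ∂P = b - a := by
  have h := variance_id_gaussianReal (μ := 0) (v := Real.toNNReal (b - a))
  rw [variance_eq_integral (by fun_prop)] at h
  simp only [id, integral_id_gaussianReal, sub_zero] at h
  rw [← hW.law a ha b hb hab, integral_map (hW.measurable_incr' ha hb).aemeasurable
    (by fun_prop), Real.coe_toNNReal _ (by linarith)] at h
  exact h

theorem indepFun_incr (hW : IsWienerProcess P T 𝓕 W) {β : Type*} [MeasurableSpace β] {a b : ℝ}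
    (ha : a ∈ Set.Icc 0 T) (hb : b ∈ Set.Icc 0 T) (hab : a ≤ b) {Z : Ω → β}
    (hZ : Measurable[𝓕 a] Z) : IndepFun Z (fun ω => W b ω - W a ω) P := by
  rw [IndepFun_iff_Indep]
  exact indep_of_indep_of_le_left (hW.indep a ha b hb hab).symm hZ.comap_le

theorem integral_mul_incr (hW : IsWienerProcess P T 𝓕 W) {a b : ℝ}
    (ha : a ∈ Set.Icc 0 T) (hb : b ∈ Set.Icc 0 T) (hab : a ≤ b) {Z : Ω → ℝ}
    (hZ : Measurable[𝓕 a] Z) : ∫ ω, Z ω * (W b ω - W a ω) ∂P = 0 := by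
  rw [(hW.indepFun_incr ha hb hab hZ).integral_fun_mul_eq_mul_integral
    (hZ.mono (𝓕.le _) le_rfl).aestronglyMeasurable
    (hW.measurable_incr' ha hb).aestronglyMeasurable, hW.integral_incr ha hb hab, mul_zero]

theorem integral_mul_incr_sq (hW : IsWienerProcess P T 𝓕 W) {a b : ℝ}
    (ha : a ∈ Set.Icc 0 T) (hb : b ∈ Set.Icc 0 T) (hab : a ≤ b) {Z : Ω → ℝ}
    (hZ : Measurable[𝓕 a] Z) :
    ∫ ω, Z ω * (W b ω - W a ω) ^ 2 ∂P = (∫ ω, Z ω ∂P) * (b - a) := by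
  have h := (hW.indepFun_incr ha hb hab hZ).comp measurable_id (measurable_id.pow_const 2)
  rw [← hW.integral_incr_sq ha hb hab]
  exact h.integral_fun_mul_eq_mul_integral
    (hZ.mono (𝓕.le _) le_rfl).aestronglyMeasurable
    ((hW.measurable_incr' ha hb).pow_const 2).aestronglyMeasurable

theorem integrable_mul_incr_mul_incr (hW : IsWienerProcess P T 𝓕 W) {a b c d C : ℝ}
    (ha : a ∈ Set.Icc 0 T) (hb : b ∈ Set.Icc 0 T) (hab : a ≤ b) (hc : c ∈ Set.Icc 0 T)
    (hd : d ∈ Set.Icc 0 T) (hcd : c ≤ d) {Z : Ω → ℝ} (hZ : Measurable Z) (hC : ∀ ω, |Z ω| ≤ C) :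
    Integrable (fun ω => Z ω * ((W b ω - W a ω) * (W d ω - W c ω))) P :=
  ((hW.memLp_incr ha hb hab).integrable_mul (hW.memLp_incr hc hd hcd)).bdd_mul
    hZ.aestronglyMeasurable (.of_forall hC)

/-- Split the longer increment at `y`. The square of the common part contributes its length, and the
remaining increment is centred and independent of everything known at `y`. -/
theorem integral_mul_incr_mul_incr_of_le (hW : IsWienerProcess P T 𝓕 W) {x y z C : ℝ}
    (hx : x ∈ Set.Icc 0 T) (hy : y ∈ Set.Icc 0 T) (hz : z ∈ Set.Icc 0 T) (hxy : x ≤ y)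
    (hyz : y ≤ z) {Z : Ω → ℝ} (hZ : Measurable[𝓕 x] Z) (hC : ∀ ω, |Z ω| ≤ C) :
    ∫ ω, Z ω * ((W y ω - W x ω) * (W z ω - W x ω)) ∂P = (∫ ω, Z ω ∂P) * (y - x) := by
  have hZ' := hZ.mono (𝓕.le _) le_rfl
  have e : ∀ ω, Z ω * ((W y ω - W x ω) * (W z ω - W x ω)) =
      Z ω * ((W y ω - W x ω) * (W y ω - W x ω)) + Z ω * ((W y ω - W x ω) * (W z ω - W y ω)) :=
    fun ω => by ring
  simp_rw [e]
  rw [integral_add (hW.integrable_mul_incr_mul_incr hx hy hxy hx hy hxy hZ' hC)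
    (hW.integrable_mul_incr_mul_incr hx hy hxy hy hz hyz hZ' hC)]
  have h1 := hW.integral_mul_incr_sq hx hy hxy hZ
  have h2 := hW.integral_mul_incr hy hz hyz (Z := fun ω => Z ω * (W y ω - W x ω))
    ((hZ.mono (𝓕.mono hxy) le_rfl).mul (hW.measurable_incr hx hy hxy le_rfl))
  simp_rw [mul_assoc] at h2
  simp_rw [← pow_two]
  rw [h1, h2, add_zero]

/-- The portion of the first increment before `c` is known at `c` and so is uncorrelated with the
second one; only the overlap, where both start at `c`, remains. -/
theorem integral_mul_incr_mul_incr_of_start_le (hW : IsWienerProcess P T 𝓕 W) {a b c d C : ℝ}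
    (ha : a ∈ Set.Icc 0 T) (hb : b ∈ Set.Icc 0 T) (hc : c ∈ Set.Icc 0 T)
    (hd : d ∈ Set.Icc 0 T) (hcd : c ≤ d) (hac : a ≤ c) {Z : Ω → ℝ}
    (hZ : Measurable[𝓕 c] Z) (hC : ∀ ω, |Z ω| ≤ C) :
    ∫ ω, Z ω * ((W b ω - W a ω) * (W d ω - W c ω)) ∂P =
      (∫ ω, Z ω ∂P) * volume.real (Set.Ioc a b ∩ Set.Ioc c d) := by
  have hZ' := hZ.mono (𝓕.le _) le_rfl
  rw [Set.Ioc_inter_Ioc, sup_eq_right.2 hac]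
  rcases le_total b c with hbc | hcb
  · have h2 := hW.integral_mul_incr hc hd hcd (Z := fun ω => Z ω * (W b ω - W a ω))
      (hZ.mul (hW.measurable_incr ha hb hac hbc))
    simp_rw [mul_assoc] at h2
    rw [h2, Set.Ioc_eq_empty (by simp [hbc])]
    simp
  have e : ∀ ω, Z ω * ((W b ω - W a ω) * (W d ω - W c ω)) =
      Z ω * ((W c ω - W a ω) * (W d ω - W c ω)) + Z ω * ((W b ω - W c ω) * (W d ω - W c ω)) :=
    fun ω => by ring
  simp_rw [e]
  rw [integral_add (hW.integrable_mul_incr_mul_incr ha hc hac hc hd hcd hZ' hC)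
    (hW.integrable_mul_incr_mul_incr hc hb hcb hc hd hcd hZ' hC)]
  have h2 := hW.integral_mul_incr hc hd hcd (Z := fun ω => Z ω * (W c ω - W a ω))
    (hZ.mul (hW.measurable_incr ha hc hac le_rfl))
  simp_rw [mul_assoc] at h2
  rw [h2, zero_add, Measure.real, Real.volume_Ioc]
  rcases le_total b d with hbd | hdb
  · rw [inf_eq_left.2 hbd, hW.integral_mul_incr_mul_incr_of_le hc hb hd hcb hbd hZ hC,
      ENNReal.toReal_ofReal (by linarith)]
  · simp_rw [mul_comm (W b _ - W c _)]
    rw [inf_eq_right.2 hdb, hW.integral_mul_incr_mul_incr_of_le hc hd hb hcd hdb hZ hC,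
      ENNReal.toReal_ofReal (by linarith)]

/-- The isometry for two elementary integrands `X 1_{(a,b]}` and `Y 1_{(c,d]}`. -/
theorem integral_mul_incr_mul_incr (hW : IsWienerProcess P T 𝓕 W) {a b c d C C' : ℝ}
    (ha : a ∈ Set.Icc 0 T) (hb : b ∈ Set.Icc 0 T) (hab : a ≤ b) (hc : c ∈ Set.Icc 0 T)
    (hd : d ∈ Set.Icc 0 T) (hcd : c ≤ d) {X Y : Ω → ℝ}
    (hX : Measurable[𝓕 a] X) (hC : ∀ ω, |X ω| ≤ C)
    (hY : Measurable[𝓕 c] Y) (hC' : ∀ ω, |Y ω| ≤ C') :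
    ∫ ω, (X ω * (W b ω - W a ω)) * (Y ω * (W d ω - W c ω)) ∂P =
      (∫ ω, X ω * Y ω ∂P) * volume.real (Set.Ioc a b ∩ Set.Ioc c d) := by
  have hb' : ∀ ω, |X ω * Y ω| ≤ C * C' := fun ω => by
    rw [abs_mul]
    exact mul_le_mul (hC ω) (hC' ω) (abs_nonneg _) ((abs_nonneg _).trans (hC ω))
  -- The product of the coefficients is known at the later of the two starting times.
  rcases le_total a c with hac | hca
  · rw [← hW.integral_mul_incr_mul_incr_of_start_le ha hb hc hd hcd hac
      (Z := fun ω => X ω * Y ω) ((hX.mono (𝓕.mono hac) le_rfl).mul hY) hb']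
    exact integral_congr_ae (.of_forall fun ω => by ring)
  · rw [Set.inter_comm, ← hW.integral_mul_incr_mul_incr_of_start_le hc hd ha hb hab hca
      (Z := fun ω => X ω * Y ω) (hX.mul (hY.mono (𝓕.mono hca) le_rfl)) hb']
    exact integral_congr_ae (.of_forall fun ω => by ring)

end IsWienerProcess

end

noncomputable section

variable {Ω : Type*} [mΩ : MeasurableSpace Ω] {P : Measure Ω} [IsProbabilityMeasure P]
  {T : ℝ} {𝓕 : Filtration ℝ mΩ} {W : ℝ → Ω → ℝ}

/-! ### The Itô isometry -/

/-- Square integrable curves `[0,T] → L₂(Ω)`. -/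
abbrev CurveSpace (P : Measure Ω) (T : ℝ) : Type _ :=
  Lp (Lp ℝ 2 P) 2 (volume.restrict (Set.Icc 0 T))

theorem eLpNorm_two_sq {α E : Type*} [MeasurableSpace α] [NormedAddCommGroup E] (μ : Measure α)
    (f : α → E) : eLpNorm f 2 μ ^ 2 = ∫⁻ x, ‖f x‖ₑ ^ 2 ∂μ := by
  have := eLpNorm_nnreal_pow_eq_lintegral (μ := μ) (f := f) (p := 2) (by norm_num)
  simpa using this

theorem tendsto_zero_of_sq {u : ℕ → ℝ≥0∞} (h : Tendsto (fun n => u n ^ 2) atTop (𝓝 0)) :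
    Tendsto u atTop (𝓝 0) := by
  have := (ENNReal.continuous_rpow_const (y := (1 / 2 : ℝ))).tendsto 0 |>.comp h
  rw [ENNReal.zero_rpow_of_pos (by norm_num)] at this
  refine this.congr fun n => ?_
  simp only [Function.comp]
  rw [← ENNReal.rpow_natCast, ← ENNReal.rpow_mul]
  norm_num

theorem tendsto_sq_zero {u : ℕ → ℝ≥0∞} (h : Tendsto u atTop (𝓝 0)) :
    Tendsto (fun n => u n ^ 2) atTop (𝓝 0) := by
  simpa using ENNReal.Tendsto.pow (n := 2) h

namespace SimpleProcess

variable {t : ℝ}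

theorem measurable_coef (φ : SimpleProcess 𝓕 t) (i : ℕ) : Measurable (φ.coef i) :=
  (φ.coef_meas i).mono (𝓕.le _) le_rfl

theorem memLp_coef (φ : SimpleProcess 𝓕 t) (i : ℕ) : MemLp (φ.coef i) 2 P := by
  obtain ⟨C, hC⟩ := φ.coef_bdd
  exact MemLp.of_bound (φ.measurable_coef i).aestronglyMeasurable C (.of_forall (hC i))

variable (P) in
/-- A coefficient of a simple process as an element of `L₂(Ω)`. -/
def coefLp (φ : SimpleProcess 𝓕 t) (i : ℕ) : Lp ℝ 2 P := (φ.memLp_coef i).toLp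

variable (P) in
/-- A simple process as a curve in `L₂(Ω)`. -/
def curve (φ : SimpleProcess 𝓕 t) (s : ℝ) : Lp ℝ 2 P :=
  ∑ i ∈ Finset.range φ.n,
    (Set.Ioc (φ.node i) (φ.node (i + 1))).indicator (fun _ => φ.coefLp P i) s

theorem coeFn_finset_sum {α E ι : Type*} [MeasurableSpace α] {μ : Measure α}
    [NormedAddCommGroup E] (S : Finset ι) (f : ι → Lp E 2 μ) :
    ⇑(∑ i ∈ S, f i) =ᵐ[μ] fun x => ∑ i ∈ S, f i x := by
  classical
  induction S using Finset.induction_on with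
  | empty =>
    simp only [Finset.sum_empty]
    exact Lp.coeFn_zero E 2 μ
  | insert a S ha ih =>
    rw [Finset.sum_insert ha]
    filter_upwards [Lp.coeFn_add (f a) (∑ i ∈ S, f i), ih] with x h1 h2
    rw [h1, Pi.add_apply, h2, Finset.sum_insert ha]

theorem coeFn_curve (φ : SimpleProcess 𝓕 t) (s : ℝ) : φ.curve P s =ᵐ[P] φ.value s := by
  refine (coeFn_finset_sum _ _).trans ?_
  have h : ∀ᵐ ω ∂P, ∀ i, φ.coefLp P i ω = φ.coef i ω :=
    ae_all_iff.2 fun i => (φ.memLp_coef i).coeFn_toLp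
  filter_upwards [h, Lp.coeFn_zero ℝ 2 P] with ω hω h0
  refine Finset.sum_congr rfl fun i _ => ?_
  by_cases hs : s ∈ Set.Ioc (φ.node i) (φ.node (i + 1))
  · simp [hs, hω]
  · simp only [Set.indicator_of_notMem hs, h0, Pi.zero_apply]

theorem curve_eq_zero (φ : SimpleProcess 𝓕 t) {s : ℝ} (hs : s ∉ Set.Icc 0 t) :
    φ.curve P s = 0 := by
  refine Finset.sum_eq_zero fun i _ => Set.indicator_of_notMem (fun h => hs ?_) _
  exact ⟨(φ.node_mem i).1.trans h.1.le, h.2.trans (φ.node_mem (i + 1)).2⟩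

variable (P T) in
/-- A simple process as an element of the space of square integrable curves. -/
def curveLp (φ : SimpleProcess 𝓕 t) : CurveSpace P T :=
  ∑ i ∈ Finset.range φ.n,
    indicatorConstLp 2 (measurableSet_Ioc (a := φ.node i) (b := φ.node (i + 1)))
      (measure_ne_top _ _) (φ.coefLp P i)

theorem coeFn_curveLp (φ : SimpleProcess 𝓕 t) :
    φ.curveLp P T =ᵐ[volume.restrict (Set.Icc 0 T)] φ.curve P := by
  refine (coeFn_finset_sum _ _).trans ?_
  have h : ∀ᵐ s ∂volume.restrict (Set.Icc 0 T), ∀ i,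
      indicatorConstLp 2 (measurableSet_Ioc (a := φ.node i) (b := φ.node (i + 1)))
        (measure_ne_top (volume.restrict (Set.Icc 0 T)) _) (φ.coefLp P i) s =
      (Set.Ioc (φ.node i) (φ.node (i + 1))).indicator (fun _ => φ.coefLp P i) s :=
    ae_all_iff.2 fun i => indicatorConstLp_coeFn
  filter_upwards [h] with s hs
  exact Finset.sum_congr rfl fun i _ => hs i

theorem node_mem' (φ : SimpleProcess 𝓕 t) (ht : t ≤ T) (i : ℕ) : φ.node i ∈ Set.Icc 0 T :=
  ⟨(φ.node_mem i).1, (φ.node_mem i).2.trans ht⟩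

theorem memLp_term (hW : IsWienerProcess P T 𝓕 W) (ht : t ≤ T) (φ : SimpleProcess 𝓕 t) (i : ℕ) :
    MemLp (fun ω => φ.coef i ω * (W (φ.node (i + 1)) ω - W (φ.node i) ω)) 2 P := by
  obtain ⟨C, hC⟩ := φ.coef_bdd
  have h1 : MemLp (φ.coef i) ∞ P :=
    MemLp.of_bound (φ.measurable_coef i).aestronglyMeasurable C (.of_forall (hC i))
  exact (hW.memLp_incr (φ.node_mem' ht i) (φ.node_mem' ht (i + 1))
    (φ.node_mono (Nat.le_succ i))).mul h1

theorem memLp_integral (hW : IsWienerProcess P T 𝓕 W) (ht : t ≤ T) (φ : SimpleProcess 𝓕 t) :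
    MemLp (φ.integral W) 2 P :=
  memLp_finsetSum _ fun i _ => φ.memLp_term hW ht i

theorem measurable_integral (hW : IsWienerProcess P T 𝓕 W) (ht : t ≤ T) (φ : SimpleProcess 𝓕 t) :
    Measurable[𝓕 t] (φ.integral W) :=
  Finset.measurable_fun_sum _ fun i _ =>
    ((φ.coef_meas i).mono (𝓕.mono (φ.node_mem i).2) le_rfl).mul
      (hW.measurable_incr (φ.node_mem' ht i) (φ.node_mem' ht (i + 1)) (φ.node_mem i).2
        (φ.node_mem (i + 1)).2)

/-- The stochastic integral of a simple process as an element of `L₂(Ω)`. -/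
def intLp (hW : IsWienerProcess P T 𝓕 W) (ht : t ≤ T) (φ : SimpleProcess 𝓕 t) : Lp ℝ 2 P :=
  (φ.memLp_integral hW ht).toLp

theorem intLp_eq_sum (hW : IsWienerProcess P T 𝓕 W) (ht : t ≤ T) (φ : SimpleProcess 𝓕 t) :
    φ.intLp hW ht = ∑ i ∈ Finset.range φ.n, (φ.memLp_term hW ht i).toLp := by
  refine Lp.ext ?_
  have h : ∀ᵐ ω ∂P, ∀ i, (φ.memLp_term hW ht i).toLp _ ω =
      φ.coef i ω * (W (φ.node (i + 1)) ω - W (φ.node i) ω) :=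
    ae_all_iff.2 fun i => (φ.memLp_term hW ht i).coeFn_toLp
  filter_upwards [(φ.memLp_integral hW ht).coeFn_toLp, h,
    coeFn_finset_sum (Finset.range φ.n) (fun i => (φ.memLp_term hW ht i).toLp)] with ω h1 h2 h3
  rw [intLp, h1, h3]
  simp only [h2, integral]

theorem inner_toLp {α : Type*} [MeasurableSpace α] {μ : Measure α} {f g : α → ℝ}
    (hf : MemLp f 2 μ) (hg : MemLp g 2 μ) :
    inner ℝ (hf.toLp f) (hg.toLp g) = ∫ x, f x * g x ∂μ := by
  rw [L2.inner_def]
  refine integral_congr_ae ?_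
  filter_upwards [hf.coeFn_toLp, hg.coeFn_toLp] with ω h1 h2
  simp [h1, h2, mul_comm]

/-- By bilinearity only pairs of elementary integrands matter. All curves are placed on [0,T],
extended by zero, so that integrals up to different times can be compared in one Hilbert space. -/
theorem inner_intLp (hW : IsWienerProcess P T 𝓕 W) {t t' : ℝ} (ht : t ≤ T) (ht' : t' ≤ T)
    (φ : SimpleProcess 𝓕 t) (ψ : SimpleProcess 𝓕 t') :
    inner ℝ (φ.intLp hW ht) (ψ.intLp hW ht') = inner ℝ (φ.curveLp P T) (ψ.curveLp P T) := by
  obtain ⟨C, hC⟩ := φ.coef_bdd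
  obtain ⟨C', hC'⟩ := ψ.coef_bdd
  rw [intLp_eq_sum, intLp_eq_sum, curveLp, curveLp, sum_inner, sum_inner]
  refine Finset.sum_congr rfl fun i _ => ?_
  rw [inner_sum, inner_sum]
  refine Finset.sum_congr rfl fun j _ => ?_
  rw [inner_toLp, L2.inner_indicatorConstLp_indicatorConstLp, coefLp, coefLp, inner_toLp,
    hW.integral_mul_incr_mul_incr (φ.node_mem' ht i) (φ.node_mem' ht (i + 1))
    (φ.node_mono (Nat.le_succ i)) (ψ.node_mem' ht' j) (ψ.node_mem' ht' (j + 1))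
    (ψ.node_mono (Nat.le_succ j)) (φ.coef_meas i) (hC i) (ψ.coef_meas j) (hC' j),
    smul_eq_mul, mul_comm, measureReal_restrict_apply (by measurability)]
  congr 2
  -- The overlap of the intervals lies in [0,T], so restricting Lebesgue measure to [0,T] does not
  -- change its length.
  rw [eq_comm, Set.inter_eq_left]
  intro s hs
  exact ⟨(φ.node_mem' ht i).1.trans hs.1.1.le, hs.1.2.trans (φ.node_mem' ht (i + 1)).2⟩

theorem norm_intLp_sub (hW : IsWienerProcess P T 𝓕 W) {t t' : ℝ} (ht : t ≤ T) (ht' : t' ≤ T)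
    (φ : SimpleProcess 𝓕 t) (ψ : SimpleProcess 𝓕 t') :
    ‖φ.intLp hW ht - ψ.intLp hW ht'‖ = ‖φ.curveLp P T - ψ.curveLp P T‖ := by
  rw [← sq_eq_sq₀ (norm_nonneg _) (norm_nonneg _), ← real_inner_self_eq_norm_sq,
    ← real_inner_self_eq_norm_sq]
  simp only [inner_sub_left, inner_sub_right, inner_intLp hW]

theorem eLpNorm_curve_sub_indicator_sq (ht : t ≤ T) (φ : SimpleProcess 𝓕 t) (Φ : ℝ → Lp ℝ 2 P) :
    eLpNorm (φ.curve P - (Set.Icc 0 t).indicator Φ) 2 (volume.restrict (Set.Icc 0 T)) ^ 2 =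
      ∫⁻ s in Set.Icc 0 t, eLpNorm (fun ω => φ.value s ω - Φ s ω) 2 P ^ 2 := by
  have h1 : ∀ s, ‖(φ.curve P - (Set.Icc 0 t).indicator Φ) s‖ₑ ^ 2 =
      (Set.Icc 0 t).indicator (fun s => ‖φ.curve P s - Φ s‖ₑ ^ 2) s := by
    intro s
    rw [Pi.sub_apply]
    by_cases hs : s ∈ Set.Icc 0 t
    · simp only [Set.indicator_of_mem hs]
    · simp only [Set.indicator_of_notMem hs, φ.curve_eq_zero hs]
      simp
  rw [eLpNorm_two_sq]
  simp_rw [h1]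
  rw [lintegral_indicator measurableSet_Icc, Measure.restrict_restrict measurableSet_Icc,
    Set.inter_eq_left.2 (Set.Icc_subset_Icc_right ht)]
  refine lintegral_congr fun s => ?_
  rw [Lp.enorm_def]
  congr 1
  refine eLpNorm_congr_ae ?_
  filter_upwards [φ.coeFn_curve (P := P) s, Lp.coeFn_sub (φ.curve P s) (Φ s)] with ω h1 h2
  rw [h2, Pi.sub_apply, h1]

/-- The distance of a simple process to a curve, in the form in which it enters the definition of
the Itô integral. -/
theorem edist_curveLp_sq (ht : t ≤ T) (φ : SimpleProcess 𝓕 t) {Φ : ℝ → Lp ℝ 2 P}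
    {F : CurveSpace P T}
    (hF : F =ᵐ[volume.restrict (Set.Icc 0 T)] (Set.Icc 0 t).indicator Φ) :
    edist (φ.curveLp P T) F ^ 2 = ∫⁻ s in Set.Icc 0 t,
      eLpNorm (fun ω => φ.value s ω - Φ s ω) 2 P ^ 2 := by
  rw [Lp.edist_def, ← eLpNorm_curve_sub_indicator_sq ht]
  congr 1
  exact eLpNorm_congr_ae (φ.coeFn_curveLp.sub hF)

theorem edist_intLp (hW : IsWienerProcess P T 𝓕 W) (ht : t ≤ T) (φ : SimpleProcess 𝓕 t)
    (Y : Lp ℝ 2 P) :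
    edist (φ.intLp hW ht) Y = eLpNorm (fun ω => φ.integral W ω - Y ω) 2 P := by
  rw [Lp.edist_def]
  refine eLpNorm_congr_ae ?_
  filter_upwards [(φ.memLp_integral hW ht).coeFn_toLp] with ω h1
  rw [Pi.sub_apply, intLp, h1]

end SimpleProcess

/-- The Itô integral as a limit in Hilbert spaces. -/
theorem isItoIntegral_iff (hW : IsWienerProcess P T 𝓕 W) {t : ℝ} (ht : t ≤ T)
    (Φ : ℝ → Lp ℝ 2 P) (Y : Lp ℝ 2 P) :
    IsItoIntegral P 𝓕 W t Φ Y ↔ ∃ F : CurveSpace P T,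
      F =ᵐ[volume.restrict (Set.Icc 0 T)] (Set.Icc 0 t).indicator Φ ∧
      ∃ φ : ℕ → SimpleProcess 𝓕 t, Tendsto (fun n => (φ n).curveLp P T) atTop (𝓝 F) ∧
        Tendsto (fun n => (φ n).intLp hW ht) atTop (𝓝 Y) := by
  have hsub : Set.Icc 0 t ⊆ Set.Icc 0 T := Set.Icc_subset_Icc_right ht
  constructor
  · rintro ⟨hΦ, φ, h1, h2⟩
    have hmeas : AEStronglyMeasurable ((Set.Icc 0 t).indicator Φ)
        (volume.restrict (Set.Icc 0 T)) := by
      rw [aestronglyMeasurable_indicator_iff measurableSet_Icc,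
        Measure.restrict_restrict measurableSet_Icc, Set.inter_eq_left.2 hsub]
      exact hΦ
    -- The definition does not require the integrand to be square integrable: this follows because
    -- it lies at finite distance from some simple process.
    obtain ⟨n, hn⟩ := (h1.eventually_lt_const (show (0 : ℝ≥0∞) < 1 by simp)).exists
    have hmem : MemLp ((Set.Icc 0 t).indicator Φ) 2 (volume.restrict (Set.Icc 0 T)) := by
      have hc : MemLp ((φ n).curve P) 2 (volume.restrict (Set.Icc 0 T)) :=
        (memLp_congr_ae (φ n).coeFn_curveLp).1 (Lp.memLp _)
      have hd : MemLp ((φ n).curve P - (Set.Icc 0 t).indicator Φ) 2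
          (volume.restrict (Set.Icc 0 T)) := by
        refine ⟨hc.1.sub hmeas, ?_⟩
        have : eLpNorm ((φ n).curve P - (Set.Icc 0 t).indicator Φ) 2
            (volume.restrict (Set.Icc 0 T)) ^ 2 < 1 := by
          refine lt_of_eq_of_lt ?_ hn
          exact (φ n).eLpNorm_curve_sub_indicator_sq ht Φ
        by_contra h
        rw [not_lt, top_le_iff] at h
        simp [h] at this
      have := hc.sub hd
      rwa [sub_sub_cancel] at this
    refine ⟨hmem.toLp, hmem.coeFn_toLp, φ, ?_, ?_⟩
    · rw [tendsto_iff_edist_tendsto_0]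
      refine tendsto_zero_of_sq (h1.congr fun n => ?_)
      rw [(φ n).edist_curveLp_sq ht hmem.coeFn_toLp]
    · rw [tendsto_iff_edist_tendsto_0]
      exact h2.congr fun n => ((φ n).edist_intLp hW ht Y).symm
  · rintro ⟨F, hF, φ, h1, h2⟩
    refine ⟨?_, φ, ?_, ?_⟩
    · have := ((Lp.aestronglyMeasurable F).congr hF)
      rwa [aestronglyMeasurable_indicator_iff measurableSet_Icc,
        Measure.restrict_restrict measurableSet_Icc, Set.inter_eq_left.2 hsub] at this
    · rw [tendsto_iff_edist_tendsto_0] at h1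
      exact (tendsto_sq_zero h1).congr fun n => (φ n).edist_curveLp_sq ht hF
    · rw [tendsto_iff_edist_tendsto_0] at h2
      exact h2.congr fun n => (φ n).edist_intLp hW ht Y

/-- A curve in the closure of the simple processes has an Itô integral. -/
theorem exists_isItoIntegral (hW : IsWienerProcess P T 𝓕 W) {t : ℝ} (ht : t ≤ T)
    {Φ : ℝ → Lp ℝ 2 P} {F : CurveSpace P T}
    (hF : F =ᵐ[volume.restrict (Set.Icc 0 T)] (Set.Icc 0 t).indicator Φ)
    {φ : ℕ → SimpleProcess 𝓕 t} (hφ : Tendsto (fun n => (φ n).curveLp P T) atTop (𝓝 F)) :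
    ∃ Y, IsItoIntegral P 𝓕 W t Φ Y ∧ Tendsto (fun n => (φ n).intLp hW ht) atTop (𝓝 Y) := by
  -- The isometry carries the Cauchy property from integrands to integrals.
  have hc : CauchySeq fun n => (φ n).intLp hW ht := by
    have := hφ.cauchySeq
    rw [Metric.cauchySeq_iff] at this ⊢
    intro ε hε
    obtain ⟨N, hN⟩ := this ε hε
    refine ⟨N, fun m hm n hn => ?_⟩
    rw [dist_eq_norm, SimpleProcess.norm_intLp_sub, ← dist_eq_norm]
    exact hN m hm n hn
  obtain ⟨Y, hY⟩ := cauchySeq_tendsto_of_complete hc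
  exact ⟨Y, (isItoIntegral_iff hW ht Φ Y).2 ⟨F, hF, φ, hφ, hY⟩, hY⟩

/-- The Itô isometry, in polarized form. -/
theorem IsItoIntegral.inner_eq (hW : IsWienerProcess P T 𝓕 W) {t t' : ℝ} (ht : t ≤ T)
    (ht' : t' ≤ T) {Φ Ψ : ℝ → Lp ℝ 2 P} {Y Z : Lp ℝ 2 P} (hY : IsItoIntegral P 𝓕 W t Φ Y)
    (hZ : IsItoIntegral P 𝓕 W t' Ψ Z) {F G : CurveSpace P T}
    (hF : F =ᵐ[volume.restrict (Set.Icc 0 T)] (Set.Icc 0 t).indicator Φ)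
    (hG : G =ᵐ[volume.restrict (Set.Icc 0 T)] (Set.Icc 0 t').indicator Ψ) :
    inner ℝ Y Z = inner ℝ F G := by
  obtain ⟨F', hF', φ, h1, h2⟩ := (isItoIntegral_iff hW ht Φ Y).1 hY
  obtain ⟨G', hG', ψ, h3, h4⟩ := (isItoIntegral_iff hW ht' Ψ Z).1 hZ
  obtain rfl : F = F' := Lp.ext (hF.trans hF'.symm)
  obtain rfl : G = G' := Lp.ext (hG.trans hG'.symm)
  refine tendsto_nhds_unique (h2.inner h4) ((h1.inner h3).congr fun n => ?_)
  exact (SimpleProcess.inner_intLp hW ht ht' (φ n) (ψ n)).symm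

theorem IsItoIntegral.exists_curve (hW : IsWienerProcess P T 𝓕 W) {t : ℝ} (ht : t ≤ T)
    {Φ : ℝ → Lp ℝ 2 P} {Y : Lp ℝ 2 P} (hY : IsItoIntegral P 𝓕 W t Φ Y) :
    ∃ F : CurveSpace P T, F =ᵐ[volume.restrict (Set.Icc 0 T)] (Set.Icc 0 t).indicator Φ := by
  obtain ⟨F, hF, -⟩ := (isItoIntegral_iff hW ht Φ Y).1 hY
  exact ⟨F, hF⟩

theorem IsItoIntegral.norm_sub_eq (hW : IsWienerProcess P T 𝓕 W) {t t' : ℝ} (ht : t ≤ T)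
    (ht' : t' ≤ T) {Φ Ψ : ℝ → Lp ℝ 2 P} {Y Z : Lp ℝ 2 P} (hY : IsItoIntegral P 𝓕 W t Φ Y)
    (hZ : IsItoIntegral P 𝓕 W t' Ψ Z) {F G : CurveSpace P T}
    (hF : F =ᵐ[volume.restrict (Set.Icc 0 T)] (Set.Icc 0 t).indicator Φ)
    (hG : G =ᵐ[volume.restrict (Set.Icc 0 T)] (Set.Icc 0 t').indicator Ψ) :
    ‖Y - Z‖ = ‖F - G‖ := by
  rw [← sq_eq_sq₀ (norm_nonneg _) (norm_nonneg _), ← real_inner_self_eq_norm_sq,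
    ← real_inner_self_eq_norm_sq]
  simp only [inner_sub_left, inner_sub_right, hY.inner_eq hW ht ht hY hF hF,
    hY.inner_eq hW ht ht' hZ hF hG, hZ.inner_eq hW ht' ht hY hG hF,
    hZ.inner_eq hW ht' ht' hZ hG hG]

/-- The Itô isometry for two curves that differ by at most `ε` in mean square. -/
theorem IsItoIntegral.norm_sub_sq_le (hW : IsWienerProcess P T 𝓕 W) {t t' : ℝ} (ht : t ≤ T)
    (ht' : t' ≤ T) {Φ Ψ : ℝ → Lp ℝ 2 P} {Y Z : Lp ℝ 2 P} (hY : IsItoIntegral P 𝓕 W t Φ Y)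
    (hZ : IsItoIntegral P 𝓕 W t' Ψ Z) {u : ℝ → ℝ} (hu : IntegrableOn u (Set.Icc 0 T))
    (h : ∀ᵐ s ∂volume.restrict (Set.Icc 0 T),
      ‖(Set.Icc 0 t).indicator Φ s - (Set.Icc 0 t').indicator Ψ s‖ ^ 2 ≤ u s) :
    ‖Y - Z‖ ^ 2 ≤ ∫ s in Set.Icc 0 T, u s := by
  obtain ⟨F, hF⟩ := hY.exists_curve hW ht
  obtain ⟨G, hG⟩ := hZ.exists_curve hW ht'
  rw [hY.norm_sub_eq hW ht ht' hZ hF hG, ← real_inner_self_eq_norm_sq, L2.inner_def]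
  refine integral_mono_ae (L2.integrable_inner _ _) hu ?_
  filter_upwards [h, hF, hG, Lp.coeFn_sub F G] with s h1 h2 h3 h4
  rw [h4, Pi.sub_apply, h2, h3, real_inner_self_eq_norm_sq]
  exact h1

/-- Being measurable at time `t`, up to null sets, is a closed condition in L₂, and it holds for the
approximating integrals. -/
theorem IsItoIntegral.aestronglyMeasurable (hW : IsWienerProcess P T 𝓕 W) {t : ℝ} (ht : t ≤ T)
    {Φ : ℝ → Lp ℝ 2 P} {Y : Lp ℝ 2 P} (hY : IsItoIntegral P 𝓕 W t Φ Y) :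
    AEStronglyMeasurable[𝓕 t] Y P := by
  obtain ⟨F, hF, φ, h1, h2⟩ := (isItoIntegral_iff hW ht Φ Y).1 hY
  refine (isClosed_aestronglyMeasurable (F := ℝ) (p := 2) (μ := P) (𝓕.le t)).mem_of_tendsto h2
    (.of_forall fun n => ?_)
  exact ⟨(φ n).integral W, ((φ n).measurable_integral hW ht).stronglyMeasurable,
    ((φ n).memLp_integral hW ht).coeFn_toLp⟩

end

noncomputable section

variable {Ω : Type*} [mΩ : MeasurableSpace Ω] {P : Measure Ω} [IsProbabilityMeasure P]
  {T : ℝ} {𝓕 : Filtration ℝ mΩ} {W : ℝ → Ω → ℝ}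

/-! ### Existence of Itô integrals -/

/-- The nodes of the uniform partition of `[a,t]` into `n` intervals; the last node is repeated. -/
def gridNode (a t : ℝ) (n i : ℕ) : ℝ := a + (t - a) * ((min i n : ℕ) / (n : ℝ))

theorem gridNode_mono {a t : ℝ} (hat : a ≤ t) (n : ℕ) : Monotone (gridNode a t n) := by
  intro i j hij
  unfold gridNode
  have : ((min i n : ℕ) : ℝ) ≤ (min j n : ℕ) := by exact_mod_cast min_le_min_right n hij
  gcongr

theorem gridNode_zero (a t : ℝ) (n : ℕ) : gridNode a t n 0 = a := by simp [gridNode]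

theorem gridNode_self (a t : ℝ) {n : ℕ} (hn : 0 < n) : gridNode a t n n = t := by
  have : (n : ℝ) ≠ 0 := by positivity
  simp [gridNode, this]

theorem gridNode_mem {a t : ℝ} (hat : a ≤ t) (n i : ℕ) : gridNode a t n i ∈ Set.Icc a t := by
  have h1 : ((min i n : ℕ) : ℝ) / n ≤ 1 :=
    div_le_one_of_le₀ (by exact_mod_cast min_le_right i n) (by positivity)
  have h0 : 0 ≤ ((min i n : ℕ) : ℝ) / n := by positivity
  constructor <;> unfold gridNode <;> nlinarith

theorem gridNode_succ_sub_le {a t : ℝ} (hat : a ≤ t) (n i : ℕ) :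
    gridNode a t n (i + 1) - gridNode a t n i ≤ (t - a) / n := by
  have h : ((min (i + 1) n : ℕ) : ℝ) ≤ (min i n : ℕ) + 1 := by
    exact_mod_cast (by omega : min (i + 1) n ≤ min i n + 1)
  have e : gridNode a t n (i + 1) - gridNode a t n i =
      ((t - a) / n) * ((min (i + 1) n : ℕ) - (min i n : ℕ)) := by
    unfold gridNode; ring
  rw [e]
  exact mul_le_of_le_one_right (by have : 0 ≤ t - a := by linarith
                                   positivity) (by linarith)

/-- Uniform continuity, with a mesh below its modulus. The comparison is with the left endpoint, the
only value that an adapted coefficient may use. For `i ≥ n` the interval is empty because the last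
node repeats. -/
theorem exists_grid {E : Type*} [PseudoMetricSpace E] {a t : ℝ} (hat : a ≤ t) {Φ : ℝ → E}
    (hΦ : ContinuousOn Φ (Set.Icc a t)) {ε : ℝ} (hε : 0 < ε) :
    ∃ n : ℕ, 0 < n ∧ ∀ i, ∀ s ∈ Set.Ioc (gridNode a t n i) (gridNode a t n (i + 1)),
      dist (Φ (gridNode a t n i)) (Φ s) ≤ ε := by
  obtain ⟨δ, hδ, h⟩ := Metric.uniformContinuousOn_iff_le.1
    (isCompact_Icc.uniformContinuousOn_of_continuous hΦ) ε hε
  obtain ⟨n, hn⟩ := exists_nat_gt ((t - a) / δ)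
  have h0 : 0 ≤ (t - a) / δ := div_nonneg (by linarith) hδ.le
  have hn0 : (0 : ℝ) < n := h0.trans_lt hn
  refine ⟨n, by exact_mod_cast hn0, fun i s hs => ?_⟩
  have hi := gridNode_mem hat n i
  have hi' := gridNode_mem hat n (i + 1)
  refine h _ hi _ ⟨hi.1.trans hs.1.le, hs.2.trans hi'.2⟩ ?_
  rw [dist_comm, Real.dist_eq, abs_of_nonneg (by linarith [hs.1])]
  have h1 := gridNode_succ_sub_le hat n i
  have h2 : (t - a) / n ≤ δ := by
    rw [div_le_iff₀ hn0]
    rw [div_lt_iff₀ hδ] at hn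
    linarith
  linarith [hs.2]

/-- The simple process on the uniform partition of `[a,t]` with given coefficients. -/
def gridProcess {a t : ℝ} (ha : 0 ≤ a) (hat : a ≤ t) (n : ℕ) (c : ℕ → Ω → ℝ)
    (hc : ∀ i, Measurable[𝓕 (gridNode a t n i)] (c i)) (hb : ∀ i, ∃ C, ∀ ω, |c i ω| ≤ C) :
    SimpleProcess 𝓕 t where
  n := n
  node := gridNode a t n
  node_mono := gridNode_mono hat n
  node_mem i := ⟨ha.trans (gridNode_mem hat n i).1, (gridNode_mem hat n i).2⟩
  -- Discarding the coefficients from `n` on leaves finitely many bounds, hence a common one.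
  coef i := if i < n then c i else 0
  coef_meas i := by
    split_ifs
    · exact hc i
    · exact measurable_const
  coef_bdd := by
    choose C hC using hb
    refine ⟨∑ i ∈ Finset.range n, |C i|, fun i ω => ?_⟩
    split_ifs with hi
    · exact (hC i ω).trans ((le_abs_self _).trans
        (Finset.single_le_sum (f := fun i => |C i|) (fun _ _ => abs_nonneg _)
          (Finset.mem_range.2 hi)))
    · simpa using Finset.sum_nonneg fun i _ => abs_nonneg (C i)

/-- The half-open intervals between consecutive nodes tile the range, so exactly one term of the sum
is active. -/
theorem SimpleProcess.exists_curve_eq {t : ℝ} (φ : SimpleProcess 𝓕 t) {s : ℝ}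
    (hs : s ∈ Set.Ioc (φ.node 0) (φ.node φ.n)) :
    ∃ i < φ.n, s ∈ Set.Ioc (φ.node i) (φ.node (i + 1)) ∧ φ.curve P s = φ.coefLp P i := by
  rw [← φ.node_mono.biUnion_Ico_Ioc_map_succ] at hs
  simp only [Set.mem_iUnion, Set.mem_Ico, exists_prop] at hs
  obtain ⟨i, ⟨-, hi⟩, his⟩ := hs
  replace his : s ∈ Set.Ioc (φ.node i) (φ.node (i + 1)) := his
  refine ⟨i, hi, his, ?_⟩
  unfold curve
  rw [Finset.sum_eq_single i, Set.indicator_of_mem his]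
  · intro j _ hj
    refine Set.indicator_of_notMem (fun h => ?_) _
    exact Set.disjoint_left.1 (φ.node_mono.pairwise_disjoint_on_Ioc_succ hj) h his
  · intro h
    exact absurd (Finset.mem_range.2 hi) h

theorem SimpleProcess.curve_eq_zero_of_le {t : ℝ} (φ : SimpleProcess 𝓕 t) {s a : ℝ}
    (ha : ∀ i, a ≤ φ.node i) (hs : s ≤ a) : φ.curve P s = 0 :=
  Finset.sum_eq_zero fun i _ => Set.indicator_of_notMem
    (fun h => absurd (h.1.trans_le hs) (not_lt.2 (ha i))) _

/-- Coefficients of simple processes must be bounded and measurable for the past. Simple functions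
are dense in L₂ of the measure trimmed to the smaller sigma-algebra, which gives both properties. -/
theorem exists_bounded_approx {m : MeasurableSpace Ω} (hm : m ≤ mΩ) (Y : Lp ℝ 2 P)
    (hY : AEStronglyMeasurable[m] Y P) {ε : ℝ} (hε : 0 < ε) :
    ∃ c : Ω → ℝ, Measurable[m] c ∧ (∃ C, ∀ ω, |c ω| ≤ C) ∧
      ∃ h : MemLp c 2 P, ‖h.toLp c - Y‖ ≤ ε := by
  obtain ⟨y, hy, hyY⟩ := hY
  have hy2 : MemLp y 2 P := (memLp_congr_ae hyY).1 (Lp.memLp Y)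
  have hyt : MemLp y 2 (P.trim hm) :=
    ⟨hy.aestronglyMeasurable, by rw [eLpNorm_trim hm hy]; exact hy2.2⟩
  obtain ⟨g, hg, hgm⟩ := hyt.exists_simpleFunc_eLpNorm_sub_lt (by simp)
    (ENNReal.ofReal_pos.2 hε).ne'
  have hg' : MemLp g 2 P := memLp_of_memLp_trim hm hgm
  refine ⟨g, g.measurable, g.exists_forall_norm_le, hg', ?_⟩
  rw [eLpNorm_trim hm (hy.sub g.stronglyMeasurable), eLpNorm_sub_comm] at hg
  have hYy : Y = hy2.toLp y := Lp.ext (hyY.trans hy2.coeFn_toLp.symm)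
  rw [hYy, ← MemLp.toLp_sub, Lp.norm_toLp]
  exact ENNReal.toReal_le_of_le_ofReal hε.le hg.le

/-- A continuous adapted curve is uniformly approximated by simple processes. -/
theorem exists_simpleProcess_approx {t : ℝ} (ht : 0 ≤ t) {Φ : ℝ → Lp ℝ 2 P}
    (hΦ : ContinuousOn Φ (Set.Icc 0 t))
    (hm : ∀ s ∈ Set.Icc 0 t, AEStronglyMeasurable[𝓕 s] (Φ s) P) {ε : ℝ} (hε : 0 < ε) :
    ∃ φ : SimpleProcess 𝓕 t, ∀ s ∈ Set.Ioc 0 t, ‖φ.curve P s - Φ s‖ ≤ ε := by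
  -- Half of `ε` pays for freezing the curve at the left node, the other half for replacing the
  -- frozen value by a bounded one.
  obtain ⟨n, hn, hg⟩ := exists_grid ht hΦ (half_pos hε)
  have := fun i => exists_bounded_approx (𝓕.le _) (Φ (gridNode 0 t n i))
    (hm _ (gridNode_mem ht n i)) (half_pos hε)
  choose c hc hb hc2 hcε using this
  let φ : SimpleProcess 𝓕 t := gridProcess le_rfl ht n c hc hb
  refine ⟨φ, fun s hs => ?_⟩
  have hs' : s ∈ Set.Ioc (φ.node 0) (φ.node φ.n) := by
    change s ∈ Set.Ioc (gridNode 0 t n 0) (gridNode 0 t n n)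
    rwa [gridNode_zero, gridNode_self _ _ hn]
  obtain ⟨i, hi, his, he⟩ := φ.exists_curve_eq (P := P) hs'
  have hci : φ.coefLp P i = (hc2 i).toLp := by
    have : φ.coef i = c i := if_pos hi
    simp only [SimpleProcess.coefLp, this]
  rw [he, hci]
  have h1 := hg i s his
  rw [dist_eq_norm] at h1
  calc _ = ‖((hc2 i).toLp (c i) - Φ (gridNode 0 t n i)) + (Φ (gridNode 0 t n i) - Φ s)‖ := by
        congr 1; abel
    _ ≤ _ := norm_add_le _ _
    _ ≤ ε := by linarith [hcε i]

theorem norm_curveSpace_le {F : CurveSpace P T} {C : ℝ} (hC : 0 ≤ C)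
    (h : ∀ᵐ s ∂volume.restrict (Set.Icc 0 T), ‖F s‖ ≤ C) : ‖F‖ ≤ √T * C := by
  have h1 := eLpNorm_le_of_ae_bound (p := 2) h
  rw [Lp.norm_def]
  refine (ENNReal.toReal_mono ?_ h1).trans (le_of_eq ?_)
  · refine ENNReal.mul_ne_top (ENNReal.rpow_ne_top_of_nonneg (by norm_num) (measure_ne_top _ _))
      (by simp)
  · rw [ENNReal.toReal_mul, ← ENNReal.toReal_rpow, ENNReal.toReal_ofReal hC,
      Measure.restrict_apply_univ, Real.volume_Icc, sub_zero, Real.sqrt_eq_rpow]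
    rcases le_total 0 T with hT | hT
    · rw [ENNReal.toReal_ofReal hT]; norm_num
    · rw [ENNReal.ofReal_of_nonpos hT, ← Real.sqrt_eq_rpow, Real.sqrt_eq_zero_of_nonpos hT]
      simp

theorem tendsto_of_norm_le {E : Type*} [SeminormedAddCommGroup E] {u : ℕ → E} {y : E} {C : ℝ}
    (h : ∀ n : ℕ, ‖u n - y‖ ≤ C * (1 / ((n : ℝ) + 1))) : Tendsto u atTop (𝓝 y) := by
  rw [tendsto_iff_norm_sub_tendsto_zero]
  refine squeeze_zero (fun _ => norm_nonneg _) h ?_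
  simpa using (tendsto_one_div_add_atTop_nhds_zero_nat (𝕜 := ℝ)).const_mul C

/-- Simple processes vanish at time 0, their intervals being open on the left; this discards that
single time. -/
theorem ae_restrict_Icc_pos (T : ℝ) : ∀ᵐ s ∂volume.restrict (Set.Icc 0 T), 0 < s := by
  rw [← restrict_Ioc_eq_restrict_Icc]
  filter_upwards [ae_restrict_mem measurableSet_Ioc] with s hs using hs.1

/-- A continuous adapted curve has an Itô integral. -/
theorem exists_isItoIntegral_of_continuousOn (hW : IsWienerProcess P T 𝓕 W) {t : ℝ}
    (ht : t ∈ Set.Icc 0 T) {Φ : ℝ → Lp ℝ 2 P} (hΦ : ContinuousOn Φ (Set.Icc 0 t))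
    (hm : ∀ s ∈ Set.Icc 0 t, AEStronglyMeasurable[𝓕 s] (Φ s) P) :
    ∃ Y, IsItoIntegral P 𝓕 W t Φ Y := by
  have hsub : Set.Icc 0 t ⊆ Set.Icc 0 T := Set.Icc_subset_Icc_right ht.2
  obtain ⟨C, hC⟩ := isCompact_Icc.exists_bound_of_continuousOn hΦ
  have hmem : MemLp ((Set.Icc 0 t).indicator Φ) 2 (volume.restrict (Set.Icc 0 T)) := by
    refine MemLp.of_bound ?_ |C| (.of_forall fun s => ?_)
    · rw [aestronglyMeasurable_indicator_iff measurableSet_Icc,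
        Measure.restrict_restrict measurableSet_Icc, Set.inter_eq_left.2 hsub]
      exact hΦ.aestronglyMeasurable_of_isCompact isCompact_Icc measurableSet_Icc
    · by_cases hs : s ∈ Set.Icc 0 t
      · rw [Set.indicator_of_mem hs]; exact (hC s hs).trans (le_abs_self _)
      · rw [Set.indicator_of_notMem hs]; simp
  choose φ hφ using fun n : ℕ => exists_simpleProcess_approx (𝓕 := 𝓕) ht.1 hΦ hm
    (Nat.one_div_pos_of_nat (α := ℝ) (n := n))
  have hconv : Tendsto (fun n => (φ n).curveLp P T) atTop (𝓝 hmem.toLp) := by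
    refine tendsto_of_norm_le (C := √T) fun n => norm_curveSpace_le (by positivity) ?_
    filter_upwards [Lp.coeFn_sub ((φ n).curveLp P T) hmem.toLp, (φ n).coeFn_curveLp (P := P),
      hmem.coeFn_toLp, ae_restrict_Icc_pos T] with s h1 h2 h3 hs0
    rw [h1, Pi.sub_apply, h2, h3]
    by_cases hs : s ∈ Set.Icc 0 t
    · rw [Set.indicator_of_mem hs]; exact hφ n s ⟨hs0, hs.2⟩
    · rw [Set.indicator_of_notMem hs, (φ n).curve_eq_zero hs, sub_zero, norm_zero]
      positivity
  obtain ⟨Y, hY, -⟩ := exists_isItoIntegral hW ht.2 hmem.coeFn_toLp hconv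
  exact ⟨Y, hY⟩

/-! ### Wiener integrals -/

theorem norm_lpConst (x : ℝ) : ‖Lp.const 2 P x‖ = |x| := by
  simp [Lp.norm_const]

theorem inner_lpConst (x y : ℝ) : inner ℝ (Lp.const 2 P x) (Lp.const 2 P y) = x * y := by
  have := SimpleProcess.inner_toLp (memLp_const (μ := P) (p := 2) x)
    (memLp_const (μ := P) (p := 2) y)
  simpa using this

theorem memLp_constCurve {g : ℝ → ℝ} (hg : MemLp g 2 (volume.restrict (Set.Icc 0 T))) :
    MemLp (fun s => Lp.const 2 P (g s)) 2 (volume.restrict (Set.Icc 0 T)) :=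
  hg.continuousLinearMap_comp (Lp.constL 2 P ℝ)

variable (P) in
/-- A deterministic function as a curve of constants. -/
def constCurve {g : ℝ → ℝ} (hg : MemLp g 2 (volume.restrict (Set.Icc 0 T))) : CurveSpace P T :=
  (memLp_constCurve hg).toLp

theorem inner_constCurve {f g : ℝ → ℝ} (hf : MemLp f 2 (volume.restrict (Set.Icc 0 T)))
    (hg : MemLp g 2 (volume.restrict (Set.Icc 0 T))) :
    inner ℝ (constCurve P hf) (constCurve P hg) = ∫ s in Set.Icc 0 T, f s * g s := by
  rw [L2.inner_def]
  refine integral_congr_ae ?_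
  filter_upwards [(memLp_constCurve (P := P) hf).coeFn_toLp,
    (memLp_constCurve (P := P) hg).coeFn_toLp] with s h1 h2
  rw [constCurve, constCurve, h1, h2, inner_lpConst]

theorem norm_constCurve_sub {f g : ℝ → ℝ} (hf : MemLp f 2 (volume.restrict (Set.Icc 0 T)))
    (hg : MemLp g 2 (volume.restrict (Set.Icc 0 T))) :
    ‖constCurve P hf - constCurve P hg‖ =
      (eLpNorm (f - g) 2 (volume.restrict (Set.Icc 0 T))).toReal := by
  rw [constCurve, constCurve, ← MemLp.toLp_sub, Lp.norm_toLp]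
  congr 1
  refine eLpNorm_congr_norm_ae (.of_forall fun s => ?_)
  rw [Pi.sub_apply, ← map_sub, norm_lpConst, Pi.sub_apply, Real.norm_eq_abs]

/-- A simple process whose coefficients are deterministic. -/
def SimpleProcess.IsDeterministic {t : ℝ} (φ : SimpleProcess 𝓕 t) : Prop :=
  ∀ i, ∃ x : ℝ, φ.coef i = fun _ => x

/-- Approximation of a deterministic function on `(a,T]` by step functions. -/
theorem exists_step_approx {a : ℝ} (ha : a ∈ Set.Icc 0 T) {g : ℝ → ℝ}
    (hg : MemLp g 2 (volume.restrict (Set.Icc 0 T))) (hga : ∀ s, 0 < s → s ≤ a → g s = 0) {ε : ℝ}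
    (hε : 0 < ε) :
    ∃ φ : SimpleProcess 𝓕 T, (∀ i, a ≤ φ.node i) ∧ φ.IsDeterministic ∧
      ‖φ.curveLp P T - constCurve P hg‖ ≤ (1 + √T) * ε := by
  obtain ⟨k, -, hk, hkc, hk2⟩ := hg.exists_hasCompactSupport_eLpNorm_sub_le (by simp)
    (ENNReal.ofReal_pos.2 hε).ne'
  -- Cutting the continuous approximation off at `a` does not increase its distance to `g`, which
  -- vanishes on (0,a], and leaves a function that step functions on a grid of [a,T] approximate
  -- uniformly on (0,T].
  let k' : ℝ → ℝ := (Set.Ioi a).indicator k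
  have hk' : MemLp k' 2 (volume.restrict (Set.Icc 0 T)) := hk2.indicator measurableSet_Ioi
  obtain ⟨n, hn, hgrid⟩ := exists_grid ha.2 hkc.continuousOn hε
  let φ : SimpleProcess 𝓕 T := gridProcess ha.1 ha.2 n (fun i _ => k (gridNode a T n i))
    (fun i => measurable_const) (fun i => ⟨_, fun _ => le_rfl⟩)
  have hnode : ∀ i, a ≤ φ.node i := fun i => (gridNode_mem ha.2 n i).1
  refine ⟨φ, hnode, fun i => ?_, ?_⟩
  · by_cases hi : i < n
    · exact ⟨_, if_pos hi⟩
    · exact ⟨0, if_neg hi⟩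
  have h1 : ‖constCurve P hk' - constCurve P hg‖ ≤ ε := by
    rw [norm_constCurve_sub]
    refine ENNReal.toReal_le_of_le_ofReal hε.le (le_trans ?_ hk)
    refine eLpNorm_mono_ae ?_
    filter_upwards [ae_restrict_Icc_pos T] with s hs0
    by_cases hs : s ∈ Set.Ioi a
    · simp only [k', Pi.sub_apply, Set.indicator_of_mem hs]; rw [norm_sub_rev]
    · simp [k', Pi.sub_apply, Set.indicator_of_notMem hs, hga s hs0 (not_lt.1 hs)]
  have h2 : ‖φ.curveLp P T - constCurve P hk'‖ ≤ √T * ε := by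
    refine norm_curveSpace_le hε.le ?_
    filter_upwards [Lp.coeFn_sub (φ.curveLp P T) (constCurve P hk'), φ.coeFn_curveLp (P := P),
      (memLp_constCurve (P := P) hk').coeFn_toLp, ae_restrict_mem measurableSet_Icc]
      with s h1 h2 h3 hsT
    rw [h1, Pi.sub_apply, h2, constCurve, h3]
    by_cases hs : s ∈ Set.Ioi a
    · have hs' : s ∈ Set.Ioc (φ.node 0) (φ.node φ.n) := by
        change s ∈ Set.Ioc (gridNode a T n 0) (gridNode a T n n)
        rw [gridNode_zero, gridNode_self _ _ hn]
        exact ⟨hs, hsT.2⟩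
      obtain ⟨i, hi, his, he⟩ := φ.exists_curve_eq (P := P) hs'
      have hci : φ.coefLp P i = Lp.const 2 P (k (gridNode a T n i)) := by
        have : φ.coef i = fun _ => k (gridNode a T n i) := if_pos hi
        simp only [SimpleProcess.coefLp, this]
        rfl
      rw [he, hci, ← map_sub, norm_lpConst]
      simp only [k', Set.indicator_of_mem hs]
      exact hgrid i s his
    · simp only [k', Set.indicator_of_notMem hs, map_zero, sub_zero]
      rw [φ.curve_eq_zero_of_le hnode (not_lt.1 hs), norm_zero]
      exact hε.le
  calc _ = ‖(φ.curveLp P T - constCurve P hk') + (constCurve P hk' - constCurve P hg)‖ := by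
        congr 1; abel
    _ ≤ _ := norm_add_le _ _
    _ ≤ _ := by linarith

theorem constCurve_coeFn_indicator {g : ℝ → ℝ} (hg : MemLp g 2 (volume.restrict (Set.Icc 0 T))) :
    constCurve P hg =ᵐ[volume.restrict (Set.Icc 0 T)]
      (Set.Icc 0 T).indicator (fun s => Lp.const 2 P (g s)) := by
  filter_upwards [(memLp_constCurve (P := P) hg).coeFn_toLp, ae_restrict_mem measurableSet_Icc]
    with s h1 h2
  rw [constCurve, h1, Set.indicator_of_mem h2]

variable (P T 𝓕 W) in
/-- The Wiener integral `∫_0^T g(s) dW(s)`. -/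
abbrev wienerInt (g : ℝ → ℝ) : Lp ℝ 2 P := itoIntegral P 𝓕 W T (fun s => Lp.const 2 P (g s))

/-- The isometry gives distance zero. Hence the choice made in `itoIntegral` is immaterial, and it
can be computed along any approximating sequence. -/
theorem IsItoIntegral.unique (hW : IsWienerProcess P T 𝓕 W) {t : ℝ} (ht : t ≤ T)
    {Φ : ℝ → Lp ℝ 2 P} {Y Z : Lp ℝ 2 P} (hY : IsItoIntegral P 𝓕 W t Φ Y)
    (hZ : IsItoIntegral P 𝓕 W t Φ Z) : Y = Z := by
  obtain ⟨F, hF⟩ := hY.exists_curve hW ht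
  rw [← sub_eq_zero, ← norm_eq_zero, hY.norm_sub_eq hW ht ht hZ hF hF, sub_self, norm_zero]

/-- The Wiener integral of a function that vanishes on `[0,a]` is a limit of integrals of step
functions on `[a,T]`. -/
theorem exists_tendsto_wienerInt (hW : IsWienerProcess P T 𝓕 W) {a : ℝ}
    (ha : a ∈ Set.Icc 0 T) {g : ℝ → ℝ}
    (hg : MemLp g 2 (volume.restrict (Set.Icc 0 T))) (hga : ∀ s, 0 < s → s ≤ a → g s = 0) :
    IsItoIntegral P 𝓕 W T (fun s => Lp.const 2 P (g s)) (wienerInt P T 𝓕 W g) ∧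
    ∃ φ : ℕ → SimpleProcess 𝓕 T, (∀ m i, a ≤ (φ m).node i) ∧ (∀ m, (φ m).IsDeterministic) ∧
      Tendsto (fun m => (φ m).curveLp P T) atTop (𝓝 (constCurve P hg)) ∧
      Tendsto (fun m => (φ m).intLp hW le_rfl) atTop (𝓝 (wienerInt P T 𝓕 W g)) := by
  choose φ h1 h2 h3 using fun n : ℕ => exists_step_approx (P := P) (𝓕 := 𝓕) ha hg hga
    (Nat.one_div_pos_of_nat (α := ℝ) (n := n))
  have hconv := tendsto_of_norm_le h3
  obtain ⟨Y, hY, hlim⟩ := exists_isItoIntegral hW le_rfl (constCurve_coeFn_indicator hg) hconv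
  have hI : IsItoIntegral P 𝓕 W T (fun s => Lp.const 2 P (g s)) (wienerInt P T 𝓕 W g) := by
    have hex : ∃ Y, IsItoIntegral P 𝓕 W T (fun s => Lp.const 2 P (g s)) Y := ⟨Y, hY⟩
    unfold wienerInt itoIntegral
    rw [dif_pos hex]
    exact hex.choose_spec
  obtain rfl := hY.unique hW le_rfl hI
  exact ⟨hI, φ, h1, h2, hconv, hlim⟩

end

noncomputable section

variable {Ω : Type*} [mΩ : MeasurableSpace Ω] {P : Measure Ω} [IsProbabilityMeasure P]
  {T : ℝ} {𝓕 : Filtration ℝ mΩ} {W : ℝ → Ω → ℝ}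

/-! ### Isometry, linearity and measurability of Wiener integrals -/

theorem IsWienerProcess.mono (hW : IsWienerProcess P T 𝓕 W) {a : ℝ} (ha : a ≤ T) :
    IsWienerProcess P a 𝓕 W := by
  have hs : Set.Icc 0 a ⊆ Set.Icc 0 T := Set.Icc_subset_Icc_right ha
  refine ⟨fun t ht => hW.adapted t (hs ht), hW.zero,
    fun s h1 t h2 h3 => hW.law s (hs h1) t (hs h2) h3,
    fun s h1 t h2 h3 => hW.indep s (hs h1) t (hs h2) h3, ?_⟩
  filter_upwards [hW.continuous_paths] with ω hω using hω.mono hs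

theorem isItoIntegral_wienerInt (hW : IsWienerProcess P T 𝓕 W) (hT : 0 ≤ T) {g : ℝ → ℝ}
    (hg : MemLp g 2 (volume.restrict (Set.Icc 0 T))) :
    IsItoIntegral P 𝓕 W T (fun s => Lp.const 2 P (g s)) (wienerInt P T 𝓕 W g) :=
  -- For `a = 0` the vanishing condition concerns no time at all.
  (exists_tendsto_wienerInt hW (a := 0) ⟨le_rfl, hT⟩ hg
    (fun _ h1 h2 => absurd h1 (not_lt.2 h2))).1

theorem inner_wienerInt (hW : IsWienerProcess P T 𝓕 W) (hT : 0 ≤ T) {f g : ℝ → ℝ}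
    (hf : MemLp f 2 (volume.restrict (Set.Icc 0 T)))
    (hg : MemLp g 2 (volume.restrict (Set.Icc 0 T))) :
    inner ℝ (wienerInt P T 𝓕 W f) (wienerInt P T 𝓕 W g) = ∫ s in Set.Icc 0 T, f s * g s := by
  rw [(isItoIntegral_wienerInt hW hT hf).inner_eq hW le_rfl le_rfl
    (isItoIntegral_wienerInt hW hT hg) (constCurve_coeFn_indicator hf)
    (constCurve_coeFn_indicator hg), inner_constCurve]

theorem constCurve_add_smul {f g : ℝ → ℝ} (hf : MemLp f 2 (volume.restrict (Set.Icc 0 T)))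
    (hg : MemLp g 2 (volume.restrict (Set.Icc 0 T))) (c : ℝ)
    (hfg : MemLp (fun s => f s + c * g s) 2 (volume.restrict (Set.Icc 0 T))) :
    constCurve P hfg = constCurve P hf + c • constCurve P hg := by
  unfold constCurve
  rw [← MemLp.toLp_const_smul, ← MemLp.toLp_add]
  refine MemLp.toLp_congr _ _ (.of_forall fun s => ?_)
  simp only [Pi.add_apply, Pi.smul_apply, map_add]
  rfl

/-- Linearity of the Wiener integral. -/
theorem wienerInt_add_smul (hW : IsWienerProcess P T 𝓕 W) (hT : 0 ≤ T) {f g : ℝ → ℝ}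
    (hf : MemLp f 2 (volume.restrict (Set.Icc 0 T)))
    (hg : MemLp g 2 (volume.restrict (Set.Icc 0 T))) (c : ℝ) :
    wienerInt P T 𝓕 W (fun s => f s + c * g s) =
      wienerInt P T 𝓕 W f + c • wienerInt P T 𝓕 W g := by
  have hfg : MemLp (fun s => f s + c * g s) 2 (volume.restrict (Set.Icc 0 T)) :=
    hf.add (hg.const_mul c)
  -- The squared norm of the defect of linearity expands into inner products. The isometry matches
  -- each with one of deterministic curves, where the defect is zero.
  rw [← sub_eq_zero, ← norm_eq_zero, ← sq_eq_zero_iff, ← real_inner_self_eq_norm_sq]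
  have key : inner ℝ (constCurve P hfg - (constCurve P hf + c • constCurve P hg))
      (constCurve P hfg - (constCurve P hf + c • constCurve P hg)) = (0 : ℝ) := by
    rw [constCurve_add_smul hf hg c hfg, sub_self, inner_zero_left]
  rw [← key]
  simp only [inner_sub_left, inner_sub_right, inner_add_left, inner_add_right, inner_smul_left,
    inner_smul_right, inner_constCurve, inner_wienerInt hW hT hf hf, inner_wienerInt hW hT hf hg,
    inner_wienerInt hW hT hf hfg, inner_wienerInt hW hT hg hf, inner_wienerInt hW hT hg hg,
    inner_wienerInt hW hT hg hfg, inner_wienerInt hW hT hfg hf, inner_wienerInt hW hT hfg hg,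
    inner_wienerInt hW hT hfg hfg]

theorem memLp_indicator_one {T : ℝ} {s : Set ℝ} (hs : MeasurableSet s) :
    MemLp (s.indicator fun _ => (1 : ℝ)) 2 (volume.restrict (Set.Icc 0 T)) :=
  (memLp_const 1).indicator hs

/-- The Wiener integral of `1_{(a,b]}` is the increment `W(b) - W(a)`. -/
theorem wienerInt_indicator (hW : IsWienerProcess P T 𝓕 W) {a b : ℝ}
    (ha : a ∈ Set.Icc 0 T) (hb : b ∈ Set.Icc 0 T) (hab : a ≤ b) :
    wienerInt P T 𝓕 W ((Set.Ioc a b).indicator fun _ => 1) =ᵐ[P] fun ω => W b ω - W a ω := by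
  have hT : 0 ≤ T := ha.1.trans ha.2
  let φ : SimpleProcess 𝓕 T :=
    { n := 1
      node := fun i => if i = 0 then a else b
      node_mono := by
        intro i j hij
        by_cases hj : j = 0
        · have : i = 0 := by omega
          simp [this, hj]
        · by_cases hi : i = 0 <;> simp [hi, hj, hab]
      node_mem := fun i => by split_ifs <;> assumption
      coef := fun _ _ => 1
      coef_meas := fun _ => measurable_const
      coef_bdd := ⟨1, by simp⟩ }
  have hφ : φ.integral W = fun ω => W b ω - W a ω := by
    funext ω
    simp [SimpleProcess.integral, φ]
  have hcurve : ∀ s, φ.curve P s = Lp.const 2 P ((Set.Ioc a b).indicator (fun _ => 1) s) := by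
    intro s
    have : φ.curve P s = (Set.Ioc a b).indicator (fun _ => φ.coefLp P 0) s := by
      simp [SimpleProcess.curve, φ]
    rw [this]
    by_cases hs : s ∈ Set.Ioc a b
    · simp only [Set.indicator_of_mem hs]; rfl
    · simp only [Set.indicator_of_notMem hs, map_zero]
  have hI : IsItoIntegral P 𝓕 W T
      (fun s => Lp.const 2 P ((Set.Ioc a b).indicator (fun _ => 1) s)) (φ.intLp hW le_rfl) := by
    refine (isItoIntegral_iff hW le_rfl _ _).2 ⟨φ.curveLp P T, ?_, fun _ => φ, tendsto_const_nhds,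
      tendsto_const_nhds⟩
    filter_upwards [φ.coeFn_curveLp (P := P) (T := T), ae_restrict_mem measurableSet_Icc]
      with s h1 h2
    rw [h1, Set.indicator_of_mem h2, hcurve]
  have := (isItoIntegral_wienerInt hW hT (memLp_indicator_one measurableSet_Ioc)).unique hW le_rfl
    hI
  rw [this]
  filter_upwards [(φ.memLp_integral hW le_rfl).coeFn_toLp] with ω h
  rw [SimpleProcess.intLp, h, hφ]

/-- The Wiener integral of a function that vanishes on `(a,T]` is measurable at the time `a`. -/
theorem aestronglyMeasurable_wienerInt (hW : IsWienerProcess P T 𝓕 W) {a : ℝ}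
    (ha : a ∈ Set.Icc 0 T) {g : ℝ → ℝ} (hg : MemLp g 2 (volume.restrict (Set.Icc 0 T)))
    (hga : ∀ s, a < s → g s = 0) :
    AEStronglyMeasurable[𝓕 a] (wienerInt P T 𝓕 W g) P := by
  have hWa := hW.mono ha.2
  have hg' : MemLp g 2 (volume.restrict (Set.Icc 0 a)) :=
    hg.mono_measure (Measure.restrict_mono (Set.Icc_subset_Icc_right ha.2) le_rfl)
  have hI := isItoIntegral_wienerInt hWa ha.1 hg'
  have hI' := isItoIntegral_wienerInt hW (ha.1.trans ha.2) hg
  have hF : constCurve P hg =ᵐ[volume.restrict (Set.Icc 0 T)]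
      (Set.Icc 0 a).indicator (fun s => Lp.const 2 P (g s)) := by
    filter_upwards [constCurve_coeFn_indicator (P := P) hg, ae_restrict_mem measurableSet_Icc]
      with s h1 h2
    rw [h1, Set.indicator_of_mem h2]
    by_cases hs : s ∈ Set.Icc 0 a
    · rw [Set.indicator_of_mem hs]
    · rw [Set.indicator_of_notMem hs, hga s (by_contra fun h => hs ⟨h2.1, not_lt.1 h⟩), map_zero]
  -- The two integrands agree as curves on [0,T] after extension by zero, so the isometry identifies
  -- the integrals; the one over [0,a] is known at time `a`.
  have : wienerInt P T 𝓕 W g = wienerInt P a 𝓕 W g := by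
    rw [← sub_eq_zero, ← norm_eq_zero, hI'.norm_sub_eq hW le_rfl ha.2 hI
      (constCurve_coeFn_indicator hg) hF, sub_self, norm_zero]
  rw [this]
  exact hI.aestronglyMeasurable hWa le_rfl

/-- Wiener integrals are measurable with respect to the Wiener process. -/
theorem aestronglyMeasurable_wienerSigma (hW : IsWienerProcess P T 𝓕 W) (hT : 0 ≤ T)
    {g : ℝ → ℝ} (hg : MemLp g 2 (volume.restrict (Set.Icc 0 T))) :
    AEStronglyMeasurable[wienerSigma T W] (wienerInt P T 𝓕 W g) P := by
  obtain ⟨-, φ, -, hdet, -, hlim⟩ := exists_tendsto_wienerInt hW (a := 0) ⟨le_rfl, hT⟩ hg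
    (fun _ h1 h2 => absurd h1 (not_lt.2 h2))
  have hle : wienerSigma T W ≤ mΩ := iSup₂_le fun t ht =>
    ((hW.adapted t ht).mono (𝓕.le _) le_rfl).comap_le
  have hWm : ∀ t ∈ Set.Icc 0 T, Measurable[wienerSigma T W] (W t) := fun t ht =>
    (comap_measurable (W t)).mono (le_iSup₂_of_le t ht le_rfl) le_rfl
  refine (isClosed_aestronglyMeasurable (F := ℝ) (p := 2) (μ := P) hle).mem_of_tendsto hlim
    (.of_forall fun n => ?_)
  refine ⟨(φ n).integral W, Measurable.stronglyMeasurable ?_,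
    ((φ n).memLp_integral hW le_rfl).coeFn_toLp⟩
  refine Finset.measurable_fun_sum _ fun i _ => ?_
  obtain ⟨x, hx⟩ := hdet n i
  rw [hx]
  exact measurable_const.mul ((hWm _ ((φ n).node_mem _)).sub (hWm _ ((φ n).node_mem _)))

/-! ### The law of a Wiener integral -/

theorem IsWienerProcess.integral_cexp_incr (hW : IsWienerProcess P T 𝓕 W) {a b : ℝ} (ha : a ∈ Set.Icc 0 T)
    (hb : b ∈ Set.Icc 0 T) (hab : a ≤ b) (u : ℝ) :
    ∫ ω, Complex.exp (u * (W b ω - W a ω : ℝ) * Complex.I) ∂P =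
      Complex.exp (-((b - a) * u ^ 2 / 2 : ℝ)) := by
  have h := charFun_gaussianReal (μ := 0) (v := Real.toNNReal (b - a)) u
  rw [← hW.law a ha b hb hab, charFun_apply_real, integral_map
    (hW.measurable_incr' ha hb).aemeasurable (by fun_prop),
    Real.coe_toNNReal _ (by linarith)] at h
  rw [h]
  congr 1
  push_cast
  ring

theorem SimpleProcess.norm_curveLp_sq {t : ℝ} (ht : t ≤ T) (φ : SimpleProcess 𝓕 t) {x : ℕ → ℝ}
    (hx : ∀ i, φ.coef i = fun _ => x i) :
    ‖φ.curveLp P T‖ ^ 2 =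
      ∑ i ∈ Finset.range φ.n, (φ.node (i + 1) - φ.node i) * x i ^ 2 := by
  have hc : ∀ i, φ.coefLp P i = Lp.const 2 P (x i) := by
    intro i
    simp only [coefLp, hx i]
    rfl
  rw [← real_inner_self_eq_norm_sq, curveLp, sum_inner]
  refine Finset.sum_congr rfl fun i hi => ?_
  rw [inner_sum, Finset.sum_eq_single i]
  · rw [L2.inner_indicatorConstLp_indicatorConstLp, hc, inner_lpConst, Set.inter_self,
      measureReal_restrict_apply measurableSet_Ioc, Set.inter_eq_left.2, Measure.real,
      Real.volume_Ioc, ENNReal.toReal_ofReal, smul_eq_mul, pow_two]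
    · linarith [φ.node_mono (Nat.le_succ i)]
    · intro s hs
      exact ⟨(φ.node_mem' ht i).1.trans hs.1.le, hs.2.trans (φ.node_mem' ht (i + 1)).2⟩
  · intro j _ hj
    rw [L2.inner_indicatorConstLp_indicatorConstLp]
    have : Disjoint (Set.Ioc (φ.node i) (φ.node (i + 1))) (Set.Ioc (φ.node j) (φ.node (j + 1))) :=
      φ.node_mono.pairwise_disjoint_on_Ioc_succ hj.symm
    rw [this.inter_eq]
    simp
  · intro h
    exact absurd hi h

/-- Induction on the steps: the last increment is independent of the earlier ones and of `A`, so its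
Gaussian characteristic function factors out. Keeping the event `A` in the statement is what later
yields independence of the past. -/
theorem SimpleProcess.setIntegral_cexp (hW : IsWienerProcess P T 𝓕 W) {t : ℝ} (ht : t ≤ T)
    (φ : SimpleProcess 𝓕 t) (hdet : φ.IsDeterministic) {a : ℝ} (ha : ∀ i, a ≤ φ.node i)
    {A : Set Ω} (hA : MeasurableSet[𝓕 a] A) (u : ℝ) :
    ∫ ω in A, Complex.exp (u * φ.integral W ω * Complex.I) ∂P =
      P.real A * Complex.exp (-(u ^ 2 / 2 * ‖φ.curveLp P T‖ ^ 2 : ℝ)) := by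
  choose x hx using hdet
  rw [φ.norm_curveLp_sq ht hx, ← integral_indicator (𝓕.le _ _ hA)]
  have key : ∀ m : ℕ, ∫ ω, A.indicator (fun ω => Complex.exp (u * (∑ i ∈ Finset.range m,
      φ.coef i ω * (W (φ.node (i + 1)) ω - W (φ.node i) ω) : ℝ) * Complex.I)) ω ∂P =
      P.real A * Complex.exp (-(u ^ 2 / 2 * ∑ i ∈ Finset.range m,
        (φ.node (i + 1) - φ.node i) * x i ^ 2 : ℝ)) := by
    intro m
    induction m with
    | zero => simp [integral_indicator (𝓕.le _ _ hA)]
    | succ m ih =>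
      have hZ : Measurable[𝓕 (φ.node m)] (A.indicator (fun ω =>
          Complex.exp (u * (∑ i ∈ Finset.range m,
            φ.coef i ω * (W (φ.node (i + 1)) ω - W (φ.node i) ω) : ℝ) * Complex.I))) := by
        refine Measurable.indicator ?_ (𝓕.mono (ha m) _ hA)
        have hS : Measurable[𝓕 (φ.node m)] (fun ω => ∑ i ∈ Finset.range m,
            φ.coef i ω * (W (φ.node (i + 1)) ω - W (φ.node i) ω)) := by
          refine Finset.measurable_fun_sum _ fun i hi => ?_
          have him : i + 1 ≤ m := Finset.mem_range.1 hi
          exact ((φ.coef_meas i).mono (𝓕.mono (φ.node_mono (by omega))) le_rfl).mul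
            (hW.measurable_incr (φ.node_mem' ht i) (φ.node_mem' ht (i + 1))
              (φ.node_mono (by omega)) (φ.node_mono him))
        exact Complex.measurable_exp.comp
          ((measurable_const.mul (Complex.measurable_ofReal.comp hS)).mul measurable_const)
      have hle := φ.node_mono (Nat.le_succ m)
      have hind := (hW.indepFun_incr (φ.node_mem' ht m) (φ.node_mem' ht (m + 1)) hle hZ).comp
        measurable_id (ψ := fun y : ℝ => Complex.exp ((u * x m : ℝ) * y * Complex.I))
        (by fun_prop)
      have h1 := hind.integral_fun_mul_eq_mul_integral
        (hZ.mono (𝓕.le _) le_rfl).aestronglyMeasurable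
        (Measurable.aestronglyMeasurable (Measurable.comp (by fun_prop)
          (hW.measurable_incr' (φ.node_mem' ht m) (φ.node_mem' ht (m + 1)))))
      have h2 := hW.integral_cexp_incr (φ.node_mem' ht m) (φ.node_mem' ht (m + 1)) hle (u * x m)
      simp only [Function.comp_def, id] at h1
      rw [h2, ih, mul_assoc, ← Complex.exp_add] at h1
      refine Eq.trans (integral_congr_ae (.of_forall fun ω => ?_)) (h1.trans ?_)
      · by_cases hω : ω ∈ A
        · simp only [Set.indicator_of_mem hω]
          rw [← Complex.exp_add, Finset.sum_range_succ, hx m]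
          congr 1
          push_cast
          ring
        · simp only [Set.indicator_of_notMem hω, zero_mul]
      · congr 2
        rw [Finset.sum_range_succ]
        push_cast
        ring
  exact key φ.n

theorem norm_cexp_sub_le (u x y : ℝ) :
    ‖Complex.exp (u * x * Complex.I) - Complex.exp (u * y * Complex.I)‖ ≤ |u| * |x - y| := by
  have e : Complex.exp (u * x * Complex.I) - Complex.exp (u * y * Complex.I) =
      Complex.exp ((u * y : ℝ) * Complex.I) *
        (Complex.exp (Complex.I * (u * (x - y) : ℝ)) - 1) := by
    rw [mul_sub, ← Complex.exp_add, mul_one]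
    push_cast
    congr 2
    ring
  rw [e, norm_mul, Complex.norm_exp_ofReal_mul_I, one_mul, ← abs_mul]
  exact Real.norm_exp_I_mul_ofReal_sub_one_le

theorem integrable_cexp {μ : Measure Ω} [IsFiniteMeasure μ] {X : Ω → ℝ}
    (hX : AEStronglyMeasurable X μ) (u : ℝ) :
    Integrable (fun ω => Complex.exp (u * X ω * Complex.I)) μ := by
  refine Integrable.of_bound (C := 1) ?_ (.of_forall fun ω => ?_)
  · exact (by fun_prop : Continuous fun y : ℝ => Complex.exp (u * y * Complex.I)
      ).comp_aestronglyMeasurable hX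
  · rw [← Complex.ofReal_mul, Complex.norm_exp_ofReal_mul_I]

theorem integral_abs_sub_le (X Y : Lp ℝ 2 P) : ∫ ω, |X ω - Y ω| ∂P ≤ ‖X - Y‖ := by
  have h : eLpNorm (X - Y : Lp ℝ 2 P) 1 P ≤ eLpNorm (X - Y : Lp ℝ 2 P) 2 P :=
    eLpNorm_le_eLpNorm_of_exponent_le (by norm_num) (Lp.aestronglyMeasurable _)
  rw [eLpNorm_one_eq_lintegral_enorm] at h
  rw [Lp.norm_def]
  refine le_trans (le_of_eq ?_) (ENNReal.toReal_mono (Lp.eLpNorm_ne_top _) h)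
  rw [← integral_norm_eq_lintegral_enorm (Lp.aestronglyMeasurable _)]
  refine integral_congr_ae ?_
  filter_upwards [Lp.coeFn_sub X Y] with ω hω
  rw [hω, Pi.sub_apply, Real.norm_eq_abs]

theorem tendsto_setIntegral_cexp {X : ℕ → Lp ℝ 2 P} {Y : Lp ℝ 2 P}
    (h : Tendsto X atTop (𝓝 Y)) (A : Set Ω) (u : ℝ) :
    Tendsto (fun n => ∫ ω in A, Complex.exp (u * X n ω * Complex.I) ∂P) atTop
      (𝓝 (∫ ω in A, Complex.exp (u * Y ω * Complex.I) ∂P)) := by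
  rw [tendsto_iff_norm_sub_tendsto_zero] at h ⊢
  refine squeeze_zero (fun _ => norm_nonneg _) (fun n => ?_) (by simpa using h.const_mul |u|)
  have hi : Integrable (fun ω => |X n ω - Y ω|) P :=
    ((((Lp.memLp (X n)).sub (Lp.memLp Y)).integrable (by norm_num)).abs :)
  rw [← integral_sub (integrable_cexp (Lp.aestronglyMeasurable _).restrict u)
    (integrable_cexp (Lp.aestronglyMeasurable _).restrict u)]
  calc _ ≤ ∫ ω in A, |u| * |X n ω - Y ω| ∂P :=
        norm_integral_le_of_norm_le (hi.const_mul _).integrableOn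
          (.of_forall fun ω => norm_cexp_sub_le _ _ _)
    _ ≤ ∫ ω, |u| * |X n ω - Y ω| ∂P :=
        setIntegral_le_integral (hi.const_mul _) (.of_forall fun ω => by positivity)
    _ = |u| * ∫ ω, |X n ω - Y ω| ∂P := integral_const_mul _ _
    _ ≤ _ := mul_le_mul_of_nonneg_left (integral_abs_sub_le _ _) (abs_nonneg _)

/-- The law of the Wiener integral of a function that vanishes on `[0,a]`, restricted to an event
of the time `a`. -/
theorem map_wienerInt_restrict (hW : IsWienerProcess P T 𝓕 W) {a : ℝ} (ha : a ∈ Set.Icc 0 T)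
    {g : ℝ → ℝ} (hg : MemLp g 2 (volume.restrict (Set.Icc 0 T)))
    (hga : ∀ s, 0 < s → s ≤ a → g s = 0) {A : Set Ω} (hA : MeasurableSet[𝓕 a] A) :
    (P.restrict A).map (wienerInt P T 𝓕 W g) =
      P A • gaussianReal 0 (Real.toNNReal (∫ s in Set.Icc 0 T, g s ^ 2)) := by
  obtain ⟨-, φ, hnode, hdet, hc, hlim⟩ := exists_tendsto_wienerInt hW ha hg hga
  have hfin : IsFiniteMeasure
      (P A • gaussianReal 0 (Real.toNNReal (∫ s in Set.Icc 0 T, g s ^ 2))) :=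
    ⟨by simp [measure_lt_top]⟩
  refine Measure.ext_of_charFun (funext fun u => ?_)
  rw [charFun_apply_real, charFun_apply_real, integral_smul_measure,
    ← charFun_apply_real (μ := gaussianReal 0 _), charFun_gaussianReal, integral_map (Lp.stronglyMeasurable _).measurable.aemeasurable
    (by fun_prop)]
  -- The same sequence is evaluated in two ways: by convergence of the integrals in L₂, and by
  -- convergence of the variances, which are squared norms of the curves.
  refine tendsto_nhds_unique (tendsto_setIntegral_cexp hlim A u) ?_
  have h1 : ∀ n, ∫ ω in A, Complex.exp (u * (φ n).intLp hW le_rfl ω * Complex.I) ∂P =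
      P.real A * Complex.exp (-(u ^ 2 / 2 * ‖(φ n).curveLp P T‖ ^ 2 : ℝ)) := by
    intro n
    rw [← (φ n).setIntegral_cexp hW le_rfl (hdet n) (hnode n) hA u]
    refine integral_congr_ae (ae_restrict_of_ae ?_)
    filter_upwards [((φ n).memLp_integral hW le_rfl).coeFn_toLp] with ω hω
    rw [SimpleProcess.intLp, hω]
  simp_rw [h1]
  have h2 : ‖constCurve P hg‖ ^ 2 = ∫ s in Set.Icc 0 T, g s ^ 2 := by
    rw [← real_inner_self_eq_norm_sq, inner_constCurve]
    simp_rw [pow_two]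
  have h3 : (0 : ℝ) ≤ ∫ s in Set.Icc 0 T, g s ^ 2 := integral_nonneg fun _ => sq_nonneg _
  have hcont : Continuous fun y : ℝ =>
      (P.real A : ℂ) * Complex.exp (-(u ^ 2 / 2 * y ^ 2 : ℝ)) := by fun_prop
  have h4 := (hcont.tendsto _).comp hc.norm
  simp only [Function.comp_def] at h4
  convert h4 using 2
  rw [h2, Real.coe_toNNReal _ h3, Complex.real_smul]
  congr 2
  push_cast
  ring

theorem map_wienerInt (hW : IsWienerProcess P T 𝓕 W) (hT : 0 ≤ T)
    {g : ℝ → ℝ} (hg : MemLp g 2 (volume.restrict (Set.Icc 0 T))) :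
    P.map (wienerInt P T 𝓕 W g) =
      gaussianReal 0 (Real.toNNReal (∫ s in Set.Icc 0 T, g s ^ 2)) := by
  have := map_wienerInt_restrict hW (a := 0) ⟨le_rfl, hT⟩ hg
    (fun _ h1 h2 => absurd h1 (not_lt.2 h2)) MeasurableSet.univ
  simpa using this

theorem integrable_exp_wienerInt (hW : IsWienerProcess P T 𝓕 W) (hT : 0 ≤ T)
    {g : ℝ → ℝ} (hg : MemLp g 2 (volume.restrict (Set.Icc 0 T))) (c : ℝ) :
    Integrable (fun ω => Real.exp (c * wienerInt P T 𝓕 W g ω)) P := by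
  have h := integrable_exp_mul_gaussianReal (μ := 0)
    (v := Real.toNNReal (∫ s in Set.Icc 0 T, g s ^ 2)) c
  rw [← map_wienerInt hW hT hg] at h
  exact (integrable_map_measure (by fun_prop)
    (Lp.stronglyMeasurable _).measurable.aemeasurable).1 h

theorem integral_exp_wienerInt (hW : IsWienerProcess P T 𝓕 W) (hT : 0 ≤ T)
    {g : ℝ → ℝ} (hg : MemLp g 2 (volume.restrict (Set.Icc 0 T))) :
    ∫ ω, Real.exp (wienerInt P T 𝓕 W g ω) ∂P =
      Real.exp (1 / 2 * ∫ s in Set.Icc 0 T, g s ^ 2) := by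
  have h := mgf_gaussianReal (map_wienerInt hW hT hg) 1
  rw [Real.coe_toNNReal _ (integral_nonneg fun _ => sq_nonneg _)] at h
  simp only [mgf, one_mul] at h
  rw [h]
  congr 1
  ring

/-- On every event `A` of the past the restricted law is P(A) times the full law, which is
independence. -/
theorem indepFun_wienerInt (hW : IsWienerProcess P T 𝓕 W) {a : ℝ} (ha : a ∈ Set.Icc 0 T)
    {g : ℝ → ℝ} (hg : MemLp g 2 (volume.restrict (Set.Icc 0 T)))
    (hga : ∀ s, 0 < s → s ≤ a → g s = 0) {c : Ω → ℝ} (hc : AEStronglyMeasurable[𝓕 a] c P) :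
    IndepFun c (wienerInt P T 𝓕 W g) P := by
  obtain ⟨c', hc', hcc'⟩ := hc
  refine IndepFun.congr (f := c') ?_ hcc'.symm (ae_eq_refl _)
  rw [indepFun_iff_measure_inter_preimage_eq_mul]
  intro s t hs ht
  have hm := (Lp.stronglyMeasurable (wienerInt P T 𝓕 W g)).measurable
  have h1 := map_wienerInt_restrict hW ha hg hga (hc'.measurable hs)
  have h2 := map_wienerInt hW (ha.1.trans ha.2) hg
  rw [← h2] at h1
  have h3 := congrArg (fun μ => μ t) h1
  simp only [Measure.smul_apply, smul_eq_mul] at h3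
  rw [Measure.map_apply hm ht, Measure.map_apply hm ht, Measure.restrict_apply (hm ht)] at h3
  rw [Set.inter_comm, h3]

theorem integrable_mul_exp_wienerInt (hW : IsWienerProcess P T 𝓕 W) {a : ℝ}
    (ha : a ∈ Set.Icc 0 T) {g : ℝ → ℝ} (hg : MemLp g 2 (volume.restrict (Set.Icc 0 T)))
    (hga : ∀ s, 0 < s → s ≤ a → g s = 0) {c : Ω → ℝ} (hc : AEStronglyMeasurable[𝓕 a] c P)
    (hci : Integrable c P) :
    Integrable (fun ω => c ω * Real.exp (wienerInt P T 𝓕 W g ω)) P := by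
  have h := (indepFun_wienerInt hW ha hg hga hc).comp measurable_id Real.measurable_exp
  have hi := integrable_exp_wienerInt hW (ha.1.trans ha.2) hg 1
  simp only [one_mul] at hi
  exact h.integrable_mul hci hi

theorem integral_mul_exp_wienerInt (hW : IsWienerProcess P T 𝓕 W) {a : ℝ}
    (ha : a ∈ Set.Icc 0 T) {g : ℝ → ℝ} (hg : MemLp g 2 (volume.restrict (Set.Icc 0 T)))
    (hga : ∀ s, 0 < s → s ≤ a → g s = 0) {c : Ω → ℝ} (hc : AEStronglyMeasurable[𝓕 a] c P)
    (hci : Integrable c P) :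
    ∫ ω, c ω * Real.exp (wienerInt P T 𝓕 W g ω) ∂P =
      (∫ ω, c ω ∂P) * Real.exp (1 / 2 * ∫ s in Set.Icc 0 T, g s ^ 2) := by
  have h := (indepFun_wienerInt hW ha hg hga hc).comp measurable_id Real.measurable_exp
  rw [← integral_exp_wienerInt hW (ha.1.trans ha.2) hg]
  exact h.integral_fun_mul_eq_mul_integral hci.1
    (Real.continuous_exp.comp_aestronglyMeasurable (Lp.aestronglyMeasurable _))

end

noncomputable section

variable {Ω : Type*} [mΩ : MeasurableSpace Ω] {P : Measure Ω} [IsProbabilityMeasure P]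
  {T : ℝ} {𝓕 : Filtration ℝ mΩ} {W : ℝ → Ω → ℝ}

/-! ### Stochastic exponentials -/

/-- Separates the exponent at time `a`. The perturbation by the increment is absorbed into the
future integrand, so independence makes the expectation an explicit function of `ε`. -/
theorem exp_wienerInt_perturb (hW : IsWienerProcess P T 𝓕 W) {a b : ℝ} (ha : a ∈ Set.Icc 0 T)
    (hb : b ∈ Set.Icc 0 T) (hab : a ≤ b) {h : ℝ → ℝ}
    (hh : MemLp h 2 (volume.restrict (Set.Icc 0 T))) (ε : ℝ) :
    ∀ᵐ ω ∂P, Real.exp (wienerInt P T 𝓕 W h ω) * Real.exp (ε * (W b ω - W a ω)) =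
      Real.exp (wienerInt P T 𝓕 W ((Set.Iic a).indicator h) ω) *
      Real.exp (wienerInt P T 𝓕 W (fun s => (Set.Ioi a).indicator h s +
        ε * (Set.Ioc a b).indicator (fun _ => 1) s) ω) := by
  have hT : 0 ≤ T := ha.1.trans ha.2
  have hi := memLp_indicator_one (T := T) (measurableSet_Ioc (a := a) (b := b))
  have h1 := hh.indicator (measurableSet_Iic (a := a))
  have h2 := hh.indicator (measurableSet_Ioi (a := a))
  have e1 := wienerInt_add_smul hW hT h1 h2 1
  have e2 := wienerInt_add_smul hW hT h2 hi ε
  have e3 : (fun s => (Set.Iic a).indicator h s + 1 * (Set.Ioi a).indicator h s) = h := by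
    funext s
    by_cases hs : s ≤ a
    · simp [hs]
    · simp [not_le.1 hs]
  rw [e3, one_smul] at e1
  rw [e1, e2]
  filter_upwards [Lp.coeFn_add (wienerInt P T 𝓕 W ((Set.Iic a).indicator h))
      (wienerInt P T 𝓕 W ((Set.Ioi a).indicator h)),
    Lp.coeFn_add (wienerInt P T 𝓕 W ((Set.Ioi a).indicator h))
      (ε • wienerInt P T 𝓕 W ((Set.Ioc a b).indicator fun _ => 1)),
    Lp.coeFn_smul ε (wienerInt P T 𝓕 W ((Set.Ioc a b).indicator fun _ => 1)),
    wienerInt_indicator hW ha hb hab] with ω h1 h2 h3 h4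
  rw [h1, h2, Pi.add_apply, Pi.add_apply, h3, Pi.smul_apply, h4, ← Real.exp_add, ← Real.exp_add,
    smul_eq_mul]
  congr 1
  ring

/-- Integration by parts against a stochastic exponential, for an increment and a nonnegative
factor from the past. -/
theorem integral_mul_incr_mul_exp_of_nonneg (hW : IsWienerProcess P T 𝓕 W) {a b : ℝ}
    (ha : a ∈ Set.Icc 0 T) (hb : b ∈ Set.Icc 0 T) (hab : a ≤ b) {h : ℝ → ℝ}
    (hh : MemLp h 2 (volume.restrict (Set.Icc 0 T))) {c : Ω → ℝ} (hc : Measurable[𝓕 a] c)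
    (hc0 : ∀ ω, 0 ≤ c ω) {C : ℝ} (hC : ∀ ω, |c ω| ≤ C) :
    ∫ ω, c ω * (W b ω - W a ω) * Real.exp (wienerInt P T 𝓕 W h ω) ∂P =
      (∫ s in Set.Icc 0 T, (Set.Ioc a b).indicator h s) *
        ∫ ω, c ω * Real.exp (wienerInt P T 𝓕 W h ω) ∂P := by
  have hT : 0 ≤ T := ha.1.trans ha.2
  set g : ℝ → ℝ → ℝ := fun ε s => (Set.Ioi a).indicator h s +
    ε * (Set.Ioc a b).indicator (fun _ => 1) s with hgdef
  have hi := memLp_indicator_one (T := T) (measurableSet_Ioc (a := a) (b := b))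
  have h2 := hh.indicator (measurableSet_Ioi (a := a))
  have hg : ∀ ε, MemLp (g ε) 2 (volume.restrict (Set.Icc 0 T)) := fun ε => h2.add (hi.const_mul ε)
  have hga : ∀ ε s, 0 < s → s ≤ a → g ε s = 0 := by
    intro ε s _ hs
    simp [g, hs]
  set c₁ : Ω → ℝ := fun ω => c ω * Real.exp (wienerInt P T 𝓕 W ((Set.Iic a).indicator h) ω)
    with hc₁
  have h1 := hh.indicator (measurableSet_Iic (a := a))
  have hc₁m : AEStronglyMeasurable[𝓕 a] c₁ P :=
    hc.stronglyMeasurable.aestronglyMeasurable.mul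
      (Real.continuous_exp.comp_aestronglyMeasurable
        (aestronglyMeasurable_wienerInt hW ha h1 fun s hs => by simp [hs]))
  have hc₁i : Integrable c₁ P := by
    have := integrable_exp_wienerInt hW hT h1 1
    simp only [one_mul] at this
    exact this.bdd_mul (hc.mono (𝓕.le _) le_rfl).aestronglyMeasurable (.of_forall hC)
  have heq : ∀ ε, (fun ω => c ω * Real.exp (wienerInt P T 𝓕 W h ω) *
      Real.exp (ε * (W b ω - W a ω))) =ᵐ[P]
      fun ω => c₁ ω * Real.exp (wienerInt P T 𝓕 W (g ε) ω) := by
    intro ε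
    filter_upwards [exp_wienerInt_perturb hW ha hb hab hh ε] with ω hω
    simp only [hc₁]
    rw [mul_assoc, hω]
    ring
  have hint : ∀ ε, Integrable (fun ω => c ω * Real.exp (wienerInt P T 𝓕 W h ω) *
      Real.exp (ε * (W b ω - W a ω))) P := fun ε =>
    (integrable_mul_exp_wienerInt hW ha (hg ε) (hga ε) hc₁m hc₁i).congr (heq ε).symm
  set A := ∫ s in Set.Icc 0 T, (Set.Ioi a).indicator h s ^ 2
  set B := ∫ s in Set.Icc 0 T, (Set.Ioc a b).indicator h s with hB
  set D := ∫ s in Set.Icc 0 T, (Set.Ioc a b).indicator (fun _ => (1 : ℝ)) s ^ 2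
  -- The variance of the future part is quadratic in `ε`; its linear coefficient carries the
  -- integral of `h` over (a,b].
  have hsq : ∀ ε, ∫ s in Set.Icc 0 T, g ε s ^ 2 = A + 2 * ε * B + ε ^ 2 * D := by
    intro ε
    have hind : ∀ s, g ε s ^ 2 = (Set.Ioi a).indicator h s ^ 2 +
        2 * ε * (Set.Ioc a b).indicator h s +
        ε ^ 2 * (Set.Ioc a b).indicator (fun _ => (1 : ℝ)) s ^ 2 := by
      intro s
      by_cases hs : s ∈ Set.Ioc a b
      · simp only [g, Set.indicator_of_mem hs, Set.indicator_of_mem (show s ∈ Set.Ioi a from hs.1)]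
        ring
      · simp only [g, Set.indicator_of_notMem hs]
        ring
    have i2 : Integrable ((Set.Ioc a b).indicator h) (volume.restrict (Set.Icc 0 T)) :=
      (hh.integrable (by norm_num)).indicator measurableSet_Ioc
    simp_rw [hind]
    have s1 := h2.integrable_sq
    have s2 := i2.const_mul (2 * ε)
    have s3 := hi.integrable_sq.const_mul (ε ^ 2)
    have s12 : Integrable (fun s => (Set.Ioi a).indicator h s ^ 2 +
        2 * ε * (Set.Ioc a b).indicator h s) (volume.restrict (Set.Icc 0 T)) := s1.add s2
    rw [integral_add s12 s3, integral_add s1 s2, integral_const_mul, integral_const_mul]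
  have hval : ∀ ε, ∫ ω, c ω * Real.exp (wienerInt P T 𝓕 W h ω) *
      Real.exp (ε * (W b ω - W a ω)) ∂P =
      (∫ ω, c₁ ω ∂P) * Real.exp (1 / 2 * (A + 2 * ε * B + ε ^ 2 * D)) := by
    intro ε
    rw [integral_congr_ae (heq ε),
      integral_mul_exp_wienerInt hW ha (hg ε) (hga ε) hc₁m hc₁i, hsq]
  -- the moment generating function of the increment under the measure with this density
  set f : Ω → ℝ≥0 := fun ω => Real.toNNReal (c ω * Real.exp (wienerInt P T 𝓕 W h ω)) with hf
  have hfm : Measurable f := ((hc.mono (𝓕.le _) le_rfl).mul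
    (Real.measurable_exp.comp (Lp.stronglyMeasurable _).measurable)).real_toNNReal
  have hfs : ∀ ω (y : ℝ), f ω • y = c ω * Real.exp (wienerInt P T 𝓕 W h ω) * y := by
    intro ω y
    rw [NNReal.smul_def, hf, Real.coe_toNNReal _ (mul_nonneg (hc0 ω) (Real.exp_pos _).le),
      smul_eq_mul]
  set ν := P.withDensity (fun ω => (f ω : ℝ≥0∞)) with hν
  have hset : integrableExpSet (fun ω => W b ω - W a ω) ν = Set.univ := by
    refine Set.eq_univ_of_forall fun ε => ?_
    change Integrable _ ν
    rw [hν, integrable_withDensity_iff_integrable_smul hfm]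
    simp_rw [hfs]
    exact hint ε
  have hmgf : mgf (fun ω => W b ω - W a ω) ν =
      fun ε => (∫ ω, c₁ ω ∂P) * Real.exp (1 / 2 * (A + 2 * ε * B + ε ^ 2 * D)) := by
    funext ε
    rw [mgf, hν, integral_withDensity_eq_integral_smul hfm, ← hval ε]
    simp_rw [hfs]
  -- The derivative at 0 is the mean of the increment under ν, and by the explicit formula it is `B`
  -- times the total mass. Nonnegativity of `c` serves to make ν a measure.
  have hd := hasDerivAt_mgf (X := fun ω => W b ω - W a ω) (μ := ν) (t := 0) (by simp [hset])
  rw [hmgf, hν, integral_withDensity_eq_integral_smul hfm] at hd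
  simp_rw [hfs] at hd
  have hd' : HasDerivAt (fun ε : ℝ => (∫ ω, c₁ ω ∂P) *
      Real.exp (1 / 2 * (A + 2 * ε * B + ε ^ 2 * D)))
      ((∫ ω, c₁ ω ∂P) * (Real.exp (1 / 2 * (A + 2 * 0 * B + 0 ^ 2 * D)) * B)) 0 := by
    have p1 : HasDerivAt (fun ε : ℝ => 1 / 2 * (A + 2 * ε * B + ε ^ 2 * D)) B 0 := by
      have q1 := ((hasDerivAt_id (0 : ℝ)).const_mul 2).mul_const B
      have q2 := ((hasDerivAt_id (0 : ℝ)).pow 2).mul_const D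
      have := (((q1.const_add A).add q2).const_mul (1 / 2))
      exact this.congr_deriv (by simp)
    exact p1.exp.const_mul _
  have huniq := hd.unique hd'
  have h0 := hval 0
  simp only [zero_mul, Real.exp_zero, mul_one] at huniq h0
  rw [h0, mul_comm B, mul_assoc]
  convert huniq using 1
  exact integral_congr_ae (.of_forall fun ω => by ring)

theorem memLp_exp_wienerInt (hW : IsWienerProcess P T 𝓕 W) (hT : 0 ≤ T) {h : ℝ → ℝ}
    (hh : MemLp h 2 (volume.restrict (Set.Icc 0 T))) :
    MemLp (fun ω => Real.exp (wienerInt P T 𝓕 W h ω)) 2 P := by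
  have hm : AEStronglyMeasurable (fun ω => Real.exp (wienerInt P T 𝓕 W h ω)) P :=
    Real.continuous_exp.comp_aestronglyMeasurable (Lp.aestronglyMeasurable _)
  rw [memLp_two_iff_integrable_sq hm]
  refine (integrable_exp_wienerInt hW hT hh 2).congr (.of_forall fun ω => ?_)
  simp only
  rw [← Real.exp_nat_mul]
  norm_cast

/-- Integration by parts against a stochastic exponential, for an increment and a bounded factor
from the past. -/
theorem integral_mul_incr_mul_exp (hW : IsWienerProcess P T 𝓕 W) {a b : ℝ}
    (ha : a ∈ Set.Icc 0 T) (hb : b ∈ Set.Icc 0 T) (hab : a ≤ b) {h : ℝ → ℝ}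
    (hh : MemLp h 2 (volume.restrict (Set.Icc 0 T))) {c : Ω → ℝ} (hc : Measurable[𝓕 a] c)
    {C : ℝ} (hC : ∀ ω, |c ω| ≤ C) :
    ∫ ω, c ω * (W b ω - W a ω) * Real.exp (wienerInt P T 𝓕 W h ω) ∂P =
      (∫ s in Set.Icc 0 T, (Set.Ioc a b).indicator h s) *
        ∫ ω, c ω * Real.exp (wienerInt P T 𝓕 W h ω) ∂P := by
  have hT : 0 ≤ T := ha.1.trans ha.2
  have hE := memLp_exp_wienerInt hW hT hh
  have i0 : Integrable (fun ω => Real.exp (wienerInt P T 𝓕 W h ω)) P :=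
    hE.integrable (by norm_num)
  have i1 : Integrable (fun ω => (W b ω - W a ω) * Real.exp (wienerInt P T 𝓕 W h ω)) P :=
    (hW.memLp_incr ha hb hab).integrable_mul hE
  have hcm := (hc.mono (𝓕.le _) le_rfl).aestronglyMeasurable (μ := P)
  have i2 : Integrable (fun ω => c ω * Real.exp (wienerInt P T 𝓕 W h ω)) P :=
    i0.bdd_mul hcm (.of_forall hC)
  have i3 : Integrable (fun ω => c ω * ((W b ω - W a ω) *
      Real.exp (wienerInt P T 𝓕 W h ω))) P := i1.bdd_mul hcm (.of_forall hC)
  by_cases hne : Nonempty Ω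
  · have hC0 : 0 ≤ C := (abs_nonneg _).trans (hC hne.some)
    -- Shift the factor by its bound to make it nonnegative, then subtract the case of a constant
    -- factor.
    have k1 := integral_mul_incr_mul_exp_of_nonneg hW ha hb hab hh (c := fun ω => c ω + C)
      (hc.add measurable_const) (fun ω => by linarith [neg_le_of_abs_le (hC ω)]) (C := 2 * C)
      (fun ω => by
        rw [abs_of_nonneg (by linarith [neg_le_of_abs_le (hC ω)])]
        linarith [le_of_abs_le (hC ω)])
    have k2 := integral_mul_incr_mul_exp_of_nonneg hW ha hb hab hh (c := fun _ => C)
      measurable_const (fun _ => hC0) (C := |C|) (fun _ => le_rfl)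
    simp only [add_mul, mul_assoc] at k1 k2 ⊢
    rw [integral_add i3 (i1.const_mul C), integral_add i2 (i0.const_mul C), k2, mul_add] at k1
    linarith
  · rw [not_nonempty_iff] at hne
    simp [Measure.eq_zero_of_isEmpty P]

theorem stochExp_eq (h : ℝ → ℝ) :
    stochExp P T 𝓕 W h = fun ω => Real.exp (-(1 / 2 * ∫ s in Set.Icc 0 T, |h s| ^ 2)) *
      Real.exp (wienerInt P T 𝓕 W h ω) := by
  funext ω
  rw [← Real.exp_add, stochExp]
  congr 1
  ring

theorem memLp_stochExp (hW : IsWienerProcess P T 𝓕 W) (hT : 0 ≤ T) {h : ℝ → ℝ}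
    (hh : MemLp h 2 (volume.restrict (Set.Icc 0 T))) : MemLp (stochExp P T 𝓕 W h) 2 P := by
  rw [stochExp_eq]
  exact (memLp_exp_wienerInt hW hT hh).const_mul _

theorem integral_stochExp (hW : IsWienerProcess P T 𝓕 W) (hT : 0 ≤ T) {h : ℝ → ℝ}
    (hh : MemLp h 2 (volume.restrict (Set.Icc 0 T))) :
    ∫ ω, stochExp P T 𝓕 W h ω ∂P = 1 := by
  rw [stochExp_eq, integral_const_mul, integral_exp_wienerInt hW hT hh, ← Real.exp_add]
  simp

theorem integral_mul_incr_mul_stochExp (hW : IsWienerProcess P T 𝓕 W) {a b : ℝ}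
    (ha : a ∈ Set.Icc 0 T) (hb : b ∈ Set.Icc 0 T) (hab : a ≤ b) {h : ℝ → ℝ}
    (hh : MemLp h 2 (volume.restrict (Set.Icc 0 T))) {c : Ω → ℝ} (hc : Measurable[𝓕 a] c)
    {C : ℝ} (hC : ∀ ω, |c ω| ≤ C) :
    ∫ ω, c ω * (W b ω - W a ω) * stochExp P T 𝓕 W h ω ∂P =
      (∫ s in Set.Icc 0 T, (Set.Ioc a b).indicator h s) *
        ∫ ω, c ω * stochExp P T 𝓕 W h ω ∂P := by
  rw [stochExp_eq]
  simp only [mul_left_comm _ (Real.exp (-(1 / 2 * ∫ s in Set.Icc 0 T, |h s| ^ 2))),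
    integral_const_mul]
  rw [integral_mul_incr_mul_exp hW ha hb hab hh hc hC]

/-- The curve `s ↦ h(s) 𝓔_h`. -/
def expCurve {h : ℝ → ℝ} (hh : MemLp h 2 (volume.restrict (Set.Icc 0 T)))
    {ζ : Ω → ℝ} (hζ : MemLp ζ 2 P) : CurveSpace P T :=
  MemLp.toLp (fun s => h s • hζ.toLp ζ)
    (hh.continuousLinearMap_comp ((ContinuousLinearMap.id ℝ ℝ).smulRight (hζ.toLp ζ)))

theorem coeFn_expCurve {h : ℝ → ℝ} (hh : MemLp h 2 (volume.restrict (Set.Icc 0 T)))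
    {ζ : Ω → ℝ} (hζ : MemLp ζ 2 P) :
    expCurve hh hζ =ᵐ[volume.restrict (Set.Icc 0 T)] fun s => h s • hζ.toLp ζ :=
  MemLp.coeFn_toLp _

/-- Writing integration by parts as an equality of inner products, one with 𝓔_h and one with the
curve s ↦ h(s) 𝓔_h, makes both sides continuous, so that it extends to all Itô integrals. -/
theorem SimpleProcess.inner_intLp_stochExp (hW : IsWienerProcess P T 𝓕 W) (hT : 0 ≤ T) {t : ℝ}
    (ht : t ≤ T) {h : ℝ → ℝ} (hh : MemLp h 2 (volume.restrict (Set.Icc 0 T)))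
    (φ : SimpleProcess 𝓕 t) :
    inner ℝ (φ.intLp hW ht) ((memLp_stochExp hW hT hh).toLp) =
      inner ℝ (φ.curveLp P T) (expCurve hh (memLp_stochExp hW hT hh)) := by
  obtain ⟨C, hC⟩ := φ.coef_bdd
  rw [intLp_eq_sum, curveLp, sum_inner, sum_inner]
  refine Finset.sum_congr rfl fun i _ => ?_
  rw [inner_toLp, integral_mul_incr_mul_stochExp hW (φ.node_mem' ht i) (φ.node_mem' ht (i + 1))
    (φ.node_mono (Nat.le_succ i)) hh (φ.coef_meas i) (hC i),
    L2.inner_indicatorConstLp_eq_inner_setIntegral ℝ]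
  have e : ∫ s in Set.Ioc (φ.node i) (φ.node (i + 1)),
      expCurve hh (memLp_stochExp hW hT hh) s ∂volume.restrict (Set.Icc 0 T) =
      (∫ s in Set.Icc 0 T, (Set.Ioc (φ.node i) (φ.node (i + 1))).indicator h s) •
        (memLp_stochExp hW hT hh).toLp := by
    rw [integral_indicator measurableSet_Ioc, ← integral_smul_const]
    exact integral_congr_ae (ae_restrict_of_ae (coeFn_expCurve hh _))
  rw [e, inner_smul_right, coefLp, inner_toLp]

/-- Integration by parts: `E[(∫_0^t Φ dW) 𝓔_h] = ∫_0^t h(s) E[Φ(s) 𝓔_h] ds`. -/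
theorem IsItoIntegral.integral_mul_stochExp (hW : IsWienerProcess P T 𝓕 W) (hT : 0 ≤ T) {t : ℝ}
    (ht : t ≤ T) {h : ℝ → ℝ} (hh : MemLp h 2 (volume.restrict (Set.Icc 0 T)))
    {Φ : ℝ → Lp ℝ 2 P} {Y : Lp ℝ 2 P} (hY : IsItoIntegral P 𝓕 W t Φ Y) :
    ∫ ω, Y ω * stochExp P T 𝓕 W h ω ∂P =
      ∫ s in Set.Icc 0 t, h s * ∫ ω, Φ s ω * stochExp P T 𝓕 W h ω ∂P := by
  have hE := memLp_stochExp hW hT hh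
  have hin : ∀ Z : Lp ℝ 2 P, ∫ ω, Z ω * stochExp P T 𝓕 W h ω ∂P = inner ℝ Z hE.toLp := by
    intro Z
    rw [← SimpleProcess.inner_toLp (Lp.memLp Z) hE, Lp.toLp_coeFn]
  obtain ⟨F, hF, φ, h1, h2⟩ := (isItoIntegral_iff hW ht Φ Y).1 hY
  have key : inner ℝ Y hE.toLp = inner ℝ F (expCurve hh hE) := by
    refine tendsto_nhds_unique (h2.inner tendsto_const_nhds)
      ((h1.inner tendsto_const_nhds).congr fun n => ?_)
    exact ((φ n).inner_intLp_stochExp hW hT ht hh).symm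
  rw [hin, key, L2.inner_def]
  have e : ∀ᵐ s ∂volume.restrict (Set.Icc 0 T), inner ℝ (F s) (expCurve hh hE s) =
      (Set.Icc 0 t).indicator (fun s => h s * inner ℝ (Φ s) hE.toLp) s := by
    filter_upwards [hF, coeFn_expCurve hh hE] with s h1 h2
    rw [h1, h2, inner_smul_right]
    by_cases hs : s ∈ Set.Icc 0 t
    · simp only [Set.indicator_of_mem hs]
    · simp only [Set.indicator_of_notMem hs, inner_zero_left, mul_zero]
  rw [integral_congr_ae e, integral_indicator measurableSet_Icc,
    Measure.restrict_restrict measurableSet_Icc,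
    Set.inter_eq_left.2 (Set.Icc_subset_Icc_right ht)]
  simp_rw [hin]

end

noncomputable section

variable {Ω : Type*} [mΩ : MeasurableSpace Ω] {P : Measure Ω} [IsProbabilityMeasure P]
  {T : ℝ} {𝓕 : Filtration ℝ mΩ} {W : ℝ → Ω → ℝ}

/-! ### Iterated Itô integrals -/

theorem snoc_mem_cube {k : ℕ} {x : Fin k → ℝ} {s : ℝ} (hx : x ∈ cube T k) (hs : s ∈ Set.Icc 0 T) :
    (Fin.snoc x s : Fin (k + 1) → ℝ) ∈ cube T (k + 1) := by
  intro i _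
  refine Fin.lastCases ?_ (fun j => ?_) i
  · simpa using hs
  · simpa using hx j trivial

theorem isCompact_cube (T : ℝ) (k : ℕ) : IsCompact (cube T k) :=
  isCompact_univ_pi fun _ => isCompact_Icc

theorem continuous_snoc {k : ℕ} (s : ℝ) :
    Continuous fun x : Fin k → ℝ => (Fin.snoc x s : Fin (k + 1) → ℝ) := by
  refine continuous_pi fun i => ?_
  refine Fin.lastCases ?_ (fun j => ?_) i
  · simpa using continuous_const
  · simpa using continuous_apply j

theorem dist_snoc_le {k : ℕ} (x : Fin k → ℝ) (s s' : ℝ) :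
    dist (Fin.snoc x s : Fin (k + 1) → ℝ) (Fin.snoc x s') ≤ dist s s' := by
  refine (dist_pi_le_iff dist_nonneg).2 fun i => ?_
  refine Fin.lastCases ?_ (fun j => ?_) i
  · simp
  · simp [dist_nonneg]

theorem continuousOn_comp_snoc {k : ℕ} {f : (Fin (k + 1) → ℝ) → ℝ}
    (hf : ContinuousOn f (cube T (k + 1))) {s : ℝ} (hs : s ∈ Set.Icc 0 T) :
    ContinuousOn (fun x => f (Fin.snoc x s)) (cube T k) :=
  hf.comp (continuous_snoc s).continuousOn fun _ hx => snoc_mem_cube hx hs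

/-- Stability of iterated integrals under perturbations of the kernel and the time. -/
theorem IsIteratedIto.norm_sub_sq_le (hW : IsWienerProcess P T 𝓕 W) {k : ℕ} :
    ∀ {f g : (Fin k → ℝ) → ℝ} {t t' : ℝ} {Y Z : Lp ℝ 2 P} {ε M : ℝ}, t ∈ Set.Icc 0 T →
      t' ∈ Set.Icc 0 T → t ≤ t' → 0 ≤ ε → IsIteratedIto P 𝓕 W k f t Y →
      IsIteratedIto P 𝓕 W k g t' Z → (∀ x ∈ cube T k, |f x - g x| ≤ ε) →
      (∀ x ∈ cube T k, |g x| ≤ M) →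
      ‖Y - Z‖ ^ 2 ≤ T ^ k * ε ^ 2 + k * T ^ (k - 1) * M ^ 2 * (t' - t) := by
  induction k with
  | zero =>
    intro f g t t' Y Z ε M _ _ _ hε hY hZ hfg _
    have hY' : Y = Lp.const 2 P (f Fin.elim0) := hY
    have hZ' : Z = Lp.const 2 P (g Fin.elim0) := hZ
    rw [hY', hZ', ← map_sub, norm_lpConst]
    have := hfg Fin.elim0 (fun i => i.elim0)
    simpa using pow_le_pow_left₀ (abs_nonneg _) this 2
  | succ k ih =>
    rintro f g t t' Y Z ε M ht ht' htt' hε ⟨Φ, hΦ, hY⟩ ⟨Ψ, hΨ, hZ⟩ hfg hg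
    have hT : 0 ≤ T := ht.1.trans ht.2
    have zero_mem : ∀ n, (0 : Fin n → ℝ) ∈ cube T n := fun n i _ => ⟨le_rfl, hT⟩
    have hM : 0 ≤ M := (abs_nonneg _).trans (hg 0 (zero_mem _))
    rw [ae_restrict_iff' measurableSet_Icc] at hΦ hΨ
    -- the zero process as an iterated integral of the zero kernel
    have hzero : ∀ n : ℕ, ∀ s ∈ Set.Icc 0 T, IsIteratedIto P 𝓕 W n (fun _ => 0) s 0 := by
      intro n
      induction n with
      | zero =>
        intro s _
        change (0 : Lp ℝ 2 P) = Lp.const 2 P 0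
        rw [map_zero]
      | succ n ihn =>
        intro s hs
        refine ⟨fun _ => 0, ?_, ?_⟩
        · filter_upwards [ae_restrict_mem measurableSet_Icc] with r hr
          exact ihn r ⟨hr.1, hr.2.trans hs.2⟩
        · obtain ⟨X, hX⟩ := exists_isItoIntegral_of_continuousOn hW hs
            (Φ := fun _ => (0 : Lp ℝ 2 P)) continuousOn_const
            (fun r _ => (aestronglyMeasurable_const (b := (0 : ℝ))).congr (Lp.coeFn_zero ℝ 2 P).symm)
          have hF : (0 : CurveSpace P T) =ᵐ[volume.restrict (Set.Icc 0 T)]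
              (Set.Icc 0 s).indicator (fun _ => (0 : Lp ℝ 2 P)) := by
            refine (Lp.coeFn_zero _ _ _).trans (.of_forall fun r => ?_)
            simp
          have : X = 0 := by
            rw [← norm_eq_zero, ← sq_eq_zero_iff, ← real_inner_self_eq_norm_sq,
              hX.inner_eq hW hs.2 hs.2 hX hF hF, inner_zero_left]
          rwa [this] at hX
    -- On [0,t] the integrands belong to the same time and differ by the induction bound alone. On
    -- (t,t'] only the second survives; comparing it with the zero kernel bounds it through `M`.
    have hu : IntegrableOn (fun s => T ^ k * ε ^ 2 + (Set.Ioc t t').indicator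
        (fun _ => T ^ k * M ^ 2) s) (Set.Icc 0 T) :=
      (integrable_const _).add ((integrable_const _).indicator measurableSet_Ioc)
    refine (hY.norm_sub_sq_le hW ht.2 ht'.2 hZ hu ?_).trans ?_
    · rw [ae_restrict_iff' measurableSet_Icc]
      filter_upwards [hΦ, hΨ] with s h1 h2 hs
      by_cases hst : s ≤ t
      · have m1 : s ∈ Set.Icc 0 t := ⟨hs.1, hst⟩
        have m2 : s ∈ Set.Icc 0 t' := ⟨hs.1, hst.trans htt'⟩
        have := ih hs hs le_rfl hε (h1 m1) (h2 m2)
          (fun x hx => hfg _ (snoc_mem_cube hx hs)) (fun x hx => hg _ (snoc_mem_cube hx hs))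
        rw [Set.indicator_of_mem m1, Set.indicator_of_mem m2,
          Set.indicator_of_notMem (fun h => absurd h.1 (not_lt.2 hst))]
        simpa using this
      · have m1 : s ∉ Set.Icc 0 t := fun h => hst h.2
        rw [Set.indicator_of_notMem m1]
        have hT' : 0 ≤ T ^ k * ε ^ 2 := by positivity
        by_cases hst' : s ≤ t'
        · have m2 : s ∈ Set.Icc 0 t' := ⟨hs.1, hst'⟩
          rw [Set.indicator_of_mem m2, Set.indicator_of_mem (show s ∈ Set.Ioc t t' from
            ⟨not_le.1 hst, hst'⟩), norm_sub_rev]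
          have := ih hs hs le_rfl hM (h2 m2) (hzero k s hs) (M := 0)
            (fun x hx => by simpa using hg _ (snoc_mem_cube hx hs)) (fun x hx => by simp)
          simp only [sub_self, mul_zero, add_zero] at this
          linarith
        · have m2 : s ∉ Set.Icc 0 t' := fun h => hst' h.2
          rw [Set.indicator_of_notMem m2, Set.indicator_of_notMem (fun h => hst' h.2)]
          simpa using hT'
    · have hIoc : Set.Ioc t t' ⊆ Set.Icc 0 T :=
        fun s hs => ⟨ht.1.trans hs.1.le, hs.2.trans ht'.2⟩
      rw [integral_add (integrable_const _) ((integrable_const _).indicator measurableSet_Ioc),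
        integral_indicator measurableSet_Ioc, Measure.restrict_restrict measurableSet_Ioc,
        Set.inter_eq_left.2 hIoc]
      simp only [integral_const, measureReal_restrict_apply_univ, Real.volume_real_Icc_of_le hT,
        Real.volume_real_Ioc_of_le htt', smul_eq_mul, sub_zero, Nat.add_sub_cancel]
      push_cast
      have h1 : 0 ≤ T ^ k * M ^ 2 * (t' - t) :=
        mul_nonneg (by positivity) (by linarith)
      have h2 : 0 ≤ (k : ℝ) * (T ^ k * M ^ 2 * (t' - t)) := by positivity
      have e : T ^ (k + 1) * ε ^ 2 = T * (T ^ k * ε ^ 2) := by ring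
      rw [e]
      linarith

theorem IsIteratedIto.aestronglyMeasurable (hW : IsWienerProcess P T 𝓕 W) {k : ℕ}
    {f : (Fin k → ℝ) → ℝ} {t : ℝ} (ht : t ∈ Set.Icc 0 T) {Y : Lp ℝ 2 P}
    (hY : IsIteratedIto P 𝓕 W k f t Y) : AEStronglyMeasurable[𝓕 t] Y P := by
  cases k with
  | zero =>
    have hY' : Y = Lp.const 2 P (f Fin.elim0) := hY
    rw [hY']
    exact (aestronglyMeasurable_const (b := f Fin.elim0)).congr (Lp.coeFn_const 2 P _).symm
  | succ k =>
    obtain ⟨Φ, -, hI⟩ := hY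
    exact hI.aestronglyMeasurable hW ht.2

/-- Existence of the iterated integrals of continuous kernels. -/
theorem exists_isIteratedIto (hW : IsWienerProcess P T 𝓕 W) {k : ℕ} :
    ∀ {f : (Fin k → ℝ) → ℝ}, ContinuousOn f (cube T k) → ∀ {t : ℝ}, t ∈ Set.Icc 0 T →
      ∃ Y, IsIteratedIto P 𝓕 W k f t Y := by
  induction k with
  | zero => exact fun {f} _ {t} _ => ⟨_, rfl⟩
  | succ k ih =>
    intro f hf t ht
    have hT : 0 ≤ T := ht.1.trans ht.2
    have hex : ∀ s, ∃ Y : Lp ℝ 2 P, s ∈ Set.Icc 0 T →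
        IsIteratedIto P 𝓕 W k (fun x => f (Fin.snoc x s)) s Y := by
      intro s
      by_cases hs : s ∈ Set.Icc 0 T
      · obtain ⟨Y, hY⟩ := ih (continuousOn_comp_snoc hf hs) hs
        exact ⟨Y, fun _ => hY⟩
      · exact ⟨0, fun h => absurd h hs⟩
    choose Φ hΦ using hex
    obtain ⟨M, hM⟩ := (isCompact_cube T (k + 1)).exists_bound_of_continuousOn hf
    have huc := (isCompact_cube T (k + 1)).uniformContinuousOn_of_continuous hf
    rw [Metric.uniformContinuousOn_iff_le] at huc
    -- The inner integrals are chosen separately for each `s`, yet stability makes them a continuous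
    -- curve, to which the existence theorem for Itô integrals applies.
    have hcont : ContinuousOn Φ (Set.Icc 0 T) := by
      have key : ∀ ε > 0, ∃ δ > 0, ∀ s ∈ Set.Icc 0 T, ∀ s' ∈ Set.Icc 0 T, s ≤ s' →
          s' - s ≤ δ → ‖Φ s - Φ s'‖ ^ 2 ≤ T ^ k * ε ^ 2 + k * T ^ (k - 1) * M ^ 2 * (s' - s) := by
        intro ε hε
        obtain ⟨δ, hδ, h⟩ := huc ε hε
        refine ⟨δ, hδ, fun s hs s' hs' hss' hd => ?_⟩
        refine (hΦ s hs).norm_sub_sq_le hW hs hs' hss' hε.le (hΦ s' hs') (fun x hx => ?_)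
          (fun x hx => hM _ (snoc_mem_cube hx hs'))
        refine h _ (snoc_mem_cube hx hs) _ (snoc_mem_cube hx hs') ((dist_snoc_le x s s').trans ?_)
        rwa [dist_comm, Real.dist_eq, abs_of_nonneg (by linarith)]
      rw [Metric.continuousOn_iff]
      intro s hs η hη
      have hK : 0 ≤ k * T ^ (k - 1) * M ^ 2 := by positivity
      set K := k * T ^ (k - 1) * M ^ 2
      obtain ⟨ε, hε, hε2⟩ : ∃ ε > 0, T ^ k * ε ^ 2 < η ^ 2 / 2 := by
        have : Tendsto (fun ε : ℝ => T ^ k * ε ^ 2) (𝓝[>] 0) (𝓝 0) := by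
          have hc : Continuous fun ε : ℝ => T ^ k * ε ^ 2 := by fun_prop
          have := hc.tendsto 0
          simp only [ne_eq, OfNat.ofNat_ne_zero, not_false_eq_true, zero_pow, mul_zero] at this
          exact this.mono_left nhdsWithin_le_nhds
        obtain ⟨ε, h1, h2⟩ := ((this.eventually_lt_const (show (0 : ℝ) < η ^ 2 / 2 by positivity)
          ).and self_mem_nhdsWithin).exists
        exact ⟨ε, h2, h1⟩
      obtain ⟨δ, hδ, hkey⟩ := key ε hε
      -- One half of `η ^ 2` covers the change of the kernel and the other the change of the time;
      -- `K + 1` avoids dividing by zero.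
      refine ⟨min δ (η ^ 2 / 2 / (K + 1)), by positivity, fun s' hs' hd => ?_⟩
      have hd1 : |s' - s| ≤ δ := (hd.le.trans (min_le_left _ _))
      have hd2 : |s' - s| ≤ η ^ 2 / 2 / (K + 1) := (hd.le.trans (min_le_right _ _))
      have hd3 : K * |s' - s| ≤ η ^ 2 / 2 := by
        rw [le_div_iff₀ (by positivity)] at hd2
        nlinarith [abs_nonneg (s' - s)]
      have hfin : ‖Φ s' - Φ s‖ ^ 2 < η ^ 2 := by
        rcases le_total s s' with hle | hle
        · rw [abs_of_nonneg (by linarith)] at hd1 hd3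
          have := hkey s hs s' hs' hle hd1
          rw [norm_sub_rev]
          linarith
        · rw [abs_of_nonpos (by linarith)] at hd1 hd3
          have := hkey s' hs' s hs hle (by linarith)
          have e : -(s' - s) = s - s' := by ring
          rw [e] at hd3
          linarith
      rw [dist_eq_norm]
      exact lt_of_pow_lt_pow_left₀ 2 hη.le hfin
    have hsub : Set.Icc 0 t ⊆ Set.Icc 0 T := Set.Icc_subset_Icc_right ht.2
    obtain ⟨Y, hY⟩ := exists_isItoIntegral_of_continuousOn hW ht (hcont.mono hsub)
      (fun s hs => (hΦ s (hsub hs)).aestronglyMeasurable hW (hsub hs))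
    refine ⟨Y, Φ, ?_, hY⟩
    filter_upwards [ae_restrict_mem measurableSet_Icc] with s hs using hΦ s (hsub hs)

theorem isIteratedIto_iteratedIto (hW : IsWienerProcess P T 𝓕 W) {k : ℕ}
    {f : (Fin k → ℝ) → ℝ} (hf : ContinuousOn f (cube T k)) {t : ℝ} (ht : t ∈ Set.Icc 0 T) :
    IsIteratedIto P 𝓕 W k f t (iteratedIto P 𝓕 W f t) := by
  have h := exists_isIteratedIto hW hf ht
  rw [iteratedIto, dif_pos h]
  exact h.choose_spec

/-- The deterministic iterated integral `∫_0^t ∫_0^{s_k} ⋯ ∫_0^{s_2} f h(s_1) ⋯ h(s_k) ds`. -/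
def iteratedIntegral (h : ℝ → ℝ) : (k : ℕ) → ((Fin k → ℝ) → ℝ) → ℝ → ℝ
  | 0, f, _ => f Fin.elim0
  | k + 1, f, t => ∫ s in Set.Icc 0 t, h s * iteratedIntegral h k (fun x => f (Fin.snoc x s)) s

/-- Each integration by parts removes the outermost integral and replaces dW(s) by h(s) ds. After
`k` of them the kernel value is a constant, and 𝓔_h has mean one. -/
theorem IsIteratedIto.integral_mul_stochExp (hW : IsWienerProcess P T 𝓕 W) {h : ℝ → ℝ}
    (hh : MemLp h 2 (volume.restrict (Set.Icc 0 T))) {k : ℕ} :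
    ∀ {f : (Fin k → ℝ) → ℝ} {t : ℝ} {Y : Lp ℝ 2 P}, t ∈ Set.Icc 0 T →
      IsIteratedIto P 𝓕 W k f t Y →
      ∫ ω, Y ω * stochExp P T 𝓕 W h ω ∂P = iteratedIntegral h k f t := by
  induction k with
  | zero =>
    intro f t Y ht hY
    have hY' : Y = Lp.const 2 P (f Fin.elim0) := hY
    rw [hY']
    have e : ∫ ω, Lp.const 2 P (f Fin.elim0) ω * stochExp P T 𝓕 W h ω ∂P =
        ∫ ω, f Fin.elim0 * stochExp P T 𝓕 W h ω ∂P := by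
      refine integral_congr_ae ?_
      filter_upwards [Lp.coeFn_const 2 P (f Fin.elim0)] with ω hω
      rw [hω, Function.const_apply]
    rw [e, integral_const_mul, integral_stochExp hW (ht.1.trans ht.2) hh, mul_one]
    rfl
  | succ k ih =>
    rintro f t Y ht ⟨Φ, hΦ, hY⟩
    rw [hY.integral_mul_stochExp hW (ht.1.trans ht.2) ht.2 hh]
    refine integral_congr_ae ?_
    filter_upwards [hΦ, ae_restrict_mem measurableSet_Icc] with s h1 h2
    rw [ih ⟨h2.1, h2.2.trans ht.2⟩ h1]

end

noncomputable section

/-! ### Integrals of symmetric functions over simplices and cubes -/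

theorem measurableSet_cube (t : ℝ) (k : ℕ) : MeasurableSet (cube t k) :=
  MeasurableSet.univ_pi fun _ => measurableSet_Icc

theorem measurePreserving_comp_perm {n : ℕ} (σ : Equiv.Perm (Fin n)) :
    MeasurePreserving (fun y : Fin n → ℝ => y ∘ σ) volume volume := by
  have h := volume_measurePreserving_piCongrLeft (fun _ : Fin n => ℝ) σ.symm
  convert h using 1
  funext y i
  have := Equiv.piCongrLeft_apply_apply (fun _ : Fin n => ℝ) σ.symm y (σ i)
  simp only [Equiv.symm_apply_apply] at this
  exact this.symm

theorem measurableEmbedding_comp_perm {n : ℕ} (σ : Equiv.Perm (Fin n)) :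
    MeasurableEmbedding (fun y : Fin n → ℝ => y ∘ σ) := by
  have h := (MeasurableEquiv.piCongrLeft (fun _ : Fin n => ℝ) σ.symm).measurableEmbedding
  convert h using 1
  funext y i
  have := Equiv.piCongrLeft_apply_apply (fun _ : Fin n => ℝ) σ.symm y (σ i)
  simp only [Equiv.symm_apply_apply] at this
  exact this.symm

/-- The part of the cube where the coordinate `j` is the largest one. -/
def maxRegion (t : ℝ) {n : ℕ} (j : Fin n) : Set (Fin n → ℝ) := {y ∈ cube t n | ∀ i, y i ≤ y j}

theorem measurableSet_maxRegion (t : ℝ) {n : ℕ} (j : Fin n) : MeasurableSet (maxRegion t j) := by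
  have : maxRegion t j = cube t n ∩ ⋂ i, {y | y i ≤ y j} := by
    ext y; simp [maxRegion]
  rw [this]
  exact (measurableSet_cube t n).inter (MeasurableSet.iInter fun i =>
    measurableSet_le (measurable_pi_apply i) (measurable_pi_apply j))

theorem iUnion_maxRegion (t : ℝ) (k : ℕ) :
    ⋃ j : Fin (k + 1), maxRegion t j = cube t (k + 1) := by
  ext y
  simp only [Set.mem_iUnion, maxRegion, Set.mem_ofPred_eq]
  constructor
  · rintro ⟨j, hj, -⟩
    exact hj
  · intro hy
    obtain ⟨j, hj⟩ := Finite.exists_max y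
    exact ⟨j, hy, hj⟩

/-- A proper linear subspace is null. Thus ties between coordinates do not matter when the cube is
divided according to its largest coordinate. -/
theorem volume_diagonal {n : ℕ} {i j : Fin n} (hij : i ≠ j) :
    volume {y : Fin n → ℝ | y i = y j} = 0 := by
  let S : Submodule ℝ (Fin n → ℝ) :=
    LinearMap.ker (LinearMap.proj (R := ℝ) (φ := fun _ : Fin n => ℝ) i - LinearMap.proj j)
  have hS : (S : Set (Fin n → ℝ)) = {y | y i = y j} := by
    ext y
    simp [S, sub_eq_zero]
  rw [← hS]
  refine Measure.addHaar_submodule volume S fun h => ?_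
  have : (Pi.single i 1 : Fin n → ℝ) ∈ S := by rw [h]; trivial
  simp [S, hij.symm] at this

theorem aedisjoint_maxRegion (t : ℝ) {n : ℕ} {i j : Fin n} (hij : i ≠ j) :
    AEDisjoint volume (maxRegion t i) (maxRegion t j) :=
  measure_mono_null (fun _ hy => le_antisymm (hy.2.2 i) (hy.1.2 j)) (volume_diagonal hij)

theorem comp_perm_mem_cube {t : ℝ} {n : ℕ} (σ : Equiv.Perm (Fin n)) {y : Fin n → ℝ} :
    y ∘ σ ∈ cube t n ↔ y ∈ cube t n := by
  constructor
  · intro h i _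
    have := h (σ.symm i) trivial
    simpa using this
  · intro h i _
    exact h (σ i) trivial

/-- The transposition of `j` and the last index preserves the measure and the integrand and
exchanges the two regions. -/
theorem setIntegral_maxRegion {t : ℝ} {k : ℕ} {G : (Fin (k + 1) → ℝ) → ℝ}
    (hsymm : ∀ σ : Equiv.Perm (Fin (k + 1)), ∀ y ∈ cube t (k + 1), G (y ∘ σ) = G y)
    (j : Fin (k + 1)) :
    ∫ y in maxRegion t j, G y = ∫ y in maxRegion t (Fin.last k), G y := by
  let σ := Equiv.swap j (Fin.last k)
  rw [← (measurePreserving_comp_perm σ).setIntegral_preimage_emb (measurableEmbedding_comp_perm σ)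
    G (maxRegion t (Fin.last k))]
  have hpre : (fun y : Fin (k + 1) → ℝ => y ∘ σ) ⁻¹' maxRegion t (Fin.last k) =
      maxRegion t j := by
    ext y
    simp only [Set.mem_preimage, maxRegion, Set.mem_ofPred_eq, comp_perm_mem_cube,
      Function.comp_apply]
    refine and_congr_right fun _ => ?_
    have hl : σ (Fin.last k) = j := Equiv.swap_apply_right _ _
    rw [hl]
    exact ⟨fun h i => by simpa using h (σ.symm i), fun h i => h _⟩
  rw [hpre]
  refine setIntegral_congr_fun (measurableSet_maxRegion t j) fun y hy => ?_
  exact (hsymm σ y hy.1).symm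

theorem snoc_mem_maxRegion {t s : ℝ} {k : ℕ} {x : Fin k → ℝ} :
    (Fin.snoc x s : Fin (k + 1) → ℝ) ∈ maxRegion t (Fin.last k) ↔
      s ∈ Set.Icc 0 t ∧ x ∈ cube s k := by
  constructor
  · rintro ⟨h1, h2⟩
    have hs : s ∈ Set.Icc 0 t := by simpa using h1 (Fin.last k) trivial
    refine ⟨hs, fun i _ => ⟨?_, ?_⟩⟩
    · simpa using (h1 i.castSucc trivial).1
    · simpa using h2 i.castSucc
  · rintro ⟨hs, hx⟩
    refine ⟨snoc_mem_cube (fun i _ => ⟨(hx i trivial).1, (hx i trivial).2.trans hs.2⟩) hs, ?_⟩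
    intro i
    refine Fin.lastCases ?_ (fun j => ?_) i
    · simp
    · simpa using (hx j trivial).2

/-- Fubini with the largest coordinate outermost: the others then fill a cube of side `s`, as in an
iterated integral. -/
theorem setIntegral_maxRegion_last {t : ℝ} {k : ℕ} {G : (Fin (k + 1) → ℝ) → ℝ}
    (hG : IntegrableOn G (cube t (k + 1))) :
    ∫ y in maxRegion t (Fin.last k), G y =
      ∫ s in Set.Icc 0 t, ∫ x in cube s k, G (Fin.snoc x s) := by
  let e := (MeasurableEquiv.piFinSuccAbove (fun _ : Fin (k + 1) => ℝ) (Fin.last k)).symm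
  have he : MeasurePreserving e volume volume :=
    (volume_preserving_piFinSuccAbove (fun _ : Fin (k + 1) => ℝ) (Fin.last k)).symm _
  have hes : ∀ s x, e (s, x) = Fin.snoc x s := fun s x => Fin.insertNth_last' s x
  have hR := measurableSet_maxRegion t (Fin.last k)
  have hI : Integrable ((maxRegion t (Fin.last k)).indicator G) :=
    (hG.mono_set fun y hy => hy.1).integrable_indicator hR
  rw [← integral_indicator hR, ← he.integral_comp']
  have hI' : Integrable (fun z => (maxRegion t (Fin.last k)).indicator G (e z))
      ((volume : Measure ℝ).prod (volume : Measure (Fin k → ℝ))) :=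
    he.integrable_comp_of_integrable hI
  rw [Measure.volume_eq_prod, integral_prod _ hI', ← integral_indicator measurableSet_Icc]
  refine integral_congr_ae (.of_forall fun s => ?_)
  simp only [hes]
  by_cases hs : s ∈ Set.Icc 0 t
  · rw [Set.indicator_of_mem hs, ← integral_indicator (measurableSet_cube s k)]
    refine integral_congr_ae (.of_forall fun x => ?_)
    simp only
    by_cases hx : x ∈ cube s k
    · rw [Set.indicator_of_mem hx, Set.indicator_of_mem (snoc_mem_maxRegion.2 ⟨hs, hx⟩)]
    · rw [Set.indicator_of_notMem hx,
        Set.indicator_of_notMem fun h => hx (snoc_mem_maxRegion.1 h).2]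
  · rw [Set.indicator_of_notMem hs]
    refine integral_eq_zero_of_ae (.of_forall fun x => ?_)
    exact Set.indicator_of_notMem (fun h => hs (snoc_mem_maxRegion.1 h).1) _

/-- The integral of a symmetric function over a cube, by the value of the largest coordinate. -/
theorem setIntegral_cube_succ {t : ℝ} {k : ℕ} {G : (Fin (k + 1) → ℝ) → ℝ}
    (hG : IntegrableOn G (cube t (k + 1)))
    (hsymm : ∀ σ : Equiv.Perm (Fin (k + 1)), ∀ y ∈ cube t (k + 1), G (y ∘ σ) = G y) :
    ∫ y in cube t (k + 1), G y =
      (k + 1) * ∫ s in Set.Icc 0 t, ∫ x in cube s k, G (Fin.snoc x s) := by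
  rw [← iUnion_maxRegion, integral_iUnion_ae
    (fun j => (measurableSet_maxRegion t j).nullMeasurableSet)
    (fun i j hij => aedisjoint_maxRegion t hij) (by rwa [iUnion_maxRegion]), tsum_fintype]
  simp_rw [setIntegral_maxRegion hsymm]
  rw [setIntegral_maxRegion_last hG]
  simp

theorem volume_restrict_cube (t : ℝ) (k : ℕ) :
    (volume : Measure (Fin k → ℝ)).restrict (cube t k) =
      Measure.pi fun _ => volume.restrict (Set.Icc 0 t) := by
  rw [volume_pi, cube, Measure.restrict_pi_pi]

theorem cube_mono {t T : ℝ} (htT : t ≤ T) (k : ℕ) : cube t k ⊆ cube T k :=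
  Set.pi_mono fun _ _ => Set.Icc_subset_Icc_right htT

theorem integrableOn_mul_prod {T t : ℝ} (htT : t ≤ T) {h : ℝ → ℝ}
    (hh : IntegrableOn h (Set.Icc 0 T)) {k : ℕ} {f : (Fin k → ℝ) → ℝ}
    (hf : ContinuousOn f (cube T k)) :
    IntegrableOn (fun x => f x * ∏ j, h (x j)) (cube t k) := by
  have hsub := cube_mono htT k
  obtain ⟨M, hM⟩ := (isCompact_cube T k).exists_bound_of_continuousOn hf
  have h1 : Integrable (fun x : Fin k → ℝ => ∏ j, h (x j)) (volume.restrict (cube t k)) := by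
    rw [volume_restrict_cube]
    exact Integrable.fintype_prod (f := fun _ => h) fun _ =>
      hh.mono_set (Set.Icc_subset_Icc_right htT)
  refine h1.bdd_mul (c := M) ((hf.mono hsub).aestronglyMeasurable (measurableSet_cube t k)) ?_
  filter_upwards [ae_restrict_mem (measurableSet_cube t k)] with x hx using hM x (hsub hx)

/-- Extend the permutation by fixing the last index. Hence freezing the last variable of a symmetric
kernel leaves a symmetric kernel. -/
theorem snoc_comp_perm {k : ℕ} (σ : Equiv.Perm (Fin k)) (x : Fin k → ℝ) (s : ℝ) :
    ∃ τ : Equiv.Perm (Fin (k + 1)),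
      (Fin.snoc (x ∘ σ) s : Fin (k + 1) → ℝ) = (Fin.snoc x s : Fin (k + 1) → ℝ) ∘ τ := by
  let e : Fin (k + 1) ≃ Option (Fin k) := finSuccEquivLast
  refine ⟨(e.trans (Equiv.optionCongr σ)).trans e.symm, ?_⟩
  funext i
  refine Fin.lastCases ?_ (fun j => ?_) i
  · simp [e]
  · simp [e]

/-- For a symmetric kernel, the iterated integral is the integral over the cube divided by
`k!`. -/
theorem iteratedIntegral_eq {T : ℝ} {h : ℝ → ℝ} (hh : IntegrableOn h (Set.Icc 0 T)) {k : ℕ} :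
    ∀ {f : (Fin k → ℝ) → ℝ}, ContinuousOn f (cube T k) →
      (∀ σ : Equiv.Perm (Fin k), ∀ x ∈ cube T k, f (x ∘ σ) = f x) → ∀ {t : ℝ}, t ≤ T →
      iteratedIntegral h k f t = (k.factorial : ℝ)⁻¹ * ∫ x in cube t k, f x * ∏ j, h (x j) := by
  induction k with
  | zero =>
    intro f _ _ t _
    have hc : cube t 0 = Set.univ := Set.eq_univ_of_forall fun x i => i.elim0
    have : ∀ x : Fin 0 → ℝ, f x = f Fin.elim0 := fun x => congrArg f (Subsingleton.elim _ _)
    simp only [iteratedIntegral, hc, Measure.restrict_univ, Finset.univ_eq_empty,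
      Finset.prod_empty, mul_one, Nat.factorial_zero, Nat.cast_one, inv_one, one_mul]
    simp_rw [this]
    rw [integral_const, volume_pi, Measure.pi_of_empty]
    simp
  | succ k ih =>
    intro f hf hsymm t ht
    have hint := integrableOn_mul_prod ht hh hf
    have hGs : ∀ σ : Equiv.Perm (Fin (k + 1)), ∀ y ∈ cube t (k + 1),
        (fun x => f x * ∏ j, h (x j)) (y ∘ σ) = (fun x => f x * ∏ j, h (x j)) y := by
      intro σ y hy
      simp only [Function.comp_apply]
      rw [hsymm σ y (cube_mono ht _ hy), Equiv.prod_comp σ (fun j => h (y j))]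
    rw [setIntegral_cube_succ hint hGs, Nat.factorial_succ]
    -- The `k + 1` equal regions cancel one factor of the factorial, leaving the constant of the
    -- induction hypothesis.
    have e : (((k + 1) * k.factorial : ℕ) : ℝ)⁻¹ * ((k + 1) * ∫ s in Set.Icc 0 t,
        ∫ x in cube s k, f (Fin.snoc x s) * ∏ j, h ((Fin.snoc x s : Fin (k + 1) → ℝ) j)) =
        (k.factorial : ℝ)⁻¹ * ∫ s in Set.Icc 0 t,
        ∫ x in cube s k, f (Fin.snoc x s) * ∏ j, h ((Fin.snoc x s : Fin (k + 1) → ℝ) j) := by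
      have h1 : (k.factorial : ℝ) ≠ 0 := by positivity
      have h2 : (k + 1 : ℝ) ≠ 0 := by positivity
      push_cast
      field_simp
    rw [e, iteratedIntegral, ← integral_const_mul]
    refine setIntegral_congr_fun measurableSet_Icc fun s hs => ?_
    have hsT : s ∈ Set.Icc 0 T := ⟨hs.1, hs.2.trans ht⟩
    rw [ih (continuousOn_comp_snoc hf hsT) ?_ hsT.2]
    · rw [mul_left_comm, ← integral_const_mul]
      congr 1
      refine integral_congr_ae (.of_forall fun x => ?_)
      simp only [Fin.prod_univ_castSucc, Fin.snoc_castSucc, Fin.snoc_last]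
      ring
    · intro σ x hx
      obtain ⟨τ, hτ⟩ := snoc_comp_perm σ x s
      rw [hτ, hsymm τ _ (snoc_mem_cube hx hsT)]

end

noncomputable section

/-! ### The tensor product cosine basis -/

theorem integral_cos_int {T : ℝ} (hT : 0 < T) (m : ℤ) :
    ∫ t in Set.Icc 0 T, Real.cos (Real.pi * m * t / T) = if m = 0 then T else 0 := by
  rw [integral_Icc_eq_integral_Ioc, ← intervalIntegral.integral_of_le hT.le]
  split_ifs with hm
  · simp [hm]
  · have hc : Real.pi * m / T ≠ 0 := by
      have : (m : ℝ) ≠ 0 := by exact_mod_cast hm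
      have := Real.pi_ne_zero
      positivity
    have e : ∀ t : ℝ, Real.cos (Real.pi * m * t / T) = Real.cos (Real.pi * m / T * t) := by
      intro t; congr 1; ring
    simp_rw [e]
    rw [intervalIntegral.integral_comp_mul_left (fun x => Real.cos x) hc, integral_cos]
    have e2 : Real.pi * m / T * T = m * Real.pi := by field_simp
    rw [e2, Real.sin_int_mul_pi]
    simp

/-- The norming constants of the cosine basis. -/
def cosConst (T : ℝ) (n : ℕ) : ℝ := if n = 0 then 1 / √T else √(2 / T)

theorem cosBasis_eq (T : ℝ) (n : ℕ) (t : ℝ) :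
    cosBasis T n t = cosConst T n * Real.cos (Real.pi * n * t / T) := by
  unfold cosBasis cosConst
  split_ifs with hn
  · simp [hn]
  · rfl

theorem cosConst_ne_zero {T : ℝ} (hT : 0 < T) (n : ℕ) : cosConst T n ≠ 0 := by
  unfold cosConst
  split_ifs <;> positivity

/-- Product-to-sum gives the integer frequencies n - m and n + m. Both vanish only for n = m = 0,
which is why the constant function is normed differently. -/
theorem integral_cosBasis_mul {T : ℝ} (hT : 0 < T) (n m : ℕ) :
    ∫ t in Set.Icc 0 T, cosBasis T n t * cosBasis T m t = if n = m then 1 else 0 := by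
  have e : ∀ t, cosBasis T n t * cosBasis T m t = cosConst T n * cosConst T m *
      (1 / 2 * (Real.cos (Real.pi * ((n - m : ℤ) : ℝ) * t / T) +
        Real.cos (Real.pi * ((n + m : ℤ) : ℝ) * t / T))) := by
    intro t
    have h1 : Real.pi * ((n - m : ℤ) : ℝ) * t / T = Real.pi * n * t / T - Real.pi * m * t / T := by
      push_cast; ring
    have h2 : Real.pi * ((n + m : ℤ) : ℝ) * t / T = Real.pi * n * t / T + Real.pi * m * t / T := by
      push_cast; ring
    rw [cosBasis_eq, cosBasis_eq, h1, h2, Real.cos_sub, Real.cos_add]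
    ring
  simp_rw [e]
  have i : ∀ m : ℤ, Integrable (fun t : ℝ => Real.cos (Real.pi * m * t / T))
      (volume.restrict (Set.Icc 0 T)) := fun m =>
    (by fun_prop : Continuous fun t : ℝ => Real.cos (Real.pi * m * t / T)
      ).continuousOn.integrableOn_compact isCompact_Icc
  rw [integral_const_mul, integral_const_mul, integral_add (i _) (i _), integral_cos_int hT,
    integral_cos_int hT]
  by_cases hnm : n = m
  · subst hnm
    by_cases hn : n = 0
    · subst hn
      have h1 : √T * √T = T := Real.mul_self_sqrt hT.le
      simp only [cosConst, if_true, CharP.cast_eq_zero, sub_self, add_zero]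
      field_simp
      rw [pow_two, h1]
      ring
    · have h0 : ¬ ((n : ℤ) + n = 0) := by omega
      have h1 : √(2 / T) * √(2 / T) = 2 / T := Real.mul_self_sqrt (by positivity)
      simp only [cosConst, hn, if_false, sub_self, if_true, h0, h1]
      field_simp
      ring
  · have h0 : ¬ ((n : ℤ) - m = 0) := by omega
    have h1 : ¬ ((n : ℤ) + m = 0) := by omega
    simp [hnm, h0, h1]

/-- The tensor product cosine basis. -/
def tensorBasis (T : ℝ) {k : ℕ} (i : Fin k → ℕ) (x : Fin k → ℝ) : ℝ :=
  ∏ j, cosBasis T (i j) (x j)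

theorem tensorBasis_continuous (T : ℝ) {k : ℕ} (i : Fin k → ℕ) : Continuous (tensorBasis T i) :=
  continuous_finsetProd _ fun j _ => (cosBasis_continuous T (i j)).comp (continuous_apply j)

theorem memLp_of_continuousOn_cube {T : ℝ} {k : ℕ} {f : (Fin k → ℝ) → ℝ}
    (hf : ContinuousOn f (cube T k)) : MemLp f 2 (volume.restrict (cube T k)) := by
  obtain ⟨M, hM⟩ := (isCompact_cube T k).exists_bound_of_continuousOn hf
  have : IsFiniteMeasure ((volume : Measure (Fin k → ℝ)).restrict (cube T k)) :=
    ⟨by simpa using (isCompact_cube T k).measure_lt_top⟩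
  refine MemLp.of_bound (hf.aestronglyMeasurable (measurableSet_cube T k)) M ?_
  filter_upwards [ae_restrict_mem (measurableSet_cube T k)] with x hx using hM x hx

theorem setIntegral_cube_prod (T : ℝ) {k : ℕ} (u : Fin k → ℝ → ℝ) :
    ∫ x in cube T k, ∏ j, u j (x j) = ∏ j, ∫ t in Set.Icc 0 T, u j t := by
  rw [volume_restrict_cube, integral_fintype_prod_eq_prod]

theorem setIntegral_tensorBasis_mul {T : ℝ} (hT : 0 < T) {k : ℕ} (i i' : Fin k → ℕ) :
    ∫ x in cube T k, tensorBasis T i x * tensorBasis T i' x = if i = i' then 1 else 0 := by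
  simp_rw [tensorBasis, ← Finset.prod_mul_distrib]
  rw [setIntegral_cube_prod T (fun j t => cosBasis T (i j) t * cosBasis T (i' j) t)]
  simp_rw [integral_cosBasis_mul hT]
  split_ifs with h
  · simp [h]
  · obtain ⟨j, hj⟩ := Function.ne_iff.1 h
    exact Finset.prod_eq_zero (Finset.mem_univ j) (if_neg hj)

/-- Products of cosines, as continuous functions on the cube. -/
def cosProd (T : ℝ) {k : ℕ} (i : Fin k → ℕ) : C(cube T k, ℝ) where
  toFun x := ∏ j, Real.cos (Real.pi * i j * x.1 j / T)
  continuous_toFun := by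
    refine continuous_finsetProd _ fun j _ => ?_
    have : Continuous fun x : cube T k => x.1 j := (continuous_apply j).comp continuous_subtype_val
    exact Real.continuous_cos.comp ((continuous_const.mul this).div_const T)

theorem cosProd_apply (T : ℝ) {k : ℕ} (i : Fin k → ℕ) (x : cube T k) :
    cosProd T i x = ∏ j, Real.cos (Real.pi * i j * x.1 j / T) := rfl

theorem cosProd_single (T : ℝ) {k : ℕ} (j : Fin k) (x : cube T k) :
    cosProd T (Pi.single j 1) x = Real.cos (Real.pi * x.1 j / T) := by
  rw [cosProd_apply, Finset.prod_eq_single j]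
  · simp
  · intro l _ hl
    simp [hl]
  · simp

/-- Product-to-sum moves the frequency in coordinate `j` up and down by one; frequency zero is
separate, since it cannot be lowered in ℕ. -/
theorem cosProd_single_mul (T : ℝ) {k : ℕ} (j : Fin k) (i : Fin k → ℕ) :
    cosProd T (Pi.single j 1) * cosProd T i ∈ Submodule.span ℝ (Set.range (cosProd T (k := k))) := by
  classical
  have hs := cosProd_single T j
  have hu : ∀ (m : ℕ) (x : cube T k), cosProd T (Function.update i j m) x =
      Real.cos (Real.pi * m * x.1 j / T) *
        ∏ l ∈ Finset.univ.erase j, Real.cos (Real.pi * i l * x.1 l / T) := by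
    intro m x
    rw [cosProd_apply, ← Finset.mul_prod_erase _ _ (Finset.mem_univ j)]
    congr 1
    · simp
    · refine Finset.prod_congr rfl fun l hl => ?_
      rw [Function.update_of_ne (Finset.ne_of_mem_erase hl)]
  have hi : ∀ x, cosProd T i x = Real.cos (Real.pi * i j * x.1 j / T) *
        ∏ l ∈ Finset.univ.erase j, Real.cos (Real.pi * i l * x.1 l / T) := by
    intro x
    rw [← hu (i j) x, Function.update_eq_self]
  have hmem : ∀ m, cosProd T (Function.update i j m) ∈
      Submodule.span ℝ (Set.range (cosProd T (k := k))) := fun m =>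
    Submodule.subset_span ⟨_, rfl⟩
  by_cases h0 : i j = 0
  · have : cosProd T (Pi.single j 1) * cosProd T i = cosProd T (Function.update i j 1) := by
      ext x
      rw [ContinuousMap.mul_apply, hs, hi, hu, h0]
      simp
    rw [this]
    exact hmem 1
  · obtain ⟨n, hn⟩ := Nat.exists_eq_succ_of_ne_zero h0
    have : cosProd T (Pi.single j 1) * cosProd T i =
        (1 / 2 : ℝ) • (cosProd T (Function.update i j (n + 2)) +
          cosProd T (Function.update i j n)) := by
      ext x
      rw [ContinuousMap.mul_apply, ContinuousMap.smul_apply, ContinuousMap.add_apply, hs, hi, hu,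
        hu, hn, smul_eq_mul]
      set y := x.1 j
      have e1 : Real.pi * ((n + 2 : ℕ) : ℝ) * y / T =
          Real.pi * ((n.succ : ℕ) : ℝ) * y / T + Real.pi * y / T := by push_cast; ring
      have e2 : Real.pi * (n : ℝ) * y / T =
          Real.pi * ((n.succ : ℕ) : ℝ) * y / T - Real.pi * y / T := by push_cast; ring
      rw [e1, e2, Real.cos_add, Real.cos_sub]
      ring
    rw [this]
    exact Submodule.smul_mem _ _ (Submodule.add_mem _ (hmem _) (hmem _))

/-- Multiplication by any element of the algebra preserves the span, by induction on the element;
apply it to the constant one. -/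
theorem adjoin_le_span_cosProd (T : ℝ) (k : ℕ) {a : C(cube T k, ℝ)}
    (ha : a ∈ Algebra.adjoin ℝ (Set.range fun j : Fin k => cosProd T (Pi.single j 1))) :
    a ∈ Submodule.span ℝ (Set.range (cosProd T (k := k))) := by
  set S := Submodule.span ℝ (Set.range (cosProd T (k := k))) with hS
  have h1 : (1 : C(cube T k, ℝ)) ∈ S := by
    refine Submodule.subset_span ⟨0, ?_⟩
    ext x
    simp [cosProd]
  have key : ∀ p ∈ S, a * p ∈ S := by
    induction ha using Algebra.adjoin_induction with
    | mem a ha =>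
      obtain ⟨j, rfl⟩ := ha
      intro p hp
      induction hp using Submodule.span_induction with
      | mem p hp =>
        obtain ⟨i, rfl⟩ := hp
        exact cosProd_single_mul T j i
      | zero => simp
      | add p q _ _ hp hq => rw [mul_add]; exact S.add_mem hp hq
      | smul c p _ hp => rw [mul_smul_comm]; exact S.smul_mem c hp
    | algebraMap c =>
      intro p hp
      rw [← Algebra.smul_def]
      exact S.smul_mem c hp
    | add a b _ _ ha hb =>
      intro p hp
      rw [add_mul]
      exact S.add_mem (ha p hp) (hb p hp)
    | mul a b _ _ ha hb =>
      intro p hp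
      rw [mul_assoc]
      exact ha _ (hb p hp)
  simpa using key 1 h1

/-- Uniform approximation on the cube by trigonometric polynomials. -/
theorem exists_cos_approx {T : ℝ} (hT : 0 < T) {k : ℕ} {g : (Fin k → ℝ) → ℝ}
    (hg : ContinuousOn g (cube T k)) {ε : ℝ} (hε : 0 < ε) :
    ∃ a : (Fin k → ℕ) →₀ ℝ, ∀ x ∈ cube T k,
      |g x - a.sum fun i c => c * ∏ j, Real.cos (Real.pi * i j * x j / T)| ≤ ε := by
  have : CompactSpace (cube T k) := isCompact_iff_compactSpace.1 (isCompact_cube T k)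
  let A := Algebra.adjoin ℝ (Set.range fun j : Fin k => cosProd T (Pi.single j 1))
  -- Cosine is injective on [0,π], so the cosines of single coordinates separate points and
  -- Stone–Weierstrass applies.
  have hsep : A.SeparatesPoints := by
    intro x y hxy
    obtain ⟨j, hj⟩ : ∃ j, x.1 j ≠ y.1 j := by
      by_contra h
      push Not at h
      exact hxy (Subtype.ext (funext h))
    refine ⟨cosProd T (Pi.single j 1), ⟨_, Algebra.subset_adjoin ⟨j, rfl⟩, rfl⟩, fun h => hj ?_⟩
    rw [cosProd_single, cosProd_single] at h
    have hm : ∀ x : cube T k, Real.pi * x.1 j / T ∈ Set.Icc 0 Real.pi := by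
      intro x
      have hx := x.2 j trivial
      have hp := Real.pi_pos
      refine ⟨div_nonneg (mul_nonneg hp.le hx.1) hT.le, ?_⟩
      rw [div_le_iff₀ hT]
      exact mul_le_mul_of_nonneg_left hx.2 hp.le
    have := Real.injOn_cos (hm x) (hm y) h
    have hp := Real.pi_ne_zero
    field_simp at this
    exact this
  have hdense := ContinuousMap.subalgebra_topologicalClosure_eq_top_of_separatesPoints A hsep
  let G : C(cube T k, ℝ) := ⟨fun x => g x.1, hg.comp_continuous continuous_subtype_val
    fun x => x.2⟩
  have hG : G ∈ closure (A : Set C(cube T k, ℝ)) := by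
    have : G ∈ A.topologicalClosure := by rw [hdense]; trivial
    exact this
  obtain ⟨p, hp, hGp⟩ := Metric.mem_closure_iff.1 hG ε hε
  obtain ⟨a, rfl⟩ := Finsupp.mem_span_range_iff_exists_finsupp.1 (adjoin_le_span_cosProd T k hp)
  refine ⟨a, fun x hx => ?_⟩
  have h1 := (ContinuousMap.dist_apply_le_dist (f := G) ⟨x, hx⟩).trans hGp.le
  rw [Real.dist_eq] at h1
  have e : (a.sum fun i c => c • cosProd T i) ⟨x, hx⟩ =
      a.sum fun i c => c * ∏ j, Real.cos (Real.pi * i j * x j / T) := by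
    simp only [Finsupp.sum, ContinuousMap.coe_sum, Finset.sum_apply]
    rfl
  rw [← e]
  exact h1

theorem tensorBasis_eq {T : ℝ} {k : ℕ} (i : Fin k → ℕ) (x : Fin k → ℝ) :
    tensorBasis T i x =
      (∏ j, cosConst T (i j)) * ∏ j, Real.cos (Real.pi * i j * x j / T) := by
  simp_rw [tensorBasis, cosBasis_eq, Finset.prod_mul_distrib]

variable (T : ℝ) in
/-- The tensor product cosine basis in `L₂([0,T]^k)`. -/
def tensorBasisLp {k : ℕ} (i : Fin k → ℕ) :
    Lp ℝ 2 ((volume : Measure (Fin k → ℝ)).restrict (cube T k)) :=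
  (memLp_of_continuousOn_cube (tensorBasis_continuous T i).continuousOn).toLp

theorem orthonormal_tensorBasisLp {T : ℝ} (hT : 0 < T) (k : ℕ) :
    Orthonormal ℝ (tensorBasisLp T (k := k)) := by
  rw [orthonormal_iff_ite]
  intro i i'
  rw [tensorBasisLp, tensorBasisLp, SimpleProcess.inner_toLp, setIntegral_tensorBasis_mul hT]

/-- Replacing `g` by a trigonometric polynomial within `ε` changes the integral by at most `ε` times
the L₁ norm of `F`. -/
theorem setIntegral_mul_eq_zero_of_cos {T : ℝ} (hT : 0 < T) {k : ℕ} {F : (Fin k → ℝ) → ℝ}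
    (hF : MemLp F 2 (volume.restrict (cube T k)))
    (horth : ∀ i : Fin k → ℕ,
      ∫ x in cube T k, F x * ∏ j, Real.cos (Real.pi * i j * x j / T) = 0)
    {g : (Fin k → ℝ) → ℝ} (hg : Continuous g) : ∫ x in cube T k, F x * g x = 0 := by
  have hfin : IsFiniteMeasure ((volume : Measure (Fin k → ℝ)).restrict (cube T k)) :=
    ⟨by simpa using (isCompact_cube T k).measure_lt_top⟩
  have hF1 : IntegrableOn F (cube T k) := hF.integrable (by norm_num)
  have hbound : ∀ ε > 0, |∫ x in cube T k, F x * g x| ≤ ε * ∫ x in cube T k, |F x| := by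
    intro ε hε
    obtain ⟨a, ha⟩ := exists_cos_approx hT hg.continuousOn hε
    let c : (Fin k → ℕ) → (Fin k → ℝ) → ℝ := fun i x => ∏ j, Real.cos (Real.pi * i j * x j / T)
    let p : (Fin k → ℝ) → ℝ := fun x => a.sum fun i r => r * c i x
    have hci : ∀ i, Continuous (c i) := fun i => by fun_prop
    have hpi : ∀ i, IntegrableOn (fun x => F x * c i x) (cube T k) :=
      fun i => hF.integrable_mul (memLp_of_continuousOn_cube (hci i).continuousOn)
    have e : ∀ x, F x * p x = ∑ i ∈ a.support, a i * (F x * c i x) := by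
      intro x
      simp only [p, Finsupp.sum, Finset.mul_sum]
      exact Finset.sum_congr rfl fun i _ => by ring
    have hp0 : ∫ x in cube T k, F x * p x = 0 := by
      simp_rw [e]
      rw [integral_finsetSum _ fun i _ => (hpi i).const_mul _]
      refine Finset.sum_eq_zero fun i _ => ?_
      rw [integral_const_mul, horth i, mul_zero]
    have hpint : IntegrableOn (fun x => F x * p x) (cube T k) := by
      simp_rw [e]
      exact integrable_finsetSum _ fun i _ => (hpi i).const_mul _
    have hgint : IntegrableOn (fun x => F x * g x) (cube T k) :=
      hF.integrable_mul (memLp_of_continuousOn_cube hg.continuousOn)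
    have : ∫ x in cube T k, F x * g x = ∫ x in cube T k, F x * (g x - p x) := by
      simp_rw [mul_sub]
      rw [integral_sub hgint hpint, hp0, sub_zero]
    rw [this, ← integral_const_mul, ← Real.norm_eq_abs]
    refine norm_integral_le_of_norm_le (hF1.abs.const_mul ε) ?_
    filter_upwards [ae_restrict_mem (measurableSet_cube T k)] with x hx
    rw [Real.norm_eq_abs, abs_mul, mul_comm]
    exact mul_le_mul_of_nonneg_right (ha x hx) (abs_nonneg _)
  have hC : 0 ≤ ∫ x in cube T k, |F x| := integral_nonneg fun _ => abs_nonneg _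
  rw [← abs_eq_zero]
  refine le_antisymm (le_of_forall_pos_le_add fun δ hδ => ?_) (abs_nonneg _)
  refine (hbound (δ / ((∫ x in cube T k, |F x|) + 1)) (by positivity)).trans ?_
  rw [zero_add, div_mul_eq_mul_div, div_le_iff₀ (by positivity)]
  nlinarith

/-- Completeness of the basis: an orthogonal `F` is orthogonal to every continuous function, and
some continuous function lies within δ of `F`, whence ‖F‖² ≤ ‖F‖ δ. -/
theorem orthogonal_span_tensorBasisLp {T : ℝ} (hT : 0 < T) (k : ℕ) :
    (Submodule.span ℝ (Set.range (tensorBasisLp T (k := k))))ᗮ = ⊥ := by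
  rw [Submodule.eq_bot_iff]
  intro F hF
  have horth : ∀ i : Fin k → ℕ,
      ∫ x in cube T k, F x * ∏ j, Real.cos (Real.pi * i j * x j / T) = 0 := by
    intro i
    have h := (Submodule.mem_orthogonal' _ _).1 hF _ (Submodule.subset_span ⟨i, rfl⟩)
    have h' := SimpleProcess.inner_toLp (Lp.memLp F)
      (memLp_of_continuousOn_cube (tensorBasis_continuous T i).continuousOn)
    rw [Lp.toLp_coeFn] at h'
    rw [tensorBasisLp, h'] at h
    simp_rw [tensorBasis_eq, mul_left_comm _ (∏ j, cosConst T (i j)), integral_const_mul] at h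
    exact (mul_eq_zero.1 h).resolve_left
      (Finset.prod_ne_zero_iff.2 fun j _ => cosConst_ne_zero hT (i j))
  rw [← norm_eq_zero]
  refine le_antisymm (le_of_forall_pos_le_add fun δ hδ => ?_) (norm_nonneg _)
  obtain ⟨g, -, hg, hgc, hg2⟩ := (Lp.memLp F).exists_hasCompactSupport_eLpNorm_sub_le (by simp)
    (ENNReal.ofReal_pos.2 hδ).ne'
  have h0 : inner ℝ F (hg2.toLp g) = (0 : ℝ) := by
    have h' := SimpleProcess.inner_toLp (Lp.memLp F) hg2
    rw [Lp.toLp_coeFn] at h'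
    rw [h', setIntegral_mul_eq_zero_of_cos hT (Lp.memLp F) horth hgc]
  have h1 : ‖F - hg2.toLp g‖ ≤ δ := by
    have : F - hg2.toLp g = ((Lp.memLp F).sub hg2).toLp := by
      rw [MemLp.toLp_sub (Lp.memLp F) hg2, Lp.toLp_coeFn]
    rw [this, Lp.norm_toLp]
    exact ENNReal.toReal_le_of_le_ofReal hδ.le hg
  have h2 : ‖F‖ ^ 2 ≤ ‖F‖ * δ := by
    calc ‖F‖ ^ 2 = inner ℝ F (F - hg2.toLp g) := by
          rw [inner_sub_right, h0, sub_zero, real_inner_self_eq_norm_sq]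
      _ ≤ ‖F‖ * ‖F - hg2.toLp g‖ := real_inner_le_norm _ _
      _ ≤ _ := mul_le_mul_of_nonneg_left h1 (norm_nonneg _)
  rw [zero_add]
  by_contra h
  push Not at h
  nlinarith

/-- Parseval's identity for the tensor product cosine basis. -/
theorem hasSum_kernelCoef_mul {T : ℝ} (hT : 0 < T) {k : ℕ} {f g : (Fin k → ℝ) → ℝ}
    (hf : MemLp f 2 (volume.restrict (cube T k))) (hg : MemLp g 2 (volume.restrict (cube T k))) :
    HasSum (fun i => kernelCoef T f i * kernelCoef T g i) (∫ x in cube T k, f x * g x) := by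
  let b := HilbertBasis.mkOfOrthogonalEqBot (orthonormal_tensorBasisLp hT k)
    (orthogonal_span_tensorBasisLp hT k)
  have h := b.hasSum_inner_mul_inner (hf.toLp f) (hg.toLp g)
  rw [SimpleProcess.inner_toLp hf hg] at h
  have e : (fun i => kernelCoef T f i * kernelCoef T g i) =
      fun i => inner ℝ (hf.toLp f) (b i) * inner ℝ (b i) (hg.toLp g) := by
    funext i
    have hb : b i = tensorBasisLp T i := by
      simp only [b, HilbertBasis.coe_mkOfOrthogonalEqBot]
    rw [hb, real_inner_comm (hg.toLp g), tensorBasisLp, SimpleProcess.inner_toLp, SimpleProcess.inner_toLp]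
    rfl
  rw [e]
  exact h

/-! ### Norms of tensor powers and the duality of `‖·‖_q` and `‖·‖_{-q}` -/

/-- The coefficient of a function of one variable in the cosine basis. -/
def cosCoef (T : ℝ) (h : ℝ → ℝ) (n : ℕ) : ℝ := ∫ t in Set.Icc 0 T, h t * cosBasis T n t

theorem kernelCoef_prod (T : ℝ) (h : ℝ → ℝ) {k : ℕ} (i : Fin k → ℕ) :
    kernelCoef T (fun x => ∏ j, h (x j)) i = ∏ j, cosCoef T h (i j) := by
  unfold kernelCoef cosCoef
  simp_rw [← Finset.prod_mul_distrib]
  rw [setIntegral_cube_prod T (fun j t => h t * cosBasis T (i j) t)]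

theorem memLp_prod {T : ℝ} {h : ℝ → ℝ} (hh : MemLp h 2 (volume.restrict (Set.Icc 0 T))) (k : ℕ) :
    MemLp (fun x : Fin k → ℝ => ∏ j, h (x j)) 2 (volume.restrict (cube T k)) := by
  rw [volume_restrict_cube]
  have h1 : Integrable (fun x : Fin k → ℝ => ∏ j, h (x j))
      (Measure.pi fun _ => volume.restrict (Set.Icc 0 T)) :=
    Integrable.fintype_prod (f := fun _ => h) fun _ => hh.integrable (by norm_num)
  rw [memLp_two_iff_integrable_sq h1.1]
  simp_rw [← Finset.prod_pow]
  exact Integrable.fintype_prod (f := fun _ t => h t ^ 2) fun _ => hh.integrable_sq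

/-- Distributivity, peeling off the first index. With values in [0,∞] no summability is needed, so
infinite norms are covered. -/
theorem tsum_prod_eq_pow (a : ℕ → ℝ≥0∞) (k : ℕ) :
    ∑' i : Fin k → ℕ, ∏ j, a (i j) = (∑' n, a n) ^ k := by
  induction k with
  | zero => simp
  | succ k ih =>
    rw [← (Fin.consEquiv (fun _ : Fin (k + 1) => ℕ)).tsum_eq]
    have : ∀ p : ℕ × (Fin k → ℕ), ∏ j, a (Fin.consEquiv (fun _ : Fin (k + 1) => ℕ) p j) =
        a p.1 * ∏ j, a (p.2 j) := by
      intro p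
      rw [Fin.prod_univ_succ]
      simp [Fin.consEquiv]
    simp_rw [this]
    rw [ENNReal.tsum_prod (f := fun n (i : Fin k → ℕ) => a n * ∏ j, a (i j))]
    simp_rw [ENNReal.tsum_mul_left, ih, ENNReal.tsum_mul_right]
    rw [pow_succ, mul_comm]

/-- The tensor product norm of `h ⊗ ⋯ ⊗ h`. -/
theorem kernelNormSq_prod (T s : ℝ) (h : ℝ → ℝ) (k : ℕ) :
    kernelNormSq T s (fun x : Fin k → ℝ => ∏ j, h (x j)) = sobolevNormSq T s h ^ k := by
  rw [sobolevNormSq, ← tsum_prod_eq_pow, kernelNormSq]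
  refine tsum_congr fun i => ?_
  rw [kernelCoef_prod, ← Finset.prod_pow, ← Finset.prod_mul_distrib,
    ENNReal.ofReal_prod_of_nonneg fun j _ => mul_nonneg
      (Real.rpow_nonneg (eigenvalue_pos _).le _) (sq_nonneg _)]
  rfl

theorem sum_le_toReal_tsum {ι : Type*} {a : ι → ℝ} (ha : ∀ i, 0 ≤ a i)
    (h : ∑' i, ENNReal.ofReal (a i) ≠ ∞) (s : Finset ι) :
    ∑ i ∈ s, a i ≤ (∑' i, ENNReal.ofReal (a i)).toReal := by
  rw [← ENNReal.ofReal_le_iff_le_toReal h, ENNReal.ofReal_sum_of_nonneg fun i _ => ha i]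
  exact ENNReal.sum_le_tsum s

/-- Duality of the norms `‖·‖_q` and `‖·‖_{-q}`. -/
theorem sq_setIntegral_mul_le {T : ℝ} (hT : 0 < T) (q : ℝ) {k : ℕ} {f g : (Fin k → ℝ) → ℝ}
    (hf : MemLp f 2 (volume.restrict (cube T k))) (hg : MemLp g 2 (volume.restrict (cube T k)))
    (hfq : kernelNormSq T q f ≠ ∞) (hgq : kernelNormSq T (-q) g ≠ ∞) :
    (∫ x in cube T k, f x * g x) ^ 2 ≤
      (kernelNormSq T q f).toReal * (kernelNormSq T (-q) g).toReal := by
  have hsum := hasSum_kernelCoef_mul hT hf hg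
  have hw : ∀ (r : ℝ) (i : Fin k → ℕ), 0 < ∏ j, eigenvalue (i j) ^ r := fun r i =>
    Finset.prod_pos fun j _ => Real.rpow_pos_of_pos (eigenvalue_pos _) _
  refine le_of_tendsto ((continuous_pow 2).tendsto _ |>.comp hsum) (.of_forall fun s => ?_)
  simp only [Function.comp_apply]
  -- Distribute reciprocal weights between the factors, so that the finite Cauchy–Schwarz inequality
  -- yields partial sums of the two dual norms.
  have e : ∀ i, kernelCoef T f i * kernelCoef T g i =
      (√(∏ j, eigenvalue (i j) ^ q) * kernelCoef T f i) *
      (√(∏ j, eigenvalue (i j) ^ (-q)) * kernelCoef T g i) := by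
    intro i
    have : √(∏ j, eigenvalue (i j) ^ q) * √(∏ j, eigenvalue (i j) ^ (-q)) = 1 := by
      rw [← Real.sqrt_mul (hw q i).le, ← Finset.prod_mul_distrib]
      have : ∀ j, eigenvalue (i j) ^ q * eigenvalue (i j) ^ (-q) = 1 := fun j => by
        rw [← Real.rpow_add (eigenvalue_pos _), add_neg_cancel, Real.rpow_zero]
      simp [this]
    calc _ = (√(∏ j, eigenvalue (i j) ^ q) * √(∏ j, eigenvalue (i j) ^ (-q))) *
          (kernelCoef T f i * kernelCoef T g i) := by rw [this, one_mul]
      _ = _ := by ring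
  simp_rw [e]
  refine (Finset.sum_mul_sq_le_sq_mul_sq s _ _).trans ?_
  simp_rw [mul_pow, Real.sq_sqrt (hw _ _).le]
  exact mul_le_mul
    (sum_le_toReal_tsum (fun i => mul_nonneg (hw q i).le (sq_nonneg _)) hfq s)
    (sum_le_toReal_tsum (fun i => mul_nonneg (hw (-q) i).le (sq_nonneg _)) hgq s)
    (Finset.sum_nonneg fun i _ => mul_nonneg (hw (-q) i).le (sq_nonneg _)) ENNReal.toReal_nonneg

end

noncomputable section

/-! ### The functional given by the stochastic exponential -/

theorem kernelNorm_sq (T s : ℝ) {k : ℕ} (f : (Fin k → ℝ) → ℝ) :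
    kernelNorm T s f ^ 2 = (kernelNormSq T s f).toReal :=
  Real.sq_sqrt ENNReal.toReal_nonneg

theorem integrableOn_mul_tensor {T : ℝ} {h : ℝ → ℝ}
    (hh : MemLp h 2 (volume.restrict (Set.Icc 0 T))) {k : ℕ} {f : (Fin k → ℝ) → ℝ}
    (hf : ContinuousOn f (cube T k)) :
    IntegrableOn (fun x => f x * ∏ j, h (x j)) (cube T k) :=
  (memLp_of_continuousOn_cube hf).integrable_mul (memLp_prod hh k)

/-- The functional `f ↦ (1 / k!) ⟨f, h ⊗ ⋯ ⊗ h⟩` on the kernels in `k` variables. -/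
def kernelPairing {T : ℝ} (q : ℝ) {h : ℝ → ℝ} (hh : MemLp h 2 (volume.restrict (Set.Icc 0 T)))
    (k : ℕ) : smoothKernel T q k →ₗ[ℝ] ℝ where
  toFun f := (k.factorial : ℝ)⁻¹ * ∫ x in cube T k, f.1 x * ∏ j, h (x j)
  map_add' f g := by
    rw [← mul_add, ← integral_add (integrableOn_mul_tensor hh f.2.1.continuousOn)
      (integrableOn_mul_tensor hh g.2.1.continuousOn)]
    simp [add_mul]
  map_smul' c f := by
    simp only [RingHom.id_apply, smul_eq_mul]
    rw [mul_left_comm c, ← integral_const_mul c]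
    simp [mul_assoc]

namespace SimpleElement

variable {T p q : ℝ} {h : ℝ → ℝ}

theorem kernel_of_notMem {η : SimpleElement T p q} {k : ℕ} (hk : k ∉ η.support) :
    η.kernel k = 0 := by
  classical
  by_contra h
  exact hk (DFinsupp.mem_support_iff.2 h)

theorem normSq_eq_sum (η : SimpleElement T p q) {s : Finset ℕ} (hs : η.support ⊆ s) :
    η.normSq = ∑ k ∈ s,
      (2 : ℝ) ^ ((k : ℝ) * p) / (k.factorial : ℝ) ^ 2 * kernelNorm T q (η.kernel k).1 ^ 2 :=
  Finset.sum_subset hs fun k _ hk => by simp [kernelNorm_of_notMem hk]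

theorem sum_kernelPairing_eq (hh : MemLp h 2 (volume.restrict (Set.Icc 0 T)))
    (η : SimpleElement T p q) {s : Finset ℕ} (hs : η.support ⊆ s) :
    ∑ k ∈ η.support, kernelPairing q hh k (η.kernel k) =
      ∑ k ∈ s, kernelPairing q hh k (η.kernel k) :=
  Finset.sum_subset hs fun k _ hk => by rw [kernel_of_notMem hk, map_zero]

/-- The functional `η ↦ ∑_k (1 / k!) ⟨η_k, h ⊗ ⋯ ⊗ h⟩` on the finite chaos expansions. -/
def pairing (p q : ℝ) (hh : MemLp h 2 (volume.restrict (Set.Icc 0 T))) :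
    SimpleElement T p q →ₗ[ℝ] ℝ where
  toFun η := ∑ k ∈ η.support, kernelPairing q hh k (η.kernel k)
  map_add' η ζ := by
    rw [sum_kernelPairing_eq hh (η + ζ) (s := (η + ζ).support ∪ (η.support ∪ ζ.support)) Finset.subset_union_left,
      sum_kernelPairing_eq hh η (Finset.subset_union_left.trans Finset.subset_union_right),
      sum_kernelPairing_eq hh ζ (Finset.subset_union_right.trans Finset.subset_union_right), ← Finset.sum_add_distrib]
    exact Finset.sum_congr rfl fun k _ => by rw [kernel_add, map_add]
  map_smul' c η := by
    rw [sum_kernelPairing_eq hh (c • η) (s := (c • η).support ∪ η.support) Finset.subset_union_left,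
      sum_kernelPairing_eq hh η Finset.subset_union_right, RingHom.id_apply, Finset.smul_sum]
    exact Finset.sum_congr rfl fun k _ => by rw [kernel_smul, map_smul]

theorem pairing_eq_sum (hh : MemLp h 2 (volume.restrict (Set.Icc 0 T)))
    (η : SimpleElement T p q) {s : Finset ℕ} (hs : η.support ⊆ s) :
    pairing p q hh η = ∑ k ∈ s, kernelPairing q hh k (η.kernel k) :=
  sum_kernelPairing_eq hh η hs

variable {Ω : Type*} [mΩ : MeasurableSpace Ω] {P : Measure Ω} [IsProbabilityMeasure P]
  {𝓕 : Filtration ℝ mΩ} {W : ℝ → Ω → ℝ}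

/-- Here probability ends: integration by parts and the symmetry of the kernels turn the expectation
into a deterministic functional. -/
theorem integral_toLp_mul_stochExp (hW : IsWienerProcess P T 𝓕 W) (hT : 0 ≤ T)
    (hh : MemLp h 2 (volume.restrict (Set.Icc 0 T))) (η : SimpleElement T p q) :
    ∫ ω, η.toLp P 𝓕 W ω * stochExp P T 𝓕 W h ω ∂P = pairing p q hh η := by
  have e : (fun ω => η.toLp P 𝓕 W ω * stochExp P T 𝓕 W h ω) =ᵐ[P] fun ω =>
      ∑ k ∈ η.support, iteratedIto P 𝓕 W (η.kernel k).1 T ω * stochExp P T 𝓕 W h ω := by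
    filter_upwards [SimpleProcess.coeFn_finset_sum η.support
      (fun k => iteratedIto P 𝓕 W (η.kernel k).1 T)] with ω hω
    rw [toLp, hω, Finset.sum_mul]
  have hi : ∀ k, Integrable (fun ω =>
      iteratedIto P 𝓕 W (η.kernel k).1 T ω * stochExp P T 𝓕 W h ω) P := fun k =>
    (Lp.memLp _).integrable_mul (memLp_stochExp hW hT hh)
  rw [integral_congr_ae e, integral_finsetSum _ fun k _ => hi k, pairing_eq_sum hh η subset_rfl]
  refine Finset.sum_congr rfl fun k _ => ?_
  have hT' : T ∈ Set.Icc 0 T := ⟨hT, le_rfl⟩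
  have hc := (η.kernel k).2.1.continuousOn
  rw [(isIteratedIto_iteratedIto hW hc hT').integral_mul_stochExp hW hh hT',
    iteratedIntegral_eq (hh.integrable (by norm_num)) hc (η.kernel k).2.2.1 le_rfl]
  rfl

/-- Duality of the kernel norms bounds the term of order k by √(r^k) times its share of ‖η‖, with r
= ‖h‖_{-q}² / 2^p. Cauchy–Schwarz over k then gives the constant √(1/(1-r)), from a geometric
series. -/
theorem abs_pairing_le (hT : 0 < T) (hh : MemLp h 2 (volume.restrict (Set.Icc 0 T)))
    (hlt : sobolevNormSq T (-q) h < ENNReal.ofReal ((2 : ℝ) ^ p)) :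
    ∃ C, ∀ η : SimpleElement T p q, ‖pairing p q hh η‖ ≤ C * ‖η‖ := by
  have hS := (hlt.trans ENNReal.ofReal_lt_top).ne
  set S := (sobolevNormSq T (-q) h).toReal with hSdef
  have hS0 : 0 ≤ S := ENNReal.toReal_nonneg
  have h2p : (0 : ℝ) < 2 ^ p := by positivity
  set r := S / 2 ^ p with hr
  have hr0 : 0 ≤ r := by positivity
  have hr1 : r < 1 := by
    rw [hr, div_lt_one h2p]
    exact (ENNReal.lt_ofReal_iff_toReal_lt hS).1 hlt
  refine ⟨√((1 - r)⁻¹), fun η => ?_⟩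
  rw [norm_def, ← Real.sqrt_mul (by simpa using hr1.le), Real.norm_eq_abs]
  refine Real.abs_le_sqrt ?_
  let a : ℕ → ℝ := fun k =>
    √((2 : ℝ) ^ ((k : ℝ) * p) / (k.factorial : ℝ) ^ 2) * kernelNorm T q (η.kernel k).1
  have hterm : ∀ k, |kernelPairing q hh k (η.kernel k)| ≤ √(r ^ k) * a k := by
    intro k
    have hk0 : 0 ≤ kernelNorm T q (η.kernel k).1 := Real.sqrt_nonneg _
    refine abs_le_of_sq_le_sq ?_ (by positivity)
    have hb := sq_setIntegral_mul_le hT q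
      (memLp_of_continuousOn_cube (η.kernel k).2.1.continuousOn) (memLp_prod hh k)
      (η.kernel k).2.2.2.ne
      (by rw [kernelNormSq_prod]; exact ENNReal.pow_ne_top hS)
    rw [kernelNormSq_prod, ENNReal.toReal_pow, ← kernelNorm_sq] at hb
    have e2 : (2 : ℝ) ^ ((k : ℝ) * p) = (2 ^ p) ^ k := by
      rw [mul_comm, Real.rpow_mul (by norm_num), Real.rpow_natCast]
    have hf : (0 : ℝ) < k.factorial := by positivity
    calc (kernelPairing q hh k (η.kernel k)) ^ 2
        = ((k.factorial : ℝ)⁻¹) ^ 2 *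
          (∫ x in cube T k, (η.kernel k).1 x * ∏ j, h (x j)) ^ 2 := by
          rw [← mul_pow]; rfl
      _ ≤ ((k.factorial : ℝ)⁻¹) ^ 2 * (kernelNorm T q (η.kernel k).1 ^ 2 * S ^ k) :=
          mul_le_mul_of_nonneg_left hb (sq_nonneg _)
      _ = (√(r ^ k) * a k) ^ 2 := by
          simp only [a]
          rw [mul_pow, mul_pow, Real.sq_sqrt (by positivity), Real.sq_sqrt (by positivity), e2, hr,
            div_pow]
          field_simp
  have hsum : |pairing p q hh η| ≤ ∑ k ∈ η.support, √(r ^ k) * a k := by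
    rw [pairing_eq_sum hh η subset_rfl]
    exact (Finset.abs_sum_le_sum_abs _ _).trans (Finset.sum_le_sum fun k _ => hterm k)
  have hgeo : ∑ k ∈ η.support, √(r ^ k) ^ 2 ≤ (1 - r)⁻¹ := by
    rw [← tsum_geometric_of_lt_one hr0 hr1, Finset.sum_congr rfl fun k _ =>
      Real.sq_sqrt (pow_nonneg hr0 k)]
    exact (summable_geometric_of_lt_one hr0 hr1).sum_le_tsum _ fun k _ => pow_nonneg hr0 k
  have hnorm : ∑ k ∈ η.support, a k ^ 2 = η.normSq := by
    refine Finset.sum_congr rfl fun k _ => ?_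
    rw [mul_pow, Real.sq_sqrt (by positivity)]
  calc (pairing p q hh η) ^ 2 = |pairing p q hh η| ^ 2 := (sq_abs _).symm
    _ ≤ (∑ k ∈ η.support, √(r ^ k) * a k) ^ 2 := pow_le_pow_left₀ (abs_nonneg _) hsum 2
    _ ≤ _ := Finset.sum_mul_sq_le_sq_mul_sq _ _ _
    _ ≤ (1 - r)⁻¹ * η.normSq := by
      rw [hnorm]
      refine mul_le_mul_of_nonneg_right hgeo ?_
      rw [← hnorm]
      exact Finset.sum_nonneg fun k _ => sq_nonneg _

end SimpleElement

/-! ### Test elements -/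

theorem contDiff_cosBasis (T : ℝ) (n : ℕ) {m : WithTop ℕ∞} : ContDiff ℝ m (cosBasis T n) := by
  unfold cosBasis
  split_ifs
  · exact contDiff_const
  · exact contDiff_const.mul (Real.contDiff_cos.comp
      ((contDiff_const.mul contDiff_id).div_const _))

theorem memLp_cosBasis (T : ℝ) (n : ℕ) :
    MemLp (cosBasis T n) 2 (volume.restrict (Set.Icc 0 T)) := by
  rw [memLp_two_iff_integrable_sq (cosBasis_continuous T n).aestronglyMeasurable]
  exact ((cosBasis_continuous T n).pow 2).continuousOn.integrableOn_compact isCompact_Icc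

/-- The kernel `g ⊗ ⋯ ⊗ g`. -/
def tensorKernel {T q : ℝ} {g : ℝ → ℝ} (hg : ContDiff ℝ ((⊤ : ℕ∞) : WithTop ℕ∞) g)
    (hgq : sobolevNormSq T q g ≠ ∞) (k : ℕ) : smoothKernel T q k :=
  ⟨fun x => ∏ j, g (x j),
    (contDiff_prod fun j _ => hg.comp (contDiff_apply ℝ ℝ j)).contDiffOn,
    fun σ x _ => Equiv.prod_comp σ fun j => g (x j),
    by rw [kernelNormSq_prod]; exact (ENNReal.pow_ne_top hgq).lt_top⟩

theorem kernelNorm_tensorKernel_sq {T q : ℝ} {g : ℝ → ℝ}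
    (hg : ContDiff ℝ ((⊤ : ℕ∞) : WithTop ℕ∞) g) (hgq : sobolevNormSq T q g ≠ ∞) (k : ℕ) :
    kernelNorm T q (tensorKernel hg hgq k).1 ^ 2 = (sobolevNormSq T q g).toReal ^ k := by
  rw [kernelNorm_sq, ← ENNReal.toReal_pow, ← kernelNormSq_prod]
  rfl

theorem kernelPairing_tensorKernel {T q : ℝ} {g h : ℝ → ℝ}
    (hg : ContDiff ℝ ((⊤ : ℕ∞) : WithTop ℕ∞) g) (hgq : sobolevNormSq T q g ≠ ∞)
    (hh : MemLp h 2 (volume.restrict (Set.Icc 0 T))) (k : ℕ) :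
    kernelPairing q hh k (tensorKernel hg hgq k) =
      (k.factorial : ℝ)⁻¹ * (∫ t in Set.Icc 0 T, g t * h t) ^ k := by
  change (k.factorial : ℝ)⁻¹ * ∫ x in cube T k, (∏ j, g (x j)) * ∏ j, h (x j) = _
  simp_rw [← Finset.prod_mul_distrib]
  rw [setIntegral_cube_prod T fun _ t => g t * h t]
  simp

/-- The element with the kernels `k! 2^{-kp} g ⊗ ⋯ ⊗ g`, `k < K`. -/
def testElement {T q : ℝ} (p : ℝ) {g : ℝ → ℝ} (hg : ContDiff ℝ ((⊤ : ℕ∞) : WithTop ℕ∞) g)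
    (hgq : sobolevNormSq T q g ≠ ∞) (K : ℕ) : SimpleElement T p q :=
  DFinsupp.mk (β := fun k => smoothKernel T q k) (Finset.range K) fun k =>
    ((k.1.factorial : ℝ) / ((2 : ℝ) ^ p) ^ k.1) • tensorKernel hg hgq k.1

theorem testElement_support {T q : ℝ} (p : ℝ) {g : ℝ → ℝ}
    (hg : ContDiff ℝ ((⊤ : ℕ∞) : WithTop ℕ∞) g) (hgq : sobolevNormSq T q g ≠ ∞) (K : ℕ) :
    (testElement p hg hgq K).support ⊆ Finset.range K := by
  classical
  exact DFinsupp.support_mk_subset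

theorem testElement_kernel {T q : ℝ} (p : ℝ) {g : ℝ → ℝ}
    (hg : ContDiff ℝ ((⊤ : ℕ∞) : WithTop ℕ∞) g) (hgq : sobolevNormSq T q g ≠ ∞) {K k : ℕ}
    (hk : k ∈ Finset.range K) :
    (testElement p hg hgq K).kernel k =
      ((k.factorial : ℝ) / ((2 : ℝ) ^ p) ^ k) • tensorKernel hg hgq k :=
  DFinsupp.mk_of_mem hk

/-- A bound for geometric sums by a functional that represents `h`. -/
theorem geom_sum_le_of_pairing_le {T p q : ℝ} {g h : ℝ → ℝ}
    (hg : ContDiff ℝ ((⊤ : ℕ∞) : WithTop ℕ∞) g) (hgq : sobolevNormSq T q g ≠ ∞)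
    (hh : MemLp h 2 (volume.restrict (Set.Icc 0 T)))
    (hgh : ∫ t in Set.Icc 0 T, g t * h t = (sobolevNormSq T q g).toReal) {C : ℝ}
    (hC : ∀ η : SimpleElement T p q, |SimpleElement.pairing p q hh η| ≤ C * ‖η‖) (K : ℕ) :
    ∑ k ∈ Finset.range K, ((sobolevNormSq T q g).toReal / 2 ^ p) ^ k ≤ C ^ 2 := by
  set S := (sobolevNormSq T q g).toReal with hS
  have hS0 : 0 ≤ S := ENNReal.toReal_nonneg
  have h2p : (0 : ℝ) < 2 ^ p := by positivity
  set A := ∑ k ∈ Finset.range K, (S / 2 ^ p) ^ k with hA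
  have hA0 : 0 ≤ A := Finset.sum_nonneg fun k _ => by positivity
  -- The weights k! 2^{-kp} are those for which the k-th terms of the pairing and of the squared
  -- norm are both (S/2^p)^k.
  have h1 : SimpleElement.pairing p q hh (testElement p hg hgq K) = A := by
    rw [SimpleElement.pairing_eq_sum hh _ (testElement_support p hg hgq K)]
    refine Finset.sum_congr rfl fun k hk => ?_
    rw [testElement_kernel p hg hgq hk, map_smul, kernelPairing_tensorKernel, hgh, div_pow,
      smul_eq_mul]
    have hf : (0 : ℝ) < k.factorial := by positivity
    field_simp
  have h2 : (testElement p hg hgq K).normSq = A := by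
    rw [SimpleElement.normSq_eq_sum _ (testElement_support p hg hgq K)]
    refine Finset.sum_congr rfl fun k hk => ?_
    rw [testElement_kernel p hg hgq hk, kernelNorm_smul, mul_pow, sq_abs,
      kernelNorm_tensorKernel_sq, ← hS, mul_comm (k : ℝ) p, Real.rpow_mul (by norm_num),
      Real.rpow_natCast, div_pow S]
    have hf : (0 : ℝ) < k.factorial := by positivity
    field_simp
  have h3 := hC (testElement p hg hgq K)
  rw [h1, SimpleElement.norm_def, h2, abs_of_nonneg hA0] at h3
  have h4 := Real.sq_sqrt hA0
  have h5 := Real.sqrt_nonneg A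
  -- The inequality A ≤ C √A may be divided by √A unless A = 0.
  rcases h5.eq_or_lt with h0 | h0
  · rw [← h4, ← h0]; nlinarith [sq_nonneg C]
  · have : √A ≤ C := by
      by_contra hlt
      push Not at hlt
      nlinarith
    rw [← h4]
    exact pow_le_pow_left₀ h5 this 2

/-- The truncation of `Λ^{-q} h` to the first `N` basis functions. -/
def truncation (T q : ℝ) (h : ℝ → ℝ) (N : ℕ) (t : ℝ) : ℝ :=
  ∑ n ∈ Finset.range N, eigenvalue n ^ (-q) * cosCoef T h n * cosBasis T n t

theorem contDiff_truncation (T q : ℝ) (h : ℝ → ℝ) (N : ℕ) {m : WithTop ℕ∞} :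
    ContDiff ℝ m (truncation T q h N) :=
  ContDiff.sum fun n _ => contDiff_const.mul (contDiff_cosBasis T n)

theorem integral_truncation_mul {T : ℝ} (q : ℝ) {h u : ℝ → ℝ} (N : ℕ)
    (hu : MemLp u 2 (volume.restrict (Set.Icc 0 T))) :
    ∫ t in Set.Icc 0 T, truncation T q h N t * u t =
      ∑ n ∈ Finset.range N, eigenvalue n ^ (-q) * cosCoef T h n * cosCoef T u n := by
  have e : ∀ t, truncation T q h N t * u t = ∑ n ∈ Finset.range N,
      eigenvalue n ^ (-q) * cosCoef T h n * (u t * cosBasis T n t) := by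
    intro t
    rw [truncation, Finset.sum_mul]
    exact Finset.sum_congr rfl fun n _ => by ring
  have hi : ∀ n, IntegrableOn (fun t => u t * cosBasis T n t) (Set.Icc 0 T) := fun n =>
    hu.integrable_mul (memLp_cosBasis T n)
  simp_rw [e]
  rw [integral_finsetSum _ fun n _ => (hi n).const_mul _]
  exact Finset.sum_congr rfl fun n _ => by rw [integral_const_mul]; rfl

theorem cosCoef_truncation {T : ℝ} (hT : 0 < T) (q : ℝ) (h : ℝ → ℝ) (N n : ℕ) :
    cosCoef T (truncation T q h N) n =
      if n ∈ Finset.range N then eigenvalue n ^ (-q) * cosCoef T h n else 0 := by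
  rw [cosCoef, integral_truncation_mul q N (memLp_cosBasis T n)]
  have : ∀ m, cosCoef T (cosBasis T n) m = if n = m then 1 else 0 :=
    fun m => integral_cosBasis_mul hT n m
  simp_rw [this, mul_ite, mul_one, mul_zero]
  rw [Finset.sum_ite_eq]

/-- The weights combine as λ^q (λ^{-q})² = λ^{-q}, so the result is a partial sum of ‖h‖_{-q}². It
is also the pairing of the truncation with `h`, which is what the test elements require. -/
theorem sobolevNormSq_truncation {T : ℝ} (hT : 0 < T) (q : ℝ) (h : ℝ → ℝ) (N : ℕ) :
    sobolevNormSq T q (truncation T q h N) =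
      ENNReal.ofReal (∑ n ∈ Finset.range N, eigenvalue n ^ (-q) * cosCoef T h n ^ 2) := by
  have e : ∀ n, ∫ t in Set.Icc 0 T, truncation T q h N t * cosBasis T n t =
      if n ∈ Finset.range N then eigenvalue n ^ (-q) * cosCoef T h n else 0 :=
    cosCoef_truncation hT q h N
  rw [sobolevNormSq, ENNReal.ofReal_sum_of_nonneg fun n _ => mul_nonneg
    (Real.rpow_nonneg (eigenvalue_pos n).le _) (sq_nonneg _),
    tsum_eq_sum (s := Finset.range N) fun n hn => by rw [e, if_neg hn]; simp]
  refine Finset.sum_congr rfl fun n hn => ?_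
  rw [e, if_pos hn]
  congr 1
  have : eigenvalue n ^ q * eigenvalue n ^ (-q) = 1 := by
    rw [← Real.rpow_add (eigenvalue_pos n), add_neg_cancel, Real.rpow_zero]
  calc _ = (eigenvalue n ^ q * eigenvalue n ^ (-q)) *
        (eigenvalue n ^ (-q) * cosCoef T h n ^ 2) := by ring
    _ = _ := by rw [this, one_mul]

theorem sobolevNormSq_lt_of_pairing_le {T p q : ℝ} (hT : 0 < T) {h : ℝ → ℝ}
    (hh : MemLp h 2 (volume.restrict (Set.Icc 0 T))) {C : ℝ}
    (hC : ∀ η : SimpleElement T p q, |SimpleElement.pairing p q hh η| ≤ C * ‖η‖) :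
    sobolevNormSq T (-q) h < ENNReal.ofReal ((2 : ℝ) ^ p) := by
  have h2p : (0 : ℝ) < 2 ^ p := by positivity
  by_contra hlt
  push Not at hlt
  -- With this ratio the geometric series sums to C² + 1, just above the admissible bound C².
  set δ : ℝ := 1 - (C ^ 2 + 1)⁻¹ with hδ
  have hC1 : 0 < C ^ 2 + 1 := by positivity
  have hδ1 : δ < 1 := by
    have : 0 < (C ^ 2 + 1)⁻¹ := by positivity
    linarith
  have hδ0 : 0 ≤ δ := by
    have : (C ^ 2 + 1)⁻¹ ≤ 1 := inv_le_one_of_one_le₀ (by nlinarith [sq_nonneg C])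
    linarith
  -- Since δ < 1 the inequality is strict, so a finite partial sum already exceeds δ 2^p, whether
  -- the full norm is finite or not.
  have hlt' : ENNReal.ofReal (δ * 2 ^ p) < sobolevNormSq T (-q) h :=
    ((ENNReal.ofReal_lt_ofReal_iff h2p).2 (by nlinarith)).trans_le hlt
  rw [sobolevNormSq, ENNReal.tsum_eq_iSup_nat, lt_iSup_iff] at hlt'
  obtain ⟨N, hN⟩ := hlt'
  have hnn : ∀ n, 0 ≤ eigenvalue n ^ (-q) * cosCoef T h n ^ 2 := fun n =>
    mul_nonneg (Real.rpow_nonneg (eigenvalue_pos n).le _) (sq_nonneg _)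
  set S := ∑ n ∈ Finset.range N, eigenvalue n ^ (-q) * cosCoef T h n ^ 2 with hS
  have hS0 : 0 ≤ S := Finset.sum_nonneg fun n _ => hnn n
  have hδS : δ < S / 2 ^ p := by
    rw [lt_div_iff₀ h2p]
    change _ < ∑ n ∈ Finset.range N, ENNReal.ofReal (eigenvalue n ^ (-q) * cosCoef T h n ^ 2) at hN
    rw [← ENNReal.ofReal_sum_of_nonneg fun n _ => hnn n] at hN
    exact (ENNReal.ofReal_lt_ofReal_iff_of_nonneg (by positivity)).1 hN
  have hnorm := sobolevNormSq_truncation hT q h N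
  have htop : sobolevNormSq T q (truncation T q h N) ≠ ∞ := by
    rw [hnorm]; exact ENNReal.ofReal_ne_top
  have hreal : (sobolevNormSq T q (truncation T q h N)).toReal = S := by
    rw [hnorm, ENNReal.toReal_ofReal hS0]
  have hgeo : ∀ K, ∑ k ∈ Finset.range K, δ ^ k ≤ C ^ 2 := by
    intro K
    have := geom_sum_le_of_pairing_le (contDiff_truncation T q h N) htop hh
      (by rw [integral_truncation_mul q N hh, hreal]
          exact Finset.sum_congr rfl fun n _ => by ring) hC K
    rw [hreal] at this
    exact (Finset.sum_le_sum fun k _ => pow_le_pow_left₀ hδ0 hδS.le k).trans this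
  have := Real.tsum_le_of_sum_range_le (fun k => pow_nonneg hδ0 k) hgeo
  rw [tsum_geometric_of_lt_one hδ0 hδ1, hδ, sub_sub_cancel, inv_inv] at this
  linarith

end

end WienerChaos

/-! ### The equivalence -/

theorem mainTheorem3 {Ω : Type*} [mΩ : MeasurableSpace Ω] (P : Measure Ω) [IsProbabilityMeasure P]
    (T : ℝ) (hT : 0 < T) (𝓕 : Filtration ℝ mΩ) (W : ℝ → Ω → ℝ)
    (hW : WienerChaos.IsWienerProcess P T 𝓕 W)
    (h : ℝ → ℝ) (hh : MemLp h 2 (volume.restrict (Set.Ioo 0 T))) (p q : ℝ) :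
    WienerChaos.MemDual P T 𝓕 W p q (WienerChaos.stochExp P T 𝓕 W h) ↔
      WienerChaos.sobolevNormSq T (-q) h < ENNReal.ofReal ((2 : ℝ) ^ p) := by
  rw [Measure.restrict_congr_set Ioo_ae_eq_Icc] at hh
  have hpair := fun η : WienerChaos.SimpleElement T p q =>
    WienerChaos.SimpleElement.integral_toLp_mul_stochExp hW hT.le hh η
  constructor
  · rintro ⟨-, -, ℓ, hℓ⟩
    -- The embedding into the completion preserves norms, so the operator norm of ℓ bounds the
    -- pairing on finite expansions.
    refine WienerChaos.sobolevNormSq_lt_of_pairing_le hT hh (C := ‖ℓ‖) fun η => ?_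
    rw [← hpair η, ← hℓ η, ← Real.norm_eq_abs, ← UniformSpace.Completion.norm_coe η]
    exact ℓ.le_opNorm _
  · intro hlt
    obtain ⟨C, hC⟩ := WienerChaos.SimpleElement.abs_pairing_le hT hh hlt
    refine ⟨WienerChaos.memLp_stochExp hW hT.le hh, ?_, ?_⟩
    · rw [WienerChaos.stochExp_eq]
      exact (Real.continuous_exp.comp_aestronglyMeasurable
        (WienerChaos.aestronglyMeasurable_wienerSigma hW hT.le hh)).const_mul _
    · let ψ : WienerChaos.SimpleElement T p q →L[ℝ] ℝ :=
        (WienerChaos.SimpleElement.pairing p q hh).mkContinuous C hC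
      -- A bounded functional on the finite expansions, dense in their completion, extends
      -- continuously to it.
      refine ⟨ψ.extend UniformSpace.Completion.toComplL, fun η => ?_⟩
      rw [hpair η]
      exact ContinuousLinearMap.extend_eq ψ (UniformSpace.Completion.denseRange_coe)
        (UniformSpace.Completion.isUniformInducing_coe _) η
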